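/- Let $\mathfrak g$ be a finite-dimensional simple complex Lie algebra with Cartan subalgebra $\mathfrak h$ and a Borel (i.e. maximal solvable) subalgebra $\mathfrak b\supseteq\mathfrak h$. For a subalgebra $\mathfrak s\supseteq\mathfrak h$ (a *root subalgebra*) let $\Delta(\mathfrak s)\subset\mathfrak h^*\setminus\{0\}$ be the set of roots $\alpha$ of $\mathfrak g$ with root space $\mathfrak g^\alpha\subseteq\mathfrak s$. Let $\mathfrak l\supseteq\mathfrak h$ be a root subalgebra. Put $\Delta(\mathfrak k)=\{\alpha\in\Delta(\mathfrak l):-\alpha\in\Delta(\mathfrak l)\}$, $\Delta(\mathfrak n)=\Delta(\mathfrak l)\setminus\Delta(\mathfrak k)$, $\mathfrak k=\mathfrak h\oplus\bigoplus_{\alpha\in\Delta(\mathfrak k)}\mathfrak g^\alpha$ and $\mathfrak n=\bigoplus_{\alpha\in\Delta(\mathfrak n)}\mathfrak g^\alpha$. For a reductive root subalgebra $\mathfrak t\supseteq\mathfrak l'\supseteq\mathfrak h$, where $\mathfrak l'$ is a root subalgebra with associated $\mathfrak k',\mathfrak n'$, put $$\mathrm{Sing}_{\mathfrak b\cap\mathfrak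 k'}(\mathfrak t/\mathfrak l')=\{\alpha\in\Delta(\mathfrak t)\setminus\Delta(\mathfrak l') : \alpha+\delta\notin\Delta(\mathfrak t)\ \text{for all}\ \delta\in\Delta(\mathfrak b)\cap\Delta(\mathfrak k')\}.$$ (Here "reductive" means $\Delta(\mathfrak t)=-\Delta(\mathfrak t)$.) Let $\mathrm{Cone}_{\mathbb Q}(I)$ and $\mathrm{Cone}_{\mathbb Z}(I)$ be the $\mathbb Q_{\ge 0}$-span and the $\mathbb Z_{\ge 0}$-span of $I$. * $\mathfrak l$ satisfies the *cone condition* if $\mathrm{Cone}_{\mathbb Q}(\Delta(\mathfrak n))\cap\mathrm{Cone}_{\mathbb Q}(\mathrm{Sing}_{\mathfrak b\cap\mathfrak k}(\mathfrak g/\mathfrak l))=\{0\}$. * A weight $\omega\in\mathfrak h^*$ is *$\mathfrak l'$-strictly infinite in $\mathfrak t$* if (i) $0\ne\omega\in\mathrm{Cone}_{\mathbb Z}(\mathrm{Sing}_{\mathfrak b\cap\mathfrak k'}(\mathfrak t/\mathfrak l'))\cap\mathrm{Cone}_{\mathbb Z}(\Delta(\mathfrak n'))$; (ii) $\omega=\sum_i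 a_i\alpha_i$ for some positive integers $a_i$ and some $\alpha_i\in\mathrm{Sing}_{\mathfrak b\cap\mathfrak k'}(\mathfrak t/\mathfrak l')$ with $[\mathfrak g^{\alpha_i},\mathfrak n']\subseteq\mathfrak n'$ for all $i$; (iii) $\omega=\sum_i b_i\beta_i$ for some positive integers $b_i$ and some $\beta_i\in\Delta(\mathfrak n')$ that are pairwise strongly orthogonal, i.e. for $i\neq j$ neither $\beta_i+\beta_j$ nor $\beta_i-\beta_j$ lies in $\Delta(\mathfrak t)\cup\{0\}$. It is *$\mathfrak l$-strictly infinite* if it is $\mathfrak l$-strictly infinite in $\mathfrak g$. * $\omega$ is *$\mathfrak l$-infinite* if there is a reductive root subalgebra $\mathfrak t\supseteq\mathfrak k$ such that $\omega$ is $(\mathfrak l\cap\mathfrak t)$-strictly infinite in $\mathfrak t$. Suppose that $\mathfrak l$ does not satisfy the cone condition. Then: * if $\mathfrak g\simeq\mathfrak{sl}(n)$, $\mathfrak{so}(2n+1)$ or $\mathfrak{so}(2n)$ for some $n$, there exists an $\mathfrak l$-strictly infinite weight; * if $\mathfrak g\simeq\mathfrak{sp}(2n)$ for some $n$, there exists an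 $\mathfrak l$-infinite weight. -/

import Mathlib

namespace RootSubalgebra

open LieAlgebra

variable {L : Type*} [LieRing L] [LieAlgebra ℂ L] (H : LieSubalgebra ℂ L) [LieRing.IsNilpotent H]

/-- `Δ(s)`: the nonzero `α ∈ 𝔥*` whose root space `𝔤^α` is nonzero and contained in `s`.
In particular `roots H ⊤` is `Δ(𝔤)`. -/
def roots (s : LieSubalgebra ℂ L) : Set (Module.Dual ℂ H) :=
  {α | α ≠ 0 ∧ rootSpace H α ≠ ⊥ ∧ (rootSpace H α).toSubmodule ≤ s.toSubmodule}

/-- `Δ(𝔨)`: the roots `α` of `l` such that `-α` is also a root of `l`. -/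
def leviRoots (l : LieSubalgebra ℂ L) : Set (Module.Dual ℂ H) :=
  {α ∈ roots H l | -α ∈ roots H l}

/-- `Δ(𝔫) = Δ(l) \ Δ(𝔨)`. -/
def nilRoots (l : LieSubalgebra ℂ L) : Set (Module.Dual ℂ H) :=
  roots H l \ leviRoots H l

/-- The reductive part `𝔨 = 𝔥 ⊕ ⨁_{α ∈ Δ(𝔨)} 𝔤^α` of `l`, as a subspace of `𝔤`. -/
def levi (l : LieSubalgebra ℂ L) : Submodule ℂ L :=
  H.toSubmodule ⊔ ⨆ α ∈ leviRoots H l, (rootSpace H α).toSubmodule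

/-- The nilradical `𝔫 = ⨁_{α ∈ Δ(𝔫)} 𝔤^α` of `l`, as a subspace of `𝔤`. -/
def nil (l : LieSubalgebra ℂ L) : Submodule ℂ L :=
  ⨆ α ∈ nilRoots H l, (rootSpace H α).toSubmodule

/-- A root subalgebra `t` (a subalgebra containing `𝔥`) that is reductive, i.e. equal to its own
reductive part: its set of roots is stable under `α ↦ -α`. -/
def IsReductiveRootSubalgebra (t : LieSubalgebra ℂ L) : Prop :=
  H ≤ t ∧ ∀ α ∈ roots H t, -α ∈ roots H t

/-- A Borel subalgebra: a maximal solvable subalgebra. -/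
def IsBorel (b : LieSubalgebra ℂ L) : Prop :=
  Maximal (fun s : LieSubalgebra ℂ L => IsSolvable s) b

/-- `Sing_{b ∩ 𝔨}(t / l)`, for root subalgebras `l ≤ t`, where `𝔨` is the reductive part of `l`. -/
def sing (t b l : LieSubalgebra ℂ L) : Set (Module.Dual ℂ H) :=
  {α ∈ roots H t \ roots H l | ∀ δ ∈ roots H b ∩ leviRoots H l, α + δ ∉ roots H t}

/-- The cone condition:
`Cone_ℚ(Δ(𝔫)) ∩ Cone_ℚ(Sing_{b ∩ 𝔨}(𝔤 / l)) = {0}`. -/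
def ConeCondition (b l : LieSubalgebra ℂ L) : Prop :=
  (Submodule.span ℚ≥0 (nilRoots H l) : Set (Module.Dual ℂ H)) ∩
    (Submodule.span ℚ≥0 (sing H ⊤ b l) : Set (Module.Dual ℂ H)) = {0}

/-- Strong orthogonality of `α` and `β` with respect to the root system of `t`:
neither `α + β` nor `α - β` is a root of `t` or zero. -/
def StronglyOrthogonal (t : LieSubalgebra ℂ L) (α β : Module.Dual ℂ H) : Prop :=
  α + β ∉ roots H t ∧ α + β ≠ 0 ∧ α - β ∉ roots H t ∧ α - β ≠ 0

/-- `ω` is a combination, with positive integer coefficients, of pairwise strongly orthogonal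
elements of `I`. -/
def HasStronglyOrthogonalDecomposition (t : LieSubalgebra ℂ L) (I : Set (Module.Dual ℂ H))
    (ω : Module.Dual ℂ H) : Prop :=
  ∃ (s : Finset (Module.Dual ℂ H)) (c : Module.Dual ℂ H → ℕ),
    (s : Set (Module.Dual ℂ H)) ⊆ I ∧ (∀ β ∈ s, 0 < c β) ∧
    (s : Set (Module.Dual ℂ H)).Pairwise (StronglyOrthogonal H t) ∧
    ω = ∑ β ∈ s, c β • β

/-- `ω` is two-sided with respect to the root subalgebra `l` of the ambient algebra `t`:
`ω` is nonzero and lies in `Cone_ℤ(Sing_{b ∩ 𝔨}(t / l)) ∩ Cone_ℤ(Δ(𝔫))`, and it has an expression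
as a non-negative integer combination of roots `α ∈ Sing_{b ∩ 𝔨}(t / l)` that satisfy
`[𝔤^α, 𝔫] ⊆ 𝔫`. -/
def IsTwoSided (t b l : LieSubalgebra ℂ L) (ω : Module.Dual ℂ H) : Prop :=
  ω ≠ 0 ∧ ω ∈ AddSubmonoid.closure (sing H t b l) ∧ ω ∈ AddSubmonoid.closure (nilRoots H l) ∧
    ω ∈ AddSubmonoid.closure
      {α ∈ sing H t b l | ∀ x ∈ rootSpace H α, ∀ y ∈ nil H l, ⁅x, y⁆ ∈ nil H l}

/-- `ω` is `l`-strictly infinite in the ambient algebra `t` (with Borel subalgebra `b`). -/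
def IsStrictlyInfinite (t b l : LieSubalgebra ℂ L) (ω : Module.Dual ℂ H) : Prop :=
  IsTwoSided H t b l ω ∧ HasStronglyOrthogonalDecomposition H t (nilRoots H l) ω

/-- `ω` is `l`-infinite: for some reductive root subalgebra `t` containing the reductive part `𝔨`
of `l`, the weight `ω` is `(l ∩ t)`-strictly infinite in `t`. -/
def IsInfinite (b l : LieSubalgebra ℂ L) (ω : Module.Dual ℂ H) : Prop :=
  ∃ t : LieSubalgebra ℂ L, IsReductiveRootSubalgebra H t ∧ levi H l ≤ t.toSubmodule ∧
    IsStrictlyInfinite H t (b ⊓ t) (l ⊓ t) ω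

end RootSubalgebra

/-! Clearing denominators, a failure of the cone condition is a relation: a sum of singular roots
equals a nonempty sum of roots of the nilradical (`Rel`). The core of the proof is that, for
classical root systems, such a relation forces a pair of singular roots whose nonzero sum already
lies in the cone of the nilradical (`HasPair`).

This is first proved for the roots of a system of type D lying in a subgroup
(`RootCone.hasPair_of_rel`), which also covers type A. Roots are edges `v + w` on the vertices
`±e_i`. In a shortest relation no two distinct summands on the same side add up to a root or to
zero, so a vertex and its negative can occur on one side only in edges `a + b`, `-a + b` with the
same other end. Following ends of edges from one side of the relation to the other then produces a
pair. Types B and C are reduced to this by folding: B is an image of D of rank one higher, and C an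
image of A. A folding pulls nilradical and singular sets back to their preimages and lets relations
be lifted after doubling.

Among all pairs, one whose sum is maximal for the order given by the cone of the nilradical
normalizes the nilradical (`exists_normalizing_pair`). Its sum is then written with as few
nilradical roots as possible, so that distinct summands never add up to a root. If two of them have
a difference that is a root, then in types A, B and D one of them is long, and pairing with its
coroot gives at least 3 on one side and at most 2 on the other (`exists_orthogonal`).

In type C this can fail, but only for `2q + (u + w) = (q + u) + (q + w)`. There a smallest symmetric
closed set of roots is chosen that contains the roots of the Levi part and still carries a pair; the
exceptional relation would give a pair in a smaller set (`exists_symplectic`). The chosen set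
defines the reductive subalgebra in the definition of an infinite weight.

The Lie-theoretic input is that roots of a subalgebra form a closed set, that a Borel subalgebra
cuts out a positive system of the Levi part, and that for an arbitrary Cartan subalgebra the roots
are read off from the weights of the natural representation. -/

namespace RootCone

/-! ### Finite root sets, closed subsets and shortest relations. -/

variable {M : Type*} [AddCommGroup M]

/-- A finite set of roots `Φ` stable under negation, together with an additive functional `p x`
for each root `x`, which has the sign properties of the pairing with the coroot of `x`. -/
structure IsRootSet (Φ : Set M) (p : M → M →+ ℝ) : Prop where
  finite : Φ.Finite
  neg_mem : ∀ x ∈ Φ, -x ∈ Φ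
  self_pos : ∀ x ∈ Φ, 0 < p x x
  pos_symm : ∀ x ∈ Φ, ∀ y ∈ Φ, 0 < p x y → 0 < p y x
  neg_symm : ∀ x ∈ Φ, ∀ y ∈ Φ, p x y < 0 → p y x < 0
  add_mem : ∀ x ∈ Φ, ∀ y ∈ Φ, p x y < 0 → x + y ∈ Φ ∨ x + y = 0

/-- The elements of `S` whose negative is in `S`. -/
def leviSet (S : Set M) : Set M := {x ∈ S | -x ∈ S}

/-- The elements of `S` whose negative is not in `S`. -/
def nilSet (S : Set M) : Set M := {x ∈ S | -x ∉ S}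

/-- The roots outside `S` that are singular with respect to `P`. -/
def singSet (Φ S P : Set M) : Set M := {x ∈ Φ \ S | ∀ δ ∈ P, x + δ ∉ Φ}

/-- A subset of `Φ` that is closed under those sums that are in `Φ`. -/
def IsClosedIn (Φ S : Set M) : Prop := S ⊆ Φ ∧ ∀ x ∈ S, ∀ y ∈ S, x + y ∈ Φ → x + y ∈ S

/-- `S` is a closed set of roots and `P` a positive system of `leviSet S`. -/
structure IsConfig (Φ S P : Set M) : Prop where
  closed : IsClosedIn Φ S
  pos_closed : IsClosedIn Φ P
  pos_subset : P ⊆ leviSet S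
  pos_or_neg : ∀ x ∈ leviSet S, x ∈ P ∨ -x ∈ P
  neg_notMem : ∀ x ∈ P, -x ∉ P

/-- There are two singular roots whose sum is a nonzero sum of elements of `nilSet S`. -/
def HasPair (Φ S P : Set M) : Prop :=
  ∃ x ∈ singSet Φ S P, ∃ y ∈ singSet Φ S P,
    x + y ≠ 0 ∧ x + y ∈ AddSubmonoid.closure (nilSet S)

variable {Φ S P Q : Set M} {p : M → M →+ ℝ}

theorem exists_pos_of_sum_pos (f : M →+ ℝ) (s : Multiset M) (h : 0 < f s.sum) :
    ∃ x ∈ s, 0 < f x := by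
  by_contra! hc
  have : 0 ≤ (s.map (-f)).sum := by
    apply Multiset.sum_nonneg
    intro x hx
    obtain ⟨y, hy, rfl⟩ := Multiset.mem_map.1 hx
    simpa using hc y hy
  rw [← map_multiset_sum, AddMonoidHom.neg_apply] at this
  linarith

theorem exists_neg_of_sum_neg (f : M →+ ℝ) (s : Multiset M) (h : f s.sum < 0) :
    ∃ x ∈ s, f x < 0 := by
  obtain ⟨x, hx, h'⟩ := exists_pos_of_sum_pos (-f) s (by simpa using h)
  exact ⟨x, hx, by simpa using h'⟩

theorem multiset_sum_mem_closure {s : Multiset M} (hs : ∀ x ∈ s, x ∈ Q) :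
    s.sum ∈ AddSubmonoid.closure Q :=
  AddSubmonoid.multiset_sum_mem _ _ fun x hx => AddSubmonoid.subset_closure (hs x hx)

namespace IsRootSet

variable (hΦ : IsRootSet Φ p)
include hΦ

theorem ne_zero {x : M} (hx : x ∈ Φ) : x ≠ 0 := by
  rintro rfl
  simpa using hΦ.self_pos _ hx

theorem sub_mem {x y : M} (hx : x ∈ Φ) (hy : y ∈ Φ) (h : 0 < p x y) :
    x - y ∈ Φ ∨ x - y = 0 := by
  rw [sub_eq_add_neg]
  exact hΦ.add_mem x hx _ (hΦ.neg_mem y hy) (by simpa using h)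

theorem nonneg_of_add_notMem {x y : M} (hx : x ∈ Φ) (hy : y ∈ Φ) (h : x + y ∉ Φ)
    (h0 : x + y ≠ 0) : 0 ≤ p x y := by
  by_contra! hc
  exact (hΦ.add_mem x hx y hy hc).elim h h0

/-- If neither `x + d` nor `y + d` were a root, `x + y + d` would pair nonpositively with `x` and
`y`, hence `x + y` would pair negatively with `d`; but `d` pairs nonnegatively with both `x` and
`y`. This is how singularity passes to sums. -/
theorem add_mem_of_add_add_mem {x y d : M} (hx : x ∈ Φ) (hy : y ∈ Φ) (hd : d ∈ Φ)
    (hxy : x + y ∈ Φ) (hxyd : x + y + d ∈ Φ) (hxd : x + d ∉ Φ) (hxd0 : x + d ≠ 0)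
    (hyd0 : y + d ≠ 0) : y + d ∈ Φ := by
  by_contra hyd
  have h1 : p (x + y + d) x ≤ 0 := by
    by_contra! hc
    have := hΦ.sub_mem hxyd hx hc
    rw [show x + y + d - x = y + d by abel] at this
    exact this.elim hyd hyd0
  have h2 : p (x + y + d) y ≤ 0 := by
    by_contra! hc
    have := hΦ.sub_mem hxyd hy hc
    rw [show x + y + d - y = x + d by abel] at this
    exact this.elim hxd hxd0
  have h3 : p (x + y) (x + y + d) ≤ 0 := by
    by_contra! hc
    have := hΦ.pos_symm _ hxy _ hxyd hc
    rw [map_add] at this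
    linarith
  have h4 : p (x + y) d < 0 := by
    have := hΦ.self_pos _ hxy
    rw [map_add] at h3
    linarith
  have h5 := hΦ.neg_symm _ hxy _ hd h4
  rw [map_add] at h5
  have h6 := hΦ.nonneg_of_add_notMem hd hx (by rwa [add_comm]) (by rwa [add_comm])
  have h7 := hΦ.nonneg_of_add_notMem hd hy (by rwa [add_comm]) (by rwa [add_comm])
  linarith

/-- In a vanishing sum each summand `x` pairs negatively with some other summand `y`, and the two
merge into `x + y ∈ Q`; induction on the length. -/
theorem sum_ne_zero (hQ : IsClosedIn Φ Q) (hneg : ∀ x ∈ Q, -x ∉ Q) :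
    ∀ s : Multiset M, (∀ x ∈ s, x ∈ Q) → s ≠ 0 → s.sum ≠ 0 := by
  intro s
  induction hn : s.card using Nat.strong_induction_on generalizing s with
  | _ n ih =>
    intro hs hs0 hsum
    obtain ⟨x, hx⟩ := Multiset.exists_mem_of_ne_zero hs0
    obtain ⟨t, rfl⟩ := Multiset.exists_cons_of_mem hx
    have hxΦ := hQ.1 (hs x hx)
    rw [Multiset.sum_cons] at hsum
    have h1 : p x t.sum < 0 := by
      have := congrArg (p x) hsum
      rw [map_add, map_zero] at this
      linarith [hΦ.self_pos x hxΦ]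
    obtain ⟨y, hy, hxy⟩ := exists_neg_of_sum_neg _ _ h1
    obtain ⟨u, rfl⟩ := Multiset.exists_cons_of_mem hy
    have hyQ := hs y (by simp)
    rcases hΦ.add_mem x hxΦ y (hQ.1 hyQ) hxy with h | h
    · refine ih ((x + y) ::ₘ u).card ?_ ((x + y) ::ₘ u) rfl ?_ (by simp) ?_
      · rw [← hn]; simp
      · intro z hz
        rcases Multiset.mem_cons.1 hz with rfl | hz
        · exact hQ.2 x (hs x hx) y hyQ h
        · exact hs z (by simp [hz])
      · rw [← hsum]; simp [add_assoc]
    · exact hneg x (hs x hx) (by rwa [neg_eq_of_add_eq_zero_right h])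

theorem ne_zero_of_mem_closure_add (hQ : IsClosedIn Φ Q) (hneg : ∀ x ∈ Q, -x ∉ Q) {x y : M}
    (hx : x ∈ AddSubmonoid.closure Q) (hy : y ∈ AddSubmonoid.closure Q) (hx0 : x ≠ 0) :
    x + y ≠ 0 := by
  obtain ⟨s, hs, rfl⟩ := AddSubmonoid.exists_multiset_of_mem_closure hx
  obtain ⟨t, ht, rfl⟩ := AddSubmonoid.exists_multiset_of_mem_closure hy
  rw [← Multiset.sum_add]
  refine hΦ.sum_ne_zero hQ hneg _ ?_ ?_
  · intro z hz
    rcases Multiset.mem_add.1 hz with h | h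
    exacts [hs z h, ht z h]
  · intro h
    apply hx0
    have : s = 0 := by
      rw [← Multiset.card_eq_zero] at h ⊢
      simp at h
      simp [h]
    simp [this]

/-- The cone of `Q` contains no two opposite nonzero elements, so it orders `M`. All later extremal
choices use this order, with `Q` a positive system of the Levi part, the nilradical, or the negative
of a set of roots. -/
theorem exists_maximal (hQ : IsClosedIn Φ Q) (hneg : ∀ x ∈ Q, -x ∉ Q) {T : Set M}
    (hT : T.Finite) (hne : T.Nonempty) :
    ∃ t ∈ T, ∀ q ∈ AddSubmonoid.closure Q, q ≠ 0 → t + q ∉ T := by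
  let _ : Preorder M :=
    { le := fun a b => b - a ∈ AddSubmonoid.closure Q
      le_refl := fun a => by simp
      le_trans := fun a b c h h' => by
        have := AddSubmonoid.add_mem _ h h'
        rwa [show b - a + (c - b) = c - a by abel] at this }
  obtain ⟨t, ht⟩ := hT.exists_maximal hne
  refine ⟨t, ht.1, fun q hq hq0 hc => ?_⟩
  have h1 : t + q ≤ t := ht.2 hc (show t + q - t ∈ _ by simpa using hq)
  have h2 : -q ∈ AddSubmonoid.closure Q := by
    have : t - (t + q) ∈ AddSubmonoid.closure Q := h1
    rwa [show t - (t + q) = -q by abel] at this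
  exact hΦ.ne_zero_of_mem_closure_add hQ hneg hq h2 hq0 (by simp)

/-- A root that is a sum pairs positively with one of its summands; removing that summand leaves a
shorter sum that is zero or again a root. -/
theorem sum_mem_of_sum_mem (hQ : IsClosedIn Φ Q) :
    ∀ s : Multiset M, (∀ x ∈ s, x ∈ Q) → s.sum ∈ Φ → s.sum ∈ Q := by
  intro s
  induction hn : s.card using Nat.strong_induction_on generalizing s with
  | _ n ih =>
    intro hs hsum
    obtain ⟨x, hx, hpos⟩ := exists_pos_of_sum_pos (p s.sum) s (hΦ.self_pos _ hsum)
    obtain ⟨t, rfl⟩ := Multiset.exists_cons_of_mem hx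
    have hxQ := hs x hx
    rw [Multiset.sum_cons] at *
    rcases hΦ.sub_mem hsum (hQ.1 hxQ) hpos with h | h
    · rw [add_sub_cancel_left] at h
      have := ih t.card (by rw [← hn]; simp) t rfl (fun y hy => hs y (by simp [hy])) h
      exact hQ.2 x hxQ _ this hsum
    · rw [add_sub_cancel_left] at h
      rw [h, add_zero]
      exact hxQ

theorem mem_of_mem_closure (hQ : IsClosedIn Φ Q) {x : M} (hx : x ∈ AddSubmonoid.closure Q)
    (hxΦ : x ∈ Φ) : x ∈ Q := by
  obtain ⟨s, hs, rfl⟩ := AddSubmonoid.exists_multiset_of_mem_closure hx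
  exact hΦ.sum_mem_of_sum_mem hQ s hs hxΦ

end IsRootSet

theorem mem_leviSet_neg {x : M} (hx : x ∈ leviSet S) : -x ∈ leviSet S :=
  ⟨hx.2, by simpa using hx.1⟩

theorem notMem_leviSet_of_mem_nilSet {x : M} (hx : x ∈ nilSet S) : x ∉ leviSet S :=
  fun h => hx.2 h.2

theorem notMem_nilSet_of_mem_singSet {x : M} (hx : x ∈ singSet Φ S P) : x ∉ nilSet S :=
  fun hn => hx.1.2 hn.1

theorem neg_notMem_nilSet {x : M} (hx : x ∈ nilSet S) : -x ∉ nilSet S := fun h => hx.2 h.1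

theorem mem_levi_or_nil {x : M} (hx : x ∈ S) : x ∈ leviSet S ∨ x ∈ nilSet S := by
  by_cases h : -x ∈ S
  exacts [Or.inl ⟨hx, h⟩, Or.inr ⟨hx, h⟩]

/-- The root system `Φ` is closed under negation and `S` is closed in it. -/
theorem nil_add_mem (hneg : ∀ x ∈ Φ, -x ∈ Φ) (hS : IsClosedIn Φ S) {x y : M}
    (hx : x ∈ nilSet S) (hy : y ∈ S) (hxy : x + y ∈ Φ) : x + y ∈ nilSet S := by
  refine ⟨hS.2 x hx.1 y hy hxy, fun h => hx.2 ?_⟩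
  have := hS.2 _ h y hy
  rw [show -(x + y) + y = -x by abel] at this
  exact this (hneg x (hS.1 hx.1))

theorem levi_add_mem (hneg : ∀ x ∈ Φ, -x ∈ Φ) (hS : IsClosedIn Φ S) {x y : M}
    (hx : x ∈ leviSet S) (hy : y ∈ leviSet S) (hxy : x + y ∈ Φ) : x + y ∈ leviSet S := by
  refine ⟨hS.2 x hx.1 y hy.1 hxy, ?_⟩
  have := hS.2 _ hx.2 _ hy.2
  rw [show -x + -y = -(x + y) by abel] at this
  exact this (hneg _ hxy)

theorem nil_closed (hneg : ∀ x ∈ Φ, -x ∈ Φ) (hS : IsClosedIn Φ S) : IsClosedIn Φ (nilSet S) :=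
  ⟨fun _ hx => hS.1 hx.1, fun _ hx _ hy h => nil_add_mem hneg hS hx hy.1 h⟩

/-- A singular root stays in `Φ \ S` under addition of elements of the Levi part. -/
theorem add_notMem_of_notMem (hS : IsClosedIn Φ S) {x y : M}
    (hx : x ∈ Φ) (hxS : x ∉ S) (hy : y ∈ leviSet S) : x + y ∉ S := by
  intro h
  have := hS.2 _ h _ hy.2
  rw [add_neg_cancel_right] at this
  exact hxS (this hx)

/-- A relation between singular roots and elements of `nilSet S`. -/
structure Rel (Φ S P : Set M) (A B : Multiset M) : Prop where
  sing : ∀ x ∈ A, x ∈ singSet Φ S P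
  nil : ∀ x ∈ B, x ∈ nilSet S
  sum_eq : A.sum = B.sum
  ne_zero : B ≠ 0

/-- A relation with the least number of singular roots and, among those, the least number of
elements of `nilSet S`. -/
structure MinRel (Φ S P : Set M) (A B : Multiset M) : Prop extends Rel Φ S P A B where
  card_le : ∀ A' B', Rel Φ S P A' B' → A.card ≤ A'.card
  card_le_of_eq : ∀ A' B', Rel Φ S P A' B' → A'.card = A.card → B.card ≤ B'.card

theorem exists_minRel {A B : Multiset M} (h : Rel Φ S P A B) : ∃ A B, MinRel Φ S P A B := by
  classical
  have h1 : ∃ n, ∃ A B, Rel Φ S P A B ∧ A.card = n := ⟨_, A, B, h, rfl⟩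
  have h2 : ∃ m, ∃ A B, Rel Φ S P A B ∧ A.card = Nat.find h1 ∧ B.card = m := by
    obtain ⟨A', B', h', h''⟩ := Nat.find_spec h1
    exact ⟨_, A', B', h', h'', rfl⟩
  obtain ⟨A', B', h', hA, hB⟩ := Nat.find_spec h2
  refine ⟨A', B', h', fun A'' B'' h'' => ?_, fun A'' B'' h'' hc => ?_⟩
  · rw [hA]; exact Nat.find_min' h1 ⟨A'', B'', h'', rfl⟩
  · rw [hB]; exact Nat.find_min' h2 ⟨A'', B'', h'', by rw [hc, hA], rfl⟩

section

variable (hΦ : IsRootSet Φ p) (hc : IsConfig Φ S P)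
include hΦ hc

theorem sum_nil_ne_zero {B : Multiset M} (hB : ∀ x ∈ B, x ∈ nilSet S) (h0 : B ≠ 0) :
    B.sum ≠ 0 :=
  hΦ.sum_ne_zero (nil_closed hΦ.neg_mem hc.closed) (fun _ => neg_notMem_nilSet) B hB h0

theorem mem_nil_of_closure {x : M} (hx : x ∈ AddSubmonoid.closure (nilSet S)) (hxΦ : x ∈ Φ) :
    x ∈ nilSet S :=
  hΦ.mem_of_mem_closure (nil_closed hΦ.neg_mem hc.closed) hx hxΦ

omit hΦ hc in
theorem sing_add_ne_zero {x d : M} (hx : x ∈ singSet Φ S P) (hd : d ∈ leviSet S) :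
    x + d ≠ 0 := by
  intro h
  rw [eq_neg_of_add_eq_zero_left h] at hx
  exact hx.1.2 hd.2

theorem sing_pairing_nonneg {x d : M} (hx : x ∈ singSet Φ S P) (hd : d ∈ P) : 0 ≤ p d x := by
  have h := hx.2 d hd
  have h0 := sing_add_ne_zero hx (hc.pos_subset hd)
  rw [add_comm] at h h0
  exact hΦ.nonneg_of_add_notMem (hc.pos_closed.1 hd) hx.1.1 h h0

/-- Any other behaviour of `x + y` shortens the relation or gives a pair. Outside `S` it is singular
and replaces `x` and `y`; in the nilradical it makes `x`, `y` a pair; in the Levi part it can be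
moved to the other side; if it is zero both terms can be dropped. -/
theorem MinRel.sing_add {A B : Multiset M} (h : MinRel Φ S P A B) (hno : ¬ HasPair Φ S P)
    {x y : M} (hx : x ∈ A) (hy : y ∈ A) (hxy : x ≠ y) : x + y ∉ Φ ∧ x + y ≠ 0 := by
  obtain ⟨t, rfl⟩ := Multiset.exists_cons_of_mem hx
  obtain ⟨u, rfl⟩ := Multiset.exists_cons_of_mem ((Multiset.mem_cons.1 hy).resolve_left hxy.symm)
  have hxs := h.sing x hx
  have hys := h.sing y hy
  have hus : ∀ z ∈ u, z ∈ singSet Φ S P := fun z hz => h.sing z (by simp [hz])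
  have hsum := h.sum_eq
  simp only [Multiset.sum_cons] at hsum
  constructor
  · intro hΦxy
    by_cases hS : x + y ∈ S
    · rcases mem_levi_or_nil hS with hk | hn
      · have hP : x + y ∈ P := by
          refine (hc.pos_or_neg _ hk).resolve_right fun hneg => ?_
          have := hxs.2 _ hneg
          rw [show x + -(x + y) = -y by abel] at this
          exact this (hΦ.neg_mem _ hys.1.1)
        -- Singular roots pair nonnegatively with elements of `P`, so some `b ∈ B` pairs positively
        -- with `x + y`. Replacing `b` by `b - (x + y)`, still in the nilradical, removes both `x`
        -- and `y`.
        have hpos : 0 < p (x + y) B.sum := by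
          rw [← hsum, ← add_assoc, map_add]
          have h1 := hΦ.self_pos _ hΦxy
          have h2 : 0 ≤ p (x + y) u.sum := by
            rw [map_multiset_sum]
            apply Multiset.sum_nonneg
            intro r hr
            obtain ⟨z, hz, rfl⟩ := Multiset.mem_map.1 hr
            exact sing_pairing_nonneg hΦ hc (hus z hz) hP
          linarith
        obtain ⟨b, hb, hbp⟩ := exists_pos_of_sum_pos _ _ hpos
        obtain ⟨v, rfl⟩ := Multiset.exists_cons_of_mem hb
        have hbn := h.nil b hb
        have hsub : b - (x + y) ∈ Φ := by
          refine (hΦ.sub_mem (hc.closed.1 hbn.1) hΦxy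
            (hΦ.pos_symm _ hΦxy _ (hc.closed.1 hbn.1) hbp)).resolve_right fun h0 => ?_
          rw [sub_eq_zero.1 h0] at hbn
          exact notMem_leviSet_of_mem_nilSet hbn hk
        rw [sub_eq_add_neg] at hsub
        have hbn' := nil_add_mem hΦ.neg_mem hc.closed hbn hk.2 hsub
        have := h.card_le u ((b + -(x + y)) ::ₘ v) ⟨hus, ?_, ?_, by simp⟩
        · simp at this
        · intro z hz
          rcases Multiset.mem_cons.1 hz with rfl | hz
          exacts [hbn', h.nil z (by simp [hz])]
        · simp only [Multiset.sum_cons] at hsum ⊢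
          calc u.sum = (x + (y + u.sum)) - (x + y) := by abel
            _ = _ := by rw [hsum]; abel
      · exact hno ⟨x, hxs, y, hys, hΦ.ne_zero hΦxy, AddSubmonoid.subset_closure hn⟩
    · have hsing : x + y ∈ singSet Φ S P := by
        refine ⟨⟨hΦxy, hS⟩, fun d hd hd' => ?_⟩
        exact hys.2 d hd (hΦ.add_mem_of_add_add_mem hxs.1.1 hys.1.1 (hc.pos_closed.1 hd) hΦxy hd'
          (hxs.2 d hd) (sing_add_ne_zero hxs (hc.pos_subset hd))
          (sing_add_ne_zero hys (hc.pos_subset hd)))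
      have := h.card_le ((x + y) ::ₘ u) B ⟨?_, h.nil, ?_, h.ne_zero⟩
      · simp at this
      · intro z hz
        rcases Multiset.mem_cons.1 hz with rfl | hz
        exacts [hsing, hus z hz]
      · rw [← hsum, Multiset.sum_cons]; abel
  · intro h0
    have := h.card_le u B ⟨hus, h.nil, ?_, h.ne_zero⟩
    · simp at this
    · rw [← hsum, ← add_assoc, h0, zero_add]

theorem nil_add_of_card_le {B : Multiset M} (hB : ∀ x ∈ B, x ∈ nilSet S)
    (hmin : ∀ B' : Multiset M, (∀ x ∈ B', x ∈ nilSet S) → B'.sum = B.sum → B.card ≤ B'.card)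
    {x y : M} (hx : x ∈ B) (hy : y ∈ B) (hxy : x ≠ y) : x + y ∉ Φ ∧ x + y ≠ 0 := by
  obtain ⟨t, rfl⟩ := Multiset.exists_cons_of_mem hx
  obtain ⟨u, rfl⟩ := Multiset.exists_cons_of_mem ((Multiset.mem_cons.1 hy).resolve_left hxy.symm)
  refine ⟨fun h => ?_, fun h => ?_⟩
  · have := hmin ((x + y) ::ₘ u) ?_ (by simp [add_assoc])
    · simp at this
    · intro z hz
      rcases Multiset.mem_cons.1 hz with rfl | hz
      exacts [nil_add_mem hΦ.neg_mem hc.closed (hB x hx) (hB y hy).1 h, hB z (by simp [hz])]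
  · exact (hB x hx).2 (by rw [neg_eq_of_add_eq_zero_right h]; exact (hB y hy).1)

theorem MinRel.nil_add {A B : Multiset M} (h : MinRel Φ S P A B)
    {x y : M} (hx : x ∈ B) (hy : y ∈ B) (hxy : x ≠ y) : x + y ∉ Φ ∧ x + y ≠ 0 := by
  refine nil_add_of_card_le hΦ hc h.nil (fun B' hB' hs => ?_) hx hy hxy
  refine h.card_le_of_eq A B' ⟨h.sing, hB', by rw [h.sum_eq, hs], ?_⟩ rfl
  rintro rfl
  exact sum_nil_ne_zero hΦ hc h.nil h.ne_zero (by rw [← hs]; simp)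

/-- Among the pairs of singular roots with sum in the cone of the nilradical, a maximal one
normalizes the nilradical. -/
theorem exists_normalizing_pair (hp : HasPair Φ S P) :
    ∃ x ∈ singSet Φ S P, ∃ y ∈ singSet Φ S P,
      x + y ≠ 0 ∧ x + y ∈ AddSubmonoid.closure (nilSet S) ∧
      ∀ z, z = x ∨ z = y → ∀ b ∈ nilSet S, z + b ≠ 0 ∧ (z + b ∈ Φ → z + b ∈ nilSet S) := by
  have hN := nil_closed hΦ.neg_mem hc.closed
  let T : Set M := {w | ∃ x ∈ singSet Φ S P, ∃ y ∈ singSet Φ S P, w = x + y ∧ w ≠ 0 ∧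
      w ∈ AddSubmonoid.closure (nilSet S)}
  have hT : T.Finite := by
    refine ((hΦ.finite.prod hΦ.finite).image fun q => q.1 + q.2).subset ?_
    rintro w ⟨x, hx, y, hy, rfl, -⟩
    exact ⟨(x, y), ⟨hx.1.1, hy.1.1⟩, rfl⟩
  have hne : T.Nonempty := by
    obtain ⟨x, hx, y, hy, h0, hm⟩ := hp
    exact ⟨_, x, hx, y, hy, rfl, h0, hm⟩
  obtain ⟨w, ⟨x, hx, y, hy, rfl, h0, hm⟩, hmax⟩ :=
    hΦ.exists_maximal hN (fun _ => neg_notMem_nilSet) hT hne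
  have key : ∀ x ∈ singSet Φ S P, ∀ y ∈ singSet Φ S P, x + y ≠ 0 →
      x + y ∈ AddSubmonoid.closure (nilSet S) →
      (∀ q ∈ AddSubmonoid.closure (nilSet S), q ≠ 0 → x + y + q ∉ T) →
      ∀ b ∈ nilSet S, x + b ≠ 0 ∧ (x + b ∈ Φ → x + b ∈ nilSet S) := by
    intro x hx y hy h0 hm hmax b hb
    -- Otherwise `y = (x + y) + (-x)` would be a root in the cone of the nilradical, hence in `S`.
    have hneg : -x ∉ nilSet S := by
      intro hxn
      apply hy.1.2
      have : y ∈ AddSubmonoid.closure (nilSet S) := by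
        have := add_mem hm (AddSubmonoid.subset_closure hxn)
        rwa [show x + y + -x = y by abel] at this
      exact (mem_nil_of_closure hΦ hc this hy.1.1).1
    constructor
    · intro h
      exact hneg (by rw [neg_eq_of_add_eq_zero_right h]; exact hb)
    intro hΦb
    by_cases hS : x + b ∈ S
    · refine (mem_levi_or_nil hS).resolve_left fun hk => hneg ?_
      have := nil_add_mem hΦ.neg_mem hc.closed hb hk.2
      rw [show b + -(x + b) = -x by abel] at this
      exact this (hΦ.neg_mem _ hx.1.1)
    · exfalso
      -- An element `ν` of `R` that is maximal for the order of `P` makes `x + ν` singular. Then `x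
      -- + ν` and `y` form a pair with a larger sum, against the choice of `x + y`.
      let R : Set M := {ν ∈ nilSet S | x + ν ∈ Φ ∧ x + ν ∉ S}
      have hR : R.Finite := hΦ.finite.subset fun ν hν => hc.closed.1 hν.1.1
      obtain ⟨ν, ⟨hν, hxν, hxνS⟩, hνmax⟩ :=
        hΦ.exists_maximal hc.pos_closed hc.neg_notMem hR ⟨b, hb, hΦb, hS⟩
      have hsing : x + ν ∈ singSet Φ S P := by
        refine ⟨⟨hxν, hxνS⟩, fun d hd hd' => ?_⟩
        have hdk := hc.pos_subset hd
        have h1 : ν + d ∈ Φ := by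
          refine hΦ.add_mem_of_add_add_mem hx.1.1 (hc.closed.1 hν.1) (hc.pos_closed.1 hd) hxν hd'
            (hx.2 d hd) (sing_add_ne_zero hx hdk) fun h => ?_
          exact hν.2 (by rw [neg_eq_of_add_eq_zero_right h]; exact hdk.1)
        refine hνmax d (AddSubmonoid.subset_closure hd) (hΦ.ne_zero (hc.pos_closed.1 hd))
          ⟨nil_add_mem hΦ.neg_mem hc.closed hν hdk.1 h1, by rwa [← add_assoc], ?_⟩
        rw [← add_assoc]
        exact add_notMem_of_notMem hc.closed hxν hxνS hdk
      have hνc := AddSubmonoid.subset_closure hν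
      refine hmax ν hνc (hΦ.ne_zero (hc.closed.1 hν.1)) ⟨x + ν, hsing, y, hy, by abel, ?_, ?_⟩
      · exact hΦ.ne_zero_of_mem_closure_add hN (fun _ => neg_notMem_nilSet) hm hνc h0
      · exact add_mem hm hνc
  refine ⟨x, hx, y, hy, h0, hm, ?_⟩
  rintro z (rfl | rfl)
  · exact key _ hx y hy h0 hm hmax
  · refine key _ hy x hx ?_ ?_ ?_ <;> rwa [add_comm z x]

end

end RootCone

/-! ### Root systems of type D as sums of two signed basis vectors. -/

namespace RootCone

variable {M : Type*} [AddCommGroup M]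

/-- A finite set `W` of the form `{±v₁, …, ±vₙ}`, with coordinate functionals `c`. -/
structure IsSignedBasis (W : Set M) (c : M → M →+ ℝ) : Prop where
  finite : W.Finite
  neg_mem : ∀ v ∈ W, -v ∈ W
  apply_self : ∀ v ∈ W, c v v = 1
  apply_of_ne : ∀ v ∈ W, ∀ w ∈ W, w ≠ v → w ≠ -v → c v w = 0

/-- The sums of two elements of `W` that are neither equal nor opposite. -/
def edges (W : Set M) : Set M := {x | ∃ v ∈ W, ∃ w ∈ W, w ≠ v ∧ w ≠ -v ∧ x = v + w}

open Classical in
/-- The pairing with an element of `edges W`. -/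
noncomputable def edgePairing (W : Set M) (c : M → M →+ ℝ) (x : M) : M →+ ℝ :=
  if h : ∃ q : M × M, q.1 ∈ W ∧ q.2 ∈ W ∧ q.2 ≠ q.1 ∧ q.2 ≠ -q.1 ∧ x = q.1 + q.2 then
    c h.choose.1 + c h.choose.2 else 0

theorem edgePairing_spec {W : Set M} (c : M → M →+ ℝ) {x : M} (hx : x ∈ edges W) :
    ∃ v ∈ W, ∃ w ∈ W, w ≠ v ∧ w ≠ -v ∧ x = v + w ∧ edgePairing W c x = c v + c w := by
  have h : ∃ q : M × M, q.1 ∈ W ∧ q.2 ∈ W ∧ q.2 ≠ q.1 ∧ q.2 ≠ -q.1 ∧ x = q.1 + q.2 := by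
    obtain ⟨v, hv, w, hw, h1, h2, h3⟩ := hx
    exact ⟨(v, w), hv, hw, h1, h2, h3⟩
  obtain ⟨h1, h2, h3, h4, h5⟩ := h.choose_spec
  exact ⟨_, h1, _, h2, h3, h4, h5, by rw [edgePairing, dif_pos h]⟩

namespace IsSignedBasis

variable {W : Set M} {c : M → M →+ ℝ} (hW : IsSignedBasis W c)
include hW

theorem apply_neg {v : M} (hv : v ∈ W) : c v (-v) = -1 := by
  rw [map_neg, hW.apply_self v hv]

theorem ne_neg {v : M} (hv : v ∈ W) : v ≠ -v := by
  intro h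
  have := hW.apply_neg hv
  rw [← h, hW.apply_self v hv] at this
  norm_num at this

theorem eq_of_apply_pos {v w : M} (hv : v ∈ W) (hw : w ∈ W) (h : 0 < c v w) : w = v := by
  by_contra h1
  by_cases h2 : w = -v
  · rw [h2, hW.apply_neg hv] at h; norm_num at h
  · rw [hW.apply_of_ne v hv w hw h1 h2] at h; exact lt_irrefl _ h

theorem eq_of_apply_neg {v w : M} (hv : v ∈ W) (hw : w ∈ W) (h : c v w < 0) : w = -v := by
  have := hW.eq_of_apply_pos hv (hW.neg_mem w hw) (by simpa using h)
  rw [← this, neg_neg]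

theorem apply_nonneg {v w : M} (hv : v ∈ W) (hw : w ∈ W) (h : w ≠ -v) : 0 ≤ c v w := by
  by_contra! h'
  exact h (hW.eq_of_apply_neg hv hw h')

theorem apply_symm {v w : M} (hv : v ∈ W) (hw : w ∈ W) : c v w = c w v := by
  by_cases h1 : w = v
  · rw [h1]
  by_cases h2 : w = -v
  · rw [h2, hW.apply_neg hv]
    have := hW.apply_neg (hW.neg_mem v hv)
    rw [neg_neg] at this
    exact this.symm
  · rw [hW.apply_of_ne v hv w hw h1 h2, hW.apply_of_ne w hw v hv (Ne.symm h1)]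
    intro h; exact h2 (by rw [h, neg_neg])

theorem ne_of_add_mem {a u : M} (ha : a ∈ W) (hu : u ∈ W) (h : a + u ∈ edges W) :
    u ≠ a ∧ u ≠ -a := by
  obtain ⟨v, hv, w, hw, h1, h2, h3⟩ := h
  have h4 : c v (a + u) = 1 := by
    rw [h3, map_add, hW.apply_self v hv, hW.apply_of_ne v hv w hw h1 h2, add_zero]
  constructor
  · rintro rfl
    rw [map_add] at h4
    by_cases h5 : u = v
    · rw [h5, hW.apply_self v hv] at h4; norm_num at h4
    · by_cases h6 : u = -v
      · rw [h6, hW.apply_neg hv] at h4; norm_num at h4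
      · rw [hW.apply_of_ne v hv u hu h5 h6] at h4; norm_num at h4
  · rintro rfl
    simp at h4

theorem apply_add {a u : M} (ha : a ∈ W) (hu : u ∈ W) (h : a + u ∈ edges W) :
    c a (a + u) = 1 := by
  obtain ⟨h1, h2⟩ := hW.ne_of_add_mem ha hu h
  rw [map_add, hW.apply_self a ha, hW.apply_of_ne a ha u hu h1 h2, add_zero]

theorem mem_of_apply_add_pos {a v w : M} (ha : a ∈ W) (hv : v ∈ W) (hw : w ∈ W)
    (h : 0 < c a (v + w)) : v = a ∨ w = a := by
  by_contra! hc
  rw [map_add] at h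
  have h1 : c a v ≤ 0 := by
    by_contra! h'; exact hc.1 (hW.eq_of_apply_pos ha hv h')
  have h2 : c a w ≤ 0 := by
    by_contra! h'; exact hc.2 (hW.eq_of_apply_pos ha hw h')
  linarith

theorem exists_eq_add {a x : M} (ha : a ∈ W) (hx : x ∈ edges W) (h : 0 < c a x) :
    ∃ u ∈ W, x = a + u := by
  obtain ⟨v, hv, w, hw, -, -, rfl⟩ := hx
  rcases hW.mem_of_apply_add_pos ha hv hw h with rfl | rfl
  exacts [⟨w, hw, rfl⟩, ⟨v, hv, add_comm _ _⟩]

theorem apply_neg_left {a x : M} (ha : a ∈ W) (hx : x ∈ edges W) (h : c a x < 0) :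
    0 < c (-a) x := by
  obtain ⟨v, hv, w, hw, h1, h2, rfl⟩ := hx
  have hna := hW.neg_mem a ha
  have key : ∀ v ∈ W, c (-a) v = - c a v := by
    intro v hv
    rw [hW.apply_symm hna hv, hW.apply_symm ha hv, map_neg]
  rw [map_add, key v hv, key w hw]
  rw [map_add] at h
  linarith

theorem apply_neg_add {a u : M} (ha : a ∈ W) (hu : u ∈ W) (h : a + u ∈ edges W) :
    c (-a) (a + u) = -1 := by
  obtain ⟨h1, h2⟩ := hW.ne_of_add_mem ha hu h
  have hna := hW.neg_mem a ha
  rw [map_add, hW.apply_of_ne _ hna u hu h2 (by rwa [neg_neg]), add_zero,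
    hW.apply_symm hna ha, hW.apply_neg ha]

theorem exists_eq_neg_add {a x : M} (ha : a ∈ W) (hx : x ∈ edges W) (h : c a x < 0) :
    ∃ u ∈ W, x = -a + u :=
  hW.exists_eq_add (hW.neg_mem a ha) hx (hW.apply_neg_left ha hx h)

/-- If nothing were cancelled, the sum would have positive coordinates at both `u` and `v`; having
only two ends it would be `u + v`, forcing `d = 0`. So adding a root moves one end of the edge. -/
theorem exists_of_add_mem {u v d : M} (hu : u ∈ W) (hv : v ∈ W) (huv : u + v ∈ edges W)
    (hd : d ∈ edges W) (h : u + v + d ∈ edges W) :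
    (∃ x ∈ W, d = -u + x ∧ x ≠ v ∧ x ≠ -v) ∨ (∃ x ∈ W, d = -v + x ∧ x ≠ u ∧ x ≠ -u) := by
  obtain ⟨y, hy, z, hz, h1, h2, rfl⟩ := hd
  have key1 : ∀ y z, y ∈ W → z ∈ W → u + v + (y + z) ∈ edges W → y = -u →
      (∃ x ∈ W, y + z = -u + x ∧ x ≠ v ∧ x ≠ -v) := by
    rintro y z hy hz h rfl
    rw [show u + v + (-u + z) = v + z by abel] at h
    exact ⟨z, hz, rfl, hW.ne_of_add_mem hv hz h⟩
  have key2 : ∀ y z, y ∈ W → z ∈ W → u + v + (y + z) ∈ edges W → y = -v →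
      (∃ x ∈ W, y + z = -v + x ∧ x ≠ u ∧ x ≠ -u) := by
    rintro y z hy hz h rfl
    rw [show u + v + (-v + z) = u + z by abel] at h
    exact ⟨z, hz, rfl, hW.ne_of_add_mem hu hz h⟩
  by_cases hyu : y = -u
  · exact Or.inl (key1 y z hy hz h hyu)
  by_cases hyv : y = -v
  · exact Or.inr (key2 y z hy hz h hyv)
  have h' := h
  rw [add_comm y z] at h' ⊢
  by_cases hzu : z = -u
  · exact Or.inl (key1 z y hz hy h' hzu)
  by_cases hzv : z = -v
  · exact Or.inr (key2 z y hz hy h' hzv)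
  exfalso
  obtain ⟨g, hg, k, hk, -, -, h3⟩ := h
  obtain ⟨hvu, hvu'⟩ := hW.ne_of_add_mem hu hv huv
  have hu1 : 0 < c u (g + k) := by
    rw [← h3, map_add, hW.apply_add hu hv huv, map_add]
    linarith [hW.apply_nonneg hu hy hyu, hW.apply_nonneg hu hz hzu]
  have hv1 : 0 < c v (g + k) := by
    rw [← h3, map_add, add_comm u v, hW.apply_add hv hu (by rwa [add_comm]), map_add]
    linarith [hW.apply_nonneg hv hy hyv, hW.apply_nonneg hv hz hzv]
  have h4 : g + k = u + v := by
    rcases hW.mem_of_apply_add_pos hu hg hk hu1 with rfl | rfl <;>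
    rcases hW.mem_of_apply_add_pos hv hg hk hv1 with h | h
    · exact absurd h.symm hvu
    · rw [h]
    · rw [h, add_comm]
    · exact absurd h.symm hvu
  rw [h4, add_eq_left] at h3
  exact h2 (eq_neg_of_add_eq_zero_right h3)

/-- The pairing is a sum of four coordinates `c v y` and is symmetric in the two edges. If it is
negative, an end of one edge is opposite to an end of the other; after cancelling them the remaining
ends form an edge or are opposite, since equal remaining ends would bring the pairing back to zero.
-/
theorem isRootSet : IsRootSet (edges W) (edgePairing W c) where
  finite := by
    refine ((hW.finite.prod hW.finite).image fun q => q.1 + q.2).subset ?_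
    rintro x ⟨v, hv, w, hw, -, -, rfl⟩
    exact ⟨(v, w), ⟨hv, hw⟩, rfl⟩
  neg_mem := by
    rintro x ⟨v, hv, w, hw, h1, h2, rfl⟩
    exact ⟨-v, hW.neg_mem v hv, -w, hW.neg_mem w hw, fun h => h1 (neg_injective h),
      fun h => h2 (neg_injective h), by abel⟩
  self_pos := by
    intro x hx
    obtain ⟨v, hv, w, hw, -, -, rfl, h⟩ := edgePairing_spec c hx
    have h1 := hW.apply_add hv hw hx
    have h2 := hW.apply_add hw hv (by rwa [add_comm])
    rw [add_comm w v] at h2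
    rw [h, AddMonoidHom.add_apply, h1, h2]
    norm_num
  pos_symm := by
    intro x hx y hy hxy
    obtain ⟨v, hv, w, hw, -, -, rfl, h⟩ := edgePairing_spec c hx
    obtain ⟨v', hv', w', hw', -, -, rfl, h'⟩ := edgePairing_spec c hy
    rw [h] at hxy
    rw [h']
    simp only [AddMonoidHom.add_apply, map_add] at hxy ⊢
    rw [hW.apply_symm hv hv', hW.apply_symm hv hw', hW.apply_symm hw hv',
      hW.apply_symm hw hw'] at hxy
    linarith
  neg_symm := by
    intro x hx y hy hxy
    obtain ⟨v, hv, w, hw, -, -, rfl, h⟩ := edgePairing_spec c hx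
    obtain ⟨v', hv', w', hw', -, -, rfl, h'⟩ := edgePairing_spec c hy
    rw [h] at hxy
    rw [h']
    simp only [AddMonoidHom.add_apply, map_add] at hxy ⊢
    rw [hW.apply_symm hv hv', hW.apply_symm hv hw', hW.apply_symm hw hv',
      hW.apply_symm hw hw'] at hxy
    linarith
  add_mem := by
    intro x hx y hy hxy
    obtain ⟨v, hv, w, hw, hwv, hwv', rfl, h⟩ := edgePairing_spec c hx
    obtain ⟨y, hy, z, hz, hzy, hzy', rfl⟩ := hy
    rw [h] at hxy
    simp only [AddMonoidHom.add_apply, map_add] at hxy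
    have key : ∀ v ∈ W, ∀ w ∈ W, ∀ y ∈ W, ∀ z ∈ W, w ≠ v → w ≠ -v →
        c v y + c v z + (c w y + c w z) < 0 → c v y < 0 →
        (v + w + (y + z) ∈ edges W ∨ v + w + (y + z) = 0) := by
      intro v hv w hw y hy z hz hwv hwv' hxy h
      obtain rfl := hW.eq_of_apply_neg hv hy h
      rw [show v + w + (-v + z) = w + z by abel]
      by_cases h1 : z = -w
      · right; rw [h1]; abel
      left
      refine ⟨w, hw, z, hz, ?_, h1, rfl⟩
      rintro rfl
      rw [hW.apply_neg hv, hW.apply_of_ne v hv z hz hwv hwv', hW.apply_self z hz,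
        ← hW.apply_symm hy hz, hW.apply_of_ne (-v) hy z hz hwv' (by rwa [neg_neg])] at hxy
      norm_num at hxy
    rcases lt_or_ge (c v y) 0 with h1 | h1
    · exact key v hv w hw y hy z hz hwv hwv' (by linarith) h1
    rcases lt_or_ge (c v z) 0 with h2 | h2
    · have := key v hv w hw z hz y hy hwv hwv' (by linarith) h2
      rwa [add_comm z y] at this
    have hvw : v ≠ -w := fun h => hwv' (by rw [h, neg_neg])
    rcases lt_or_ge (c w y) 0 with h3 | h3
    · have := key w hw v hv y hy z hz hwv.symm hvw (by linarith) h3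
      rwa [add_comm w v] at this
    rcases lt_or_ge (c w z) 0 with h4 | h4
    · have := key w hw v hv z hz y hy hwv.symm hvw (by linarith) h4
      rwa [add_comm w v, add_comm z y] at this
    linarith

end IsSignedBasis

/-- The subgroup `U` is carried along so that type A, as the part of type D with coordinate sum
zero, needs no separate argument. -/
theorem IsRootSet.inter {Φ : Set M} {p : M → M →+ ℝ} (hΦ : IsRootSet Φ p) (U : AddSubgroup M) :
    IsRootSet (Φ ∩ U) p where
  finite := hΦ.finite.subset Set.inter_subset_left
  neg_mem := fun x hx => ⟨hΦ.neg_mem x hx.1, U.neg_mem hx.2⟩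
  self_pos := fun x hx => hΦ.self_pos x hx.1
  pos_symm := fun x hx y hy => hΦ.pos_symm x hx.1 y hy.1
  neg_symm := fun x hx y hy => hΦ.neg_symm x hx.1 y hy.1
  add_mem := fun x hx y hy h => (hΦ.add_mem x hx.1 y hy.1 h).imp_left
    fun h => ⟨h, U.add_mem hx.2 hy.2⟩

end RootCone

/-! ### Type D: vertices and edges of a shortest relation. -/

namespace RootCone

variable {M : Type*} [AddCommGroup M]

/-- The setting for a relation of minimal length in a subsystem of a root system of type `D`. -/
structure MinCtx (W : Set M) (c : M → M →+ ℝ) (U : AddSubgroup M) (S P : Set M)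
    (A B : Multiset M) : Prop where
  basis : IsSignedBasis W c
  config : IsConfig (edges W ∩ U) S P
  noPair : ¬ HasPair (edges W ∩ U) S P
  minRel : MinRel (edges W ∩ U) S P A B

section Basis

variable {W : Set M} {c : M → M →+ ℝ} (hW : IsSignedBasis W c) {T : Multiset M} {U : AddSubgroup M}
  (hT : ∀ x ∈ T, x ∈ edges W ∩ U)
  (hadd : ∀ x ∈ T, ∀ y ∈ T, x ≠ y → x + y ∉ edges W ∩ U ∧ x + y ≠ 0)
include hW hT hadd

/-- The two edges sum to `b + w`, which may be neither a root nor zero; the only remaining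
possibility is `w = b`. -/
theorem eq_of_mem_of_neg_mem {a b w : M} (ha : a ∈ W) (hb : b ∈ W) (hw : w ∈ W)
    (h1 : a + b ∈ T) (h2 : -a + w ∈ T) : w = b := by
  have hab := (hT _ h1).1
  have haw := (hT _ h2).1
  have hne : a + b ≠ -a + w := by
    intro h
    have h3 := hW.apply_add ha hb hab
    have h4 := hW.apply_add (hW.neg_mem a ha) hw haw
    rw [← h, hW.apply_neg_add ha hb hab] at h4
    norm_num at h4
  obtain ⟨h5, h6⟩ := hadd _ h1 _ h2 hne
  by_contra hwb
  have e : a + b + (-a + w) = b + w := by abel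
  rw [e] at h5 h6
  refine h5 ⟨⟨b, hb, w, hw, hwb, fun h => h6 (by rw [h]; abel), rfl⟩, ?_⟩
  have := U.add_mem (hT _ h1).2 (hT _ h2).2
  rwa [e] at this

/-- A vertex `a` of the edge `a + b` either survives in the total sum, and hence reappears on the
other side of the relation, or is cancelled, which only `-a + b` can do. -/
theorem apply_sum_pos_or {a b : M} (ha : a ∈ W) (hb : b ∈ W) (h1 : a + b ∈ T) :
    0 < c a T.sum ∨ -a + b ∈ T := by
  by_contra! hc
  obtain ⟨t, rfl⟩ := Multiset.exists_cons_of_mem h1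
  have h2 : c a t.sum < 0 := by
    have := hc.1
    rw [Multiset.sum_cons, map_add, hW.apply_add ha hb (hT _ h1).1] at this
    linarith
  obtain ⟨x, hx, hxa⟩ := exists_neg_of_sum_neg _ _ h2
  have hx' : x ∈ (a + b) ::ₘ t := by simp [hx]
  obtain ⟨w, hw, rfl⟩ := hW.exists_eq_neg_add ha (hT _ hx').1 hxa
  obtain rfl := eq_of_mem_of_neg_mem hW hT hadd ha hb hw h1 hx'
  exact hc.2 hx'

end Basis

namespace MinCtx

variable {W : Set M} {c : M → M →+ ℝ} {U : AddSubgroup M} {S P : Set M} {A B : Multiset M}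
  (h : MinCtx W c U S P A B)
include h

theorem rootSet : IsRootSet (edges W ∩ U) (edgePairing W c) := h.basis.isRootSet.inter U

theorem neg_root : ∀ x ∈ edges W ∩ U, -x ∈ edges W ∩ U := h.rootSet.neg_mem

theorem A_mem : ∀ x ∈ A, x ∈ edges W ∩ U := fun x hx => (h.minRel.sing x hx).1.1

theorem B_mem : ∀ x ∈ B, x ∈ edges W ∩ U := fun x hx => h.config.closed.1 (h.minRel.nil x hx).1

theorem A_add : ∀ x ∈ A, ∀ y ∈ A, x ≠ y → x + y ∉ edges W ∩ U ∧ x + y ≠ 0 :=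
  fun _ hx _ hy hxy => h.minRel.sing_add h.rootSet h.config h.noPair hx hy hxy

theorem B_add : ∀ x ∈ B, ∀ y ∈ B, x ≠ y → x + y ∉ edges W ∩ U ∧ x + y ≠ 0 :=
  fun _ hx _ hy hxy => h.minRel.nil_add h.rootSet h.config hx hy hxy

theorem A_eq {a b w : M} (ha : a ∈ W) (hb : b ∈ W) (hw : w ∈ W)
    (h1 : a + b ∈ A) (h2 : -a + w ∈ A) : w = b :=
  eq_of_mem_of_neg_mem h.basis h.A_mem h.A_add ha hb hw h1 h2

theorem B_eq {a b w : M} (ha : a ∈ W) (hb : b ∈ W) (hw : w ∈ W)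
    (h1 : a + b ∈ B) (h2 : -a + w ∈ B) : w = b :=
  eq_of_mem_of_neg_mem h.basis h.B_mem h.B_add ha hb hw h1 h2

theorem exists_B_of_pos {a : M} (ha : a ∈ W) (hp : 0 < c a B.sum) : ∃ u ∈ W, a + u ∈ B := by
  obtain ⟨x, hx, hxp⟩ := exists_pos_of_sum_pos _ _ hp
  obtain ⟨u, hu, rfl⟩ := h.basis.exists_eq_add ha (h.B_mem x hx).1 hxp
  exact ⟨u, hu, hx⟩

theorem exists_A_of_pos {a : M} (ha : a ∈ W) (hp : 0 < c a B.sum) : ∃ u ∈ W, a + u ∈ A := by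
  rw [← h.minRel.sum_eq] at hp
  obtain ⟨x, hx, hxp⟩ := exists_pos_of_sum_pos _ _ hp
  obtain ⟨u, hu, rfl⟩ := h.basis.exists_eq_add ha (h.A_mem x hx).1 hxp
  exact ⟨u, hu, hx⟩

/-- A vertex of an element of `A` that is not cancelled in `A` is a vertex of an element of `B`. -/
theorem exists_B {a b : M} (ha : a ∈ W) (hb : b ∈ W) (h1 : a + b ∈ A) (h2 : -a + b ∉ A) :
    ∃ u ∈ W, a + u ∈ B := by
  have := (apply_sum_pos_or h.basis h.A_mem h.A_add ha hb h1).resolve_right h2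
  rw [h.minRel.sum_eq] at this
  exact h.exists_B_of_pos ha this

theorem exists_A {a b : M} (ha : a ∈ W) (hb : b ∈ W) (h1 : a + b ∈ B) (h2 : -a + b ∉ B) :
    ∃ u ∈ W, a + u ∈ A :=
  h.exists_A_of_pos ha
    ((apply_sum_pos_or h.basis h.B_mem h.B_add ha hb h1).resolve_right h2)

theorem ne_of_mem {a u : M} (ha : a ∈ W) (hu : u ∈ W) (h1 : a + u ∈ edges W ∩ U) :
    u ≠ a ∧ u ≠ -a :=
  h.basis.ne_of_add_mem ha hu h1.1

theorem mem_U {x : M} (hx : x ∈ S) : x ∈ U := (h.config.closed.1 hx).2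

/-- Adding `-a + x` to the singular root `a + b` gives `b + x`, which is a root unless `x = ±b`. The
case `x = -b` would put `a + b` into `S`. -/
theorem sing_end {a b x : M} (hb : b ∈ W) (hx : x ∈ W)
    (h1 : a + b ∈ singSet (edges W ∩ U) S P) (h2 : -a + x ∈ P) : x = b := by
  by_contra hxb
  have e : a + b + (-a + x) = b + x := by abel
  refine h1.2 _ h2 ?_
  rw [e]
  refine ⟨⟨b, hb, x, hx, hxb, ?_, rfl⟩, ?_⟩
  · intro hxb'
    refine h1.1.2 ?_
    have := (h.config.pos_subset h2).2
    rwa [hxb', show -(-a + -b) = a + b by abel] at this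
  · rw [← e]
    exact U.add_mem h1.1.1.2 (h.config.pos_closed.1 h2).2

theorem nil_step {a u x : M} (ha : a ∈ W) (hx : x ∈ W) (h1 : a + u ∈ nilSet S)
    (h2 : -u + x ∈ S) (h3 : x ≠ a) (h4 : x ≠ -a) : a + x ∈ nilSet S := by
  have e : a + u + (-u + x) = a + x := by abel
  have := nil_add_mem h.neg_root h.config.closed h1 h2
  rw [e] at this
  refine this ⟨⟨a, ha, x, hx, h3, h4, rfl⟩, ?_⟩
  rw [← e]
  exact U.add_mem (h.mem_U h1.1) (h.mem_U h2)

theorem closed_step {a u x : M} (ha : a ∈ W) (hx : x ∈ W) (h1 : a + u ∈ S)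
    (h2 : -u + x ∈ S) (h3 : x ≠ a) (h4 : x ≠ -a) : a + x ∈ S := by
  have e : a + u + (-u + x) = a + x := by abel
  have := h.config.closed.2 _ h1 _ h2
  rw [e] at this
  refine this ⟨⟨a, ha, x, hx, h3, h4, rfl⟩, ?_⟩
  rw [← e]
  exact U.add_mem (h.mem_U h1) (h.mem_U h2)

/-- Two singular roots cannot add up to a root in `nilSet S`. -/
theorem not_nil_of_sing_add {x y z : M} (hx : x ∈ singSet (edges W ∩ U) S P)
    (hy : y ∈ singSet (edges W ∩ U) S P) (hz : z ∈ nilSet S) (e : x + y = z) : False := by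
  refine h.noPair ⟨x, hx, y, hy, ?_, ?_⟩
  · rw [e]; exact h.rootSet.ne_zero (h.config.closed.1 hz.1)
  · rw [e]; exact AddSubmonoid.subset_closure hz

theorem not_nil_of_sing_add_two {x y z z' : M} (hx : x ∈ singSet (edges W ∩ U) S P)
    (hy : y ∈ singSet (edges W ∩ U) S P) (hz : z ∈ nilSet S) (hz' : z' ∈ nilSet S)
    (e : x + y = z + z') : False := by
  refine h.noPair ⟨x, hx, y, hy, ?_, ?_⟩
  · rw [e]
    intro h0
    exact hz.2 (by rw [neg_eq_of_add_eq_zero_right h0]; exact hz'.1)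
  · rw [e]
    exact AddSubmonoid.add_mem _ (AddSubmonoid.subset_closure hz) (AddSubmonoid.subset_closure hz')

/-- The root `a - u` cannot be in `B`, being in the Levi part, so `u` is not cancelled in `B` and
occurs in a singular root `u + w` of `A`. By `sing_end` this forces `w = a`, but `a + u` lies in the
nilradical. -/
theorem notMem_pos {a u : M} (ha : a ∈ W) (hu : u ∈ W) (h1 : a + u ∈ B) : a + -u ∉ P := by
  intro hP
  by_cases hc : -u + a ∈ B
  · refine notMem_leviSet_of_mem_nilSet (h.minRel.nil _ hc) ?_
    rw [add_comm]
    exact h.config.pos_subset hP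
  · obtain ⟨w, hw, hwA⟩ := h.exists_A hu ha (by rwa [add_comm]) hc
    have := h.sing_end hw ha (h.minRel.sing _ hwA) (by rwa [add_comm])
    subst this
    rw [add_comm] at hwA
    exact notMem_nilSet_of_mem_singSet (h.minRel.sing _ hwA) (h.minRel.nil _ h1)

end MinCtx

end RootCone

/-! ### Type D: every relation yields a pair. -/

namespace RootCone

variable {M : Type*} [AddCommGroup M]

theorem add_mem_edges_inter {W : Set M} {U : AddSubgroup M} {a b : M} (ha : a ∈ W) (hb : b ∈ W) (h1 : b ≠ a ∧ b ≠ -a) (h2 : a + b ∈ U) :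
    a + b ∈ edges W ∩ U :=
  ⟨⟨a, ha, b, hb, h1.1, h1.2, rfl⟩, h2⟩

namespace MinCtx

variable {W : Set M} {c : M → M →+ ℝ} {U : AddSubgroup M} {S P : Set M} {A B : Multiset M}
  (h : MinCtx W c U S P A B)
include h

theorem neg_add_notMem_pos {a u : M} (h1 : a + u ∈ nilSet S) : -u + -a ∉ P := by
  intro hP
  refine h1.2 ?_
  rw [neg_add_rev]
  exact (h.config.pos_subset hP).1

/-- Adding `-u + x ∈ P` to `u + v` moves the end `u` to `x`. The conditions tying `u` to `a` survive
this move, so they may be imposed on a root that is maximal for the order of `P`. -/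
theorem raise {a u v x : M} (ha : a ∈ W) (hu : u ∈ W) (hv : v ∈ W) (hx : x ∈ W)
    (hau : a + u ∈ nilSet S) (hau' : a + -u ∉ P) (huv : u + v ∉ S) (huv' : v ≠ u ∧ v ≠ -u)
    (hδ : -u + x ∈ P) (hxv : x ≠ v ∧ x ≠ -v) :
    a + x ∈ nilSet S ∧ a + -x ∉ P ∧ x + v ∉ S := by
  have hδS := (h.config.pos_subset hδ)
  have hxa : x ≠ a := by
    rintro rfl; exact hau' (by rwa [add_comm])
  have hxa' : x ≠ -a := by
    rintro rfl; exact h.neg_add_notMem_pos hau hδ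
  refine ⟨h.nil_step ha hx hau hδS.1 hxa hxa', fun hP => ?_, fun hS => huv ?_⟩
  · have hua := h.ne_of_mem ha hu (h.config.closed.1 hau.1)
    refine hau' ?_
    have e : a + -x + (-u + x) = a + -u := by abel
    rw [← e]
    refine h.config.pos_closed.2 _ hP _ hδ ?_
    rw [e]
    refine ⟨⟨a, ha, -u, h.basis.neg_mem u hu, ?_, ?_, rfl⟩, ?_⟩
    · intro h0; exact hua.2 (by rw [← h0, neg_neg])
    · intro h0; exact hua.1 (neg_injective h0)
    · rw [← e]
      exact U.add_mem (h.config.pos_closed.1 hP).2 (h.config.pos_closed.1 hδ).2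
  · rw [add_comm]
    refine h.closed_step (u := x) hv hu (by rwa [add_comm]) ?_ (Ne.symm huv'.1) ?_
    · have := hδS.2
      rwa [neg_add_rev, neg_neg] at this
    · intro h0; exact huv'.2 (by rw [h0, neg_neg])

/-- Among the admissible `u + v`, one that is maximal for the order of `P` is singular by `raise`.
Then `(a + b) + (u + v) = (a + u) + (b + v)` exhibits a pair. -/
theorem not_of_pair {a b u v : M} (ha : a ∈ W) (hb : b ∈ W) (hu : u ∈ W) (hv : v ∈ W)
    (hab : a + b ∈ singSet (edges W ∩ U) S P) (hau : a + u ∈ nilSet S) (hbv : b + v ∈ nilSet S)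
    (hau' : a + -u ∉ P) (hbv' : b + -v ∉ P) (huv : u + v ∈ edges W ∩ U) (huvS : u + v ∉ S) :
    False := by
  let R : Set M := {γ | ∃ u ∈ W, ∃ v ∈ W, γ = u + v ∧ a + u ∈ nilSet S ∧ b + v ∈ nilSet S ∧
    a + -u ∉ P ∧ b + -v ∉ P ∧ γ ∈ edges W ∩ U ∧ γ ∉ S}
  have hR : R.Finite := h.rootSet.finite.subset fun γ hγ => by
    obtain ⟨u, -, v, -, -, -, -, -, -, h1, -⟩ := hγ
    exact h1
  obtain ⟨γ, ⟨u, hu, v, hv, rfl, h1, h2, h3, h4, h5, h6⟩, hmax⟩ :=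
    h.rootSet.exists_maximal h.config.pos_closed h.config.neg_notMem hR
      ⟨u + v, u, hu, v, hv, rfl, hau, hbv, hau', hbv', huv, huvS⟩
  have hvu := h.ne_of_mem hu hv h5
  have hsing : u + v ∈ singSet (edges W ∩ U) S P := by
    refine ⟨⟨h5, h6⟩, fun δ hδ hδ' => ?_⟩
    have hδΦ := h.config.pos_closed.1 hδ
    refine hmax δ (AddSubmonoid.subset_closure hδ) (h.rootSet.ne_zero hδΦ) ?_
    rcases h.basis.exists_of_add_mem hu hv h5.1 hδΦ.1 hδ'.1 with ⟨x, hx, rfl, hxv⟩ | ⟨x, hx, rfl, hxu⟩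
    · obtain ⟨k1, k2, k3⟩ := h.raise ha hu hv hx h1 h3 h6 hvu hδ hxv
      have e : u + v + (-u + x) = x + v := by abel
      rw [e] at hδ' ⊢
      exact ⟨x, hx, v, hv, rfl, k1, h2, k2, h4, hδ', k3⟩
    · have huv := h.ne_of_mem hv hu (by rwa [add_comm])
      obtain ⟨k1, k2, k3⟩ := h.raise hb hv hu hx h2 h4 (by rwa [add_comm]) huv hδ hxu
      have e : u + v + (-v + x) = u + x := by abel
      rw [add_comm] at k3
      rw [e] at hδ' ⊢
      exact ⟨u, hu, x, hx, rfl, h1, k1, h3, k2, hδ', k3⟩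
  exact h.not_nil_of_sing_add_two hab hsing h1 h2 (by abel)

/-- If the ends differed, `u + v` would be a root. In the Levi part it would carry `a + u` and `b +
v` to `a + b`, placing the latter in the nilradical; in the nilradical it would shorten the
relation; outside `S` it is excluded by `not_of_pair`. -/
theorem eq_of_mem {a b u v : M} (ha : a ∈ W) (hb : b ∈ W) (hu : u ∈ W) (hv : v ∈ W)
    (hab : a + b ∈ A) (hau : a + u ∈ B) (hbv : b + v ∈ B) : u = v := by
  by_contra huv
  have hs := h.minRel.sing _ hab
  have habn := notMem_nilSet_of_mem_singSet hs
  have hba := h.ne_of_mem ha hb hs.1.1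
  have hau1 := h.minRel.nil _ hau
  have hbv1 := h.minRel.nil _ hbv
  have hua := h.ne_of_mem ha hu (h.B_mem _ hau)
  have hvb := h.ne_of_mem hb hv (h.B_mem _ hbv)
  have hub : u ≠ b := by rintro rfl; exact habn hau1
  have hva : v ≠ a := by rintro rfl; exact habn (by rwa [add_comm])
  have hne : a + u ≠ b + v := by
    intro he
    have := h.basis.apply_add ha hu (h.B_mem _ hau).1
    rcases h.basis.mem_of_apply_add_pos ha hb hv (by rw [← he, this]; norm_num) with h1 | h1
    exacts [hba.1 h1, hva h1]
  obtain ⟨f1, f2⟩ := h.B_add _ hau _ hbv hne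
  have huv' : v ≠ -u := by
    rintro rfl
    rw [show a + u + (b + -u) = a + b by abel] at f1
    exact f1 hs.1.1
  have hUab : a + u + (b + v) ∈ U := U.add_mem (h.mem_U hau1.1) (h.mem_U hbv1.1)
  have hub' : u ≠ -b := by
    rintro rfl
    have e : a + -b + (b + v) = a + v := by abel
    rw [e] at f1 f2 hUab
    exact f1 (add_mem_edges_inter ha hv ⟨hva, fun h0 => f2 (by rw [h0]; abel)⟩ hUab)
  have hva' : v ≠ -a := by
    rintro rfl
    have e : a + u + (b + -a) = b + u := by abel
    rw [e] at f1 f2 hUab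
    exact f1 (add_mem_edges_inter hb hu ⟨hub, hub'⟩ hUab)
  have huvΦ : u + v ∈ edges W ∩ U := by
    refine add_mem_edges_inter hu hv ⟨Ne.symm huv, huv'⟩ ?_
    have := U.sub_mem hUab hs.1.1.2
    rwa [show a + u + (b + v) - (a + b) = u + v by abel] at this
  by_cases hS : u + v ∈ S
  · rcases mem_levi_or_nil hS with hk | hn
    · have h1 : a + -v ∈ nilSet S := by
        refine h.nil_step ha (h.basis.neg_mem v hv) hau1 ?_ ?_ ?_
        · rw [← neg_add]; exact hk.2
        · intro h0; exact hva' (by rw [← h0, neg_neg])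
        · intro h0; exact hva (neg_injective h0)
      refine habn (h.nil_step ha hb h1 ?_ hba.1 hba.2)
      rw [neg_neg, add_comm]
      exact hbv1.1
    · obtain ⟨A', rfl⟩ := Multiset.exists_cons_of_mem hab
      obtain ⟨B', rfl⟩ := Multiset.exists_cons_of_mem hau
      obtain ⟨B'', rfl⟩ := Multiset.exists_cons_of_mem
        ((Multiset.mem_cons.1 hbv).resolve_left hne.symm)
      -- Subtracting `a + b` from both sides turns `(a + u) + (b + v)` into `u + v`, so the relation
      -- loses a singular root.
      have := h.minRel.card_le A' ((u + v) ::ₘ B'') ⟨?_, ?_, ?_, by simp⟩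
      · simp at this
      · exact fun z hz => h.minRel.sing z (by simp [hz])
      · intro z hz
        rcases Multiset.mem_cons.1 hz with rfl | hz
        exacts [hn, h.minRel.nil z (by simp [hz])]
      · have hsum := h.minRel.sum_eq
        simp only [Multiset.sum_cons] at hsum ⊢
        calc A'.sum = a + b + A'.sum - (a + b) := by abel
          _ = _ := by rw [hsum]; abel
  · exact h.not_of_pair ha hb hu hv hs hau1 hbv1 (h.notMem_pos ha hu hau) (h.notMem_pos hb hv hbv)
      huvΦ hS

/-- The configuration of four singular roots `a+b`, `u±w` with `a+u`, `b+u` in the nilradical. -/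
theorem not_of_four {a b u w : M} (ha : a ∈ W) (hb : b ∈ W) (hu : u ∈ W) (hw : w ∈ W)
    (hab : a + b ∈ singSet (edges W ∩ U) S P) (huw : u + w ∈ singSet (edges W ∩ U) S P)
    (huw' : u + -w ∈ singSet (edges W ∩ U) S P) (hau : a + u ∈ nilSet S) (hbu : b + u ∈ nilSet S)
    (hwa : w ≠ a ∧ w ≠ -a) (hwb : w ≠ b ∧ w ≠ -b) : False := by
  have hba := h.ne_of_mem ha hb hab.1.1
  have key : ∀ a b w, a ∈ W → b ∈ W → w ∈ W → a + b ∈ singSet (edges W ∩ U) S P →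
      u + w ∈ singSet (edges W ∩ U) S P → u + -w ∈ singSet (edges W ∩ U) S P →
      a + u ∈ nilSet S → b + u ∈ nilSet S → (w ≠ a ∧ w ≠ -a) → (w ≠ b ∧ w ≠ -b) →
      a + w ∈ S := by
    intro a b w ha hb hw hab huw huw' hau hbu hwa hwb
    by_contra hS
    have hw' := h.basis.neg_mem w hw
    have hU : ∀ a, a + u ∈ nilSet S → a + w ∈ U := by
      intro a hau
      have := U.sub_mem (h.mem_U hau.1) huw'.1.1.2
      rwa [show a + u - (u + -w) = a + w by abel] at this
    -- The end `w` cannot be moved by `P`: it could only move to `u`, but `u - w` is outside `S`.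
    have hgood : ∀ x ∈ W, -w + x ∉ P := by
      intro x hx hP
      have h1 : x = u := h.sing_end (a := w) hu hx (by rwa [add_comm]) hP
      subst h1
      refine huw'.1.2 ?_
      rw [add_comm]
      exact (h.config.pos_subset hP).1
    have hfin : ∀ p, p ∈ W → p + u ∈ nilSet S → (w ≠ p ∧ w ≠ -p) → p + w ∉ S →
        (∀ x ∈ W, -p + x ∉ P) → False := by
      intro p hp hpu hwp hpS hpg
      have hΦ := add_mem_edges_inter hp hw hwp (hU p hpu)
      have hsing : p + w ∈ singSet (edges W ∩ U) S P := by
        refine ⟨⟨hΦ, hpS⟩, fun δ hδ hδ' => ?_⟩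
        rcases h.basis.exists_of_add_mem hp hw hΦ.1 (h.config.pos_closed.1 hδ).1 hδ'.1 with
          ⟨x, hx, rfl, -⟩ | ⟨x, hx, rfl, -⟩
        exacts [hpg x hx hδ, hgood x hx hδ]
      exact h.not_nil_of_sing_add hsing huw' hpu (by abel)
    -- By `sing_end`, `P` can move the ends of `a + b` only onto each other, and not both ways. With
    -- `p` the end that cannot be moved, `p + w` is singular and `(p + w) + (u - w) = p + u` gives a
    -- pair.
    by_cases hP : -a + b ∈ P
    · have hbS : b + w ∉ S := by
        intro hbS
        refine hS ?_
        rw [add_comm] at hbS ⊢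
        refine h.closed_step hw ha hbS ?_ (Ne.symm hwa.1) ?_
        · have := (h.config.pos_subset hP).2
          rwa [neg_add_rev, neg_neg] at this
        · intro h0; exact hwa.2 (by rw [h0, neg_neg])
      refine hfin b hb hbu hwb hbS fun x hx hx' => ?_
      have h1 : x = a := h.sing_end (a := b) ha hx (by rwa [add_comm]) hx'
      subst h1
      refine h.config.neg_notMem _ hP ?_
      rwa [neg_add_rev, neg_neg]
    · refine hfin a ha hau hwa hS fun x hx hx' => hP ?_
      have h1 : x = b := h.sing_end hb hx hab hx'
      rwa [h1] at hx'
  have h1 := key a b w ha hb hw hab huw huw' hau hbu hwa hwb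
  have h2 := key b a (-w) hb ha (h.basis.neg_mem w hw) (by rwa [add_comm]) huw'
    (by rwa [neg_neg]) hbu hau ⟨fun h0 => hwb.2 (by rw [← h0, neg_neg]), fun h0 => hwb.1 (neg_injective h0)⟩
    ⟨fun h0 => hwa.2 (by rw [← h0, neg_neg]), fun h0 => hwa.1 (neg_injective h0)⟩
  -- Both `a + w` and `b - w` are in `S`, hence so is their sum `a + b`.
  exact hab.1.2 (h.closed_step ha hb h1 (by rwa [add_comm]) hba.1 hba.2)

/-- Every element of `A` has a vertex that is cancelled in `A`. -/
theorem cancelled {a b : M} (ha : a ∈ W) (hb : b ∈ W) (hab : a + b ∈ A) :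
    -a + b ∈ A ∨ a + -b ∈ A := by
  by_contra! hc
  obtain ⟨hc1, hc2⟩ := hc
  have hs := h.minRel.sing _ hab
  have hba := h.ne_of_mem ha hb hs.1.1
  have habn := notMem_nilSet_of_mem_singSet hs
  obtain ⟨u, hu, hau⟩ := h.exists_B ha hb hab hc1
  obtain ⟨v, hv, hbv⟩ := h.exists_B hb ha (by rwa [add_comm]) (by rwa [add_comm])
  -- Both ends survive into `B`, and there they are joined to a common vertex `u`, which in turn
  -- survives into `A` in an edge `u + w`. If `w` is cancelled in `A`, `not_of_four` applies;
  -- otherwise `eq_of_mem` for `u + w` identifies both `a` and `b` with one vertex.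
  obtain rfl := h.eq_of_mem ha hb hu hv hab hau hbv
  have hua := h.ne_of_mem ha hu (h.B_mem _ hau)
  have hub := h.ne_of_mem hb hu (h.B_mem _ hbv)
  have hnu : -u + a ∉ B := by
    intro h1
    have := h.B_eq hu hb ha (by rwa [add_comm]) h1
    exact hba.1 this.symm
  obtain ⟨w, hw, huw⟩ := h.exists_A hu ha (by rwa [add_comm]) hnu
  have hws := h.minRel.sing _ huw
  have hne : ∀ a b, a ∈ W → b ∈ W → a + b ∈ A → a + u ∈ B → u ≠ b → u ≠ -b →
      w ≠ a ∧ w ≠ -a := by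
    intro a b ha hb hab hau hub hub'
    constructor
    · rintro rfl
      rw [add_comm] at huw
      exact notMem_nilSet_of_mem_singSet (h.minRel.sing _ huw) (h.minRel.nil _ hau)
    · rintro rfl
      rw [add_comm] at huw
      exact hub (h.A_eq ha hb hu hab huw)
  have hwa := hne a b ha hb hab hau hub.1 hub.2
  have hwb := hne b a hb ha (by rwa [add_comm]) hbv hua.1 hua.2
  by_cases hcw : u + -w ∈ A
  · exact h.not_of_four ha hb hu hw hs hws (h.minRel.sing _ hcw) (h.minRel.nil _ hau)
      (h.minRel.nil _ hbv) hwa hwb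
  · obtain ⟨z, hz, hwz⟩ := h.exists_B hw hu (by rwa [add_comm]) (by rwa [add_comm])
    have h1 := h.eq_of_mem hu hw ha hz huw (by rwa [add_comm]) hwz
    have h2 := h.eq_of_mem hu hw hb hz huw (by rwa [add_comm]) hwz
    exact hba.1 (h2.trans h1.symm)

/-- Otherwise a suitable `s + v` outside `S`, maximal for the order of `P`, is singular, and `(b -
s) + (s + v) = b + v` gives a pair. -/
theorem mem_of_cancelled_aux {b s v : M} (hb : b ∈ W) (hs : s ∈ W) (hv : v ∈ W)
    (h1 : b + s ∈ A) (h2 : b + -s ∈ A) (hbv : b + v ∈ B) : s + v ∈ S := by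
  by_contra hS
  have h1s := h.minRel.sing _ h1
  have h2s := h.minRel.sing _ h2
  have hbvn := h.minRel.nil _ hbv
  have hvs : v ≠ s ∧ v ≠ -s := by
    constructor
    · rintro rfl; exact notMem_nilSet_of_mem_singSet h1s hbvn
    · rintro rfl; exact notMem_nilSet_of_mem_singSet h2s hbvn
  have hU : ∀ v, b + v ∈ nilSet S → s + v ∈ U := by
    intro v hv
    have := U.sub_mem (h.mem_U hv.1) h2s.1.1.2
    rwa [show b + v - (b + -s) = s + v by abel] at this
  let R : Set M := {γ | ∃ v ∈ W, γ = s + v ∧ b + v ∈ nilSet S ∧ b + -v ∉ P ∧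
    γ ∈ edges W ∩ U ∧ γ ∉ S}
  have hR : R.Finite := h.rootSet.finite.subset fun γ hγ => by
    obtain ⟨v, -, -, -, -, h1, -⟩ := hγ
    exact h1
  obtain ⟨γ, ⟨v, hv, rfl, k1, k2, k3, k4⟩, hmax⟩ :=
    h.rootSet.exists_maximal h.config.pos_closed h.config.neg_notMem hR
      ⟨s + v, v, hv, rfl, hbvn, h.notMem_pos hb hv hbv, add_mem_edges_inter hs hv hvs (hU v hbvn), hS⟩
  have hsv := h.ne_of_mem hv hs (by rwa [add_comm])
  have hsing : s + v ∈ singSet (edges W ∩ U) S P := by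
    refine ⟨⟨k3, k4⟩, fun δ hδ hδ' => ?_⟩
    have hδΦ := h.config.pos_closed.1 hδ
    rcases h.basis.exists_of_add_mem hs hv k3.1 hδΦ.1 hδ'.1 with ⟨x, hx, rfl, -⟩ | ⟨x, hx, rfl, hxs⟩
    · have := h.sing_end (a := s) hb hx (by rwa [add_comm]) hδ
      subst this
      refine h2s.1.2 ?_
      rw [add_comm]
      exact (h.config.pos_subset hδ).1
    · refine hmax _ (AddSubmonoid.subset_closure hδ) (h.rootSet.ne_zero hδΦ) ?_
      obtain ⟨m1, m2, m3⟩ := h.raise hb hv hs hx k1 k2 (by rwa [add_comm]) hsv hδ hxs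
      have e : s + v + (-v + x) = s + x := by abel
      rw [e] at hδ' ⊢
      rw [add_comm] at m3
      exact ⟨x, hx, rfl, m1, m2, hδ', m3⟩
  exact h.not_nil_of_sing_add h2s hsing k1 (by abel)

/-- The roots `±a + v` are in `S`. If `a + v` were in the Levi part, subtracting it from `b + v`
would put `b - a` in the nilradical; the other sign is symmetric. -/
theorem mem_of_cancelled {b a v : M} (hb : b ∈ W) (ha : a ∈ W) (hv : v ∈ W)
    (h1 : b + a ∈ A) (h2 : b + -a ∈ A) (hbv : b + v ∈ B) :
    a + v ∈ nilSet S ∧ -a + v ∈ nilSet S := by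
  have hna := h.basis.neg_mem a ha
  have key : ∀ a ∈ W, b + a ∈ A → b + -a ∈ A → a + v ∈ nilSet S := by
    intro a ha h1 h2
    refine (mem_levi_or_nil (h.mem_of_cancelled_aux hb ha hv h1 h2 hbv)).resolve_left fun hk => ?_
    have hna := h.basis.neg_mem a ha
    have hnab := h.ne_of_mem hb hna (h.A_mem _ h2)
    refine notMem_nilSet_of_mem_singSet (h.minRel.sing _ h2)
      (h.nil_step hb hna (h.minRel.nil _ hbv) ?_ hnab.1 hnab.2)
    have := hk.2
    rwa [neg_add_rev] at this
  exact ⟨key a ha h1 h2, key (-a) hna h2 (by rwa [neg_neg])⟩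

end MinCtx

/-- In a subsystem of a root system of type `D` cut out by a subgroup, a relation between singular
roots and roots of the nilradical gives one which involves only two singular roots. -/
theorem hasPair_of_rel {W : Set M} {c : M → M →+ ℝ} {U : AddSubgroup M} {S P : Set M}
    (hW : IsSignedBasis W c) (hc : IsConfig (edges W ∩ U) S P) {A B : Multiset M}
    (hr : Rel (edges W ∩ U) S P A B) : HasPair (edges W ∩ U) S P := by
  by_contra hno
  obtain ⟨A, B, hm⟩ := exists_minRel hr
  have h : MinCtx W c U S P A B := ⟨hW, hc, hno, hm⟩
  -- an element of `A` with its cancelled vertex second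
  obtain ⟨b, hb, a, ha, h1, h2⟩ : ∃ b ∈ W, ∃ a ∈ W, b + a ∈ A ∧ b + -a ∈ A := by
    have hA : A ≠ 0 := by
      rintro rfl
      exact sum_nil_ne_zero h.rootSet hc hm.nil hm.ne_zero (by rw [← hm.sum_eq]; simp)
    obtain ⟨x, hx⟩ := Multiset.exists_mem_of_ne_zero hA
    obtain ⟨v, hv, w, hw, -, -, rfl⟩ := (h.A_mem x hx).1
    rcases h.cancelled hv hw hx with h1 | h1
    · exact ⟨w, hw, v, hv, by rwa [add_comm], by rwa [add_comm]⟩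
    · exact ⟨v, hv, w, hw, hx, h1⟩
  have hnB : ∀ v, v ∈ W → b + v ∈ nilSet S → b + -v ∉ nilSet S := fun v hv hv1 hv2 =>
    h.not_nil_of_sing_add_two (hm.sing _ h1) (hm.sing _ h2) hv1 hv2 (by abel)
  have hB : ∀ b ∈ W, ∀ a ∈ W, b + a ∈ A → b + -a ∈ A → ∃ u ∈ W, b + u ∈ B := by
    intro b hb a ha h1 h2
    refine h.exists_B hb ha h1 fun h3 => ?_
    have := h.A_eq hb (hW.neg_mem a ha) ha h2 h3
    exact hW.ne_neg ha this
  have hAB : ∀ b ∈ W, ∀ a ∈ W, ∀ v ∈ W, b + a ∈ A → b + -a ∈ A → b + v ∈ B →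
      ∃ d ∈ W, v + d ∈ A := by
    intro b hb a ha v hv h1 h2 h3
    refine h.exists_A hv hb (by rwa [add_comm]) fun h4 => ?_
    exact h.not_nil_of_sing_add_two (hm.sing _ h1) (hm.sing _ h2) (hm.nil _ h3) (hm.nil _ h4)
      (by abel)
  -- The edges `b ± a` in `A` lead to vertices `v` of `B` and back to edges `v + d` of `A`. A vertex
  -- `v` that is maximal for the order of the nilradical stops this process.
  let Z : Set M := {v | v ∈ W ∧ b + v ∈ nilSet S ∧ a + v ∈ nilSet S ∧ -a + v ∈ nilSet S ∧
    ∃ d ∈ W, v + d ∈ A}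
  have hZ : Z.Nonempty := by
    obtain ⟨v, hv, hbv⟩ := hB b hb a ha h1 h2
    obtain ⟨k1, k2⟩ := h.mem_of_cancelled hb ha hv h1 h2 hbv
    exact ⟨v, hv, hm.nil _ hbv, k1, k2, hAB b hb a ha v hv h1 h2 hbv⟩
  obtain ⟨v, ⟨hv, k1, k2, k3, d, hd, hvd⟩, hmax⟩ :=
    h.rootSet.exists_maximal (nil_closed h.rootSet.neg_mem hc.closed)
      (fun _ => neg_notMem_nilSet) (hW.finite.subset fun v hv => hv.1 : Z.Finite) hZ
  -- If `v` is cancelled, the edges `d ± v` lead to a vertex `z` with `z - v` in the nilradical,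
  -- which is a larger element of `Z`. If `d` is cancelled, `(v + d) + (v - d) = (a + v) + (-a + v)`
  -- gives a pair.
  rcases h.cancelled hv hd hvd with hc1 | hc1
  · have h3 : d + v ∈ A := by rwa [add_comm]
    have h4 : d + -v ∈ A := by rwa [add_comm]
    obtain ⟨z, hz, hdz⟩ := hB d hd v hv h3 h4
    obtain ⟨m1, m2⟩ := h.mem_of_cancelled hd hv hz h3 h4 hdz
    obtain ⟨d', hd', hzd'⟩ := hAB d hd v hv z hz h3 h4 hdz
    have hstep : ∀ s ∈ W, s + v ∈ nilSet S → (z ≠ s ∧ z ≠ -s) → s + z ∈ nilSet S :=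
      fun s hs hsv hzs => h.nil_step hs hz hsv m2.1 hzs.1 hzs.2
    have hzb : z ≠ b ∧ z ≠ -b := by
      constructor
      · rintro rfl; exact hnB v hv k1 (by rwa [add_comm])
      · rintro rfl; exact k1.2 (by rw [neg_add_rev]; exact m2.1)
    have hbz := hstep b hb k1 hzb
    have hza : z ≠ a ∧ z ≠ -a := by
      constructor
      · rintro rfl; exact notMem_nilSet_of_mem_singSet (hm.sing _ h1) hbz
      · rintro rfl; exact notMem_nilSet_of_mem_singSet (hm.sing _ h2) hbz
    refine hmax _ (AddSubmonoid.subset_closure m2) (h.rootSet.ne_zero (hc.closed.1 m2.1)) ?_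
    rw [show v + (-v + z) = z by abel]
    refine ⟨hz, hbz, hstep a ha k2 hza, hstep (-a) (hW.neg_mem a ha) k3 ?_, d', hd', hzd'⟩
    rw [neg_neg]
    exact hza.symm
  · exact h.not_nil_of_sing_add_two (hm.sing _ hvd) (hm.sing _ hc1) k2 k3 (by abel)

end RootCone

/-! ### Rational relations, foldings, and strong orthogonality from long roots. -/

namespace RootCone

variable {M M' : Type*} [AddCommGroup M] [AddCommGroup M']

theorem nsmul_mem_closure_of_mem_span [Module ℚ≥0 M] {T : Set M} {x : M}
    (hx : x ∈ Submodule.span ℚ≥0 T) : ∃ k : ℕ, 0 < k ∧ k • x ∈ AddSubmonoid.closure T := by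
  induction hx using Submodule.span_induction with
  | mem x hx => exact ⟨1, one_pos, by simpa using AddSubmonoid.subset_closure hx⟩
  | zero => exact ⟨1, one_pos, by simp⟩
  | add x y _ _ hx hy =>
    obtain ⟨k, hk, hx⟩ := hx
    obtain ⟨l, hl, hy⟩ := hy
    refine ⟨k * l, Nat.mul_pos hk hl, ?_⟩
    rw [smul_add]
    refine add_mem ?_ ?_
    · rw [mul_comm, mul_smul]; exact AddSubmonoid.nsmul_mem _ hx l
    · rw [mul_smul]; exact AddSubmonoid.nsmul_mem _ hy k
  | smul q x _ hx =>
    obtain ⟨k, hk, hx⟩ := hx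
    refine ⟨q.den * k, Nat.mul_pos q.den_pos hk, ?_⟩
    have : (q.den * k) • q • x = q.num • k • x := by
      simp only [← Nat.cast_smul_eq_nsmul ℚ≥0, smul_smul]
      congr 1
      push_cast
      have := NNRat.den_mul_eq_num q
      rw [mul_right_comm, this]
    rw [this]
    exact AddSubmonoid.nsmul_mem _ hx _

theorem exists_rel {Φ S P : Set M} [Module ℚ≥0 M] {w : M}
    (h1 : w ∈ Submodule.span ℚ≥0 (nilSet S)) (h2 : w ∈ Submodule.span ℚ≥0 (singSet Φ S P))
    (hw : w ≠ 0) : ∃ A B, Rel Φ S P A B := by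
  obtain ⟨k, hk, h1⟩ := nsmul_mem_closure_of_mem_span h1
  obtain ⟨l, hl, h2⟩ := nsmul_mem_closure_of_mem_span h2
  have h1 := AddSubmonoid.nsmul_mem _ h1 l
  have h2 := AddSubmonoid.nsmul_mem _ h2 k
  obtain ⟨B, hB, hBs⟩ := AddSubmonoid.exists_multiset_of_mem_closure h1
  obtain ⟨A, hA, hAs⟩ := AddSubmonoid.exists_multiset_of_mem_closure h2
  refine ⟨A, B, hA, hB, ?_, ?_⟩
  · rw [hAs, hBs, smul_comm]
  · rintro rfl
    rw [Multiset.sum_zero, smul_smul, ← Nat.cast_smul_eq_nsmul ℚ≥0] at hBs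
    have hne : ((l * k : ℕ) : ℚ≥0) ≠ 0 := by exact_mod_cast (Nat.mul_pos hl hk).ne'
    apply hw
    calc w = ((l * k : ℕ) : ℚ≥0)⁻¹ • ((l * k : ℕ) : ℚ≥0) • w := by
          rw [smul_smul, inv_mul_cancel₀ hne, one_smul]
      _ = 0 := by rw [← hBs, smul_zero]

/-- A map `π` from a set of roots `Φ'` onto a set of roots `Φ`, with a doubled section `s`. -/
structure IsFolding (Φ : Set M) (Φ' : Set M') (π : M' →+ M) (s : M →+ M') : Prop where
  map_mem : ∀ x ∈ Φ', π x ∈ Φ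
  lift : ∀ a ∈ Φ, ∃ x ∈ Φ', ∃ y ∈ Φ', π x = a ∧ π y = a ∧ s a = x + y
  lift_add : ∀ x ∈ Φ', ∀ d ∈ Φ, π x + d ∈ Φ → ∃ y ∈ Φ', π y = d ∧ x + y ∈ Φ'

namespace IsFolding

variable {Φ S P : Set M} {Φ' : Set M'} {π : M' →+ M} {s : M →+ M'} (hπ : IsFolding Φ Φ' π s)
  (hneg : ∀ x ∈ Φ', -x ∈ Φ')

include hπ in
theorem closed (hS : IsClosedIn Φ S) : IsClosedIn Φ' (Φ' ∩ π ⁻¹' S) := by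
  refine ⟨Set.inter_subset_left, fun x hx y hy hxy => ⟨hxy, ?_⟩⟩
  have := hS.2 _ hx.2 _ hy.2
  rw [← map_add] at this
  exact this (hπ.map_mem _ hxy)

include hneg in
theorem leviSet_eq : leviSet (Φ' ∩ π ⁻¹' S) = Φ' ∩ π ⁻¹' leviSet S := by
  ext x
  simp only [leviSet, Set.mem_ofPred_eq, Set.mem_inter_iff, Set.mem_preimage, map_neg]
  exact ⟨fun h => ⟨h.1.1, h.1.2, h.2.2⟩, fun h => ⟨⟨h.1, h.2.1⟩, hneg x h.1, h.2.2⟩⟩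

include hneg in
theorem nilSet_eq : nilSet (Φ' ∩ π ⁻¹' S) = Φ' ∩ π ⁻¹' nilSet S := by
  ext x
  simp only [nilSet, Set.mem_ofPred_eq, Set.mem_inter_iff, Set.mem_preimage, map_neg, not_and]
  exact ⟨fun h => ⟨h.1.1, h.1.2, h.2 (hneg x h.1.1)⟩, fun h => ⟨⟨h.1, h.2.1⟩, fun _ => h.2.2⟩⟩

include hπ hneg in
theorem config (hc : IsConfig Φ S P) : IsConfig Φ' (Φ' ∩ π ⁻¹' S) (Φ' ∩ π ⁻¹' P) where
  closed := hπ.closed hc.closed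
  pos_closed := hπ.closed hc.pos_closed
  pos_subset := by
    rw [leviSet_eq hneg]
    exact fun x hx => ⟨hx.1, hc.pos_subset hx.2⟩
  pos_or_neg := by
    rw [leviSet_eq hneg]
    intro x hx
    refine (hc.pos_or_neg _ hx.2).imp (fun h => ⟨hx.1, h⟩) fun h => ⟨hneg x hx.1, ?_⟩
    rwa [Set.mem_preimage, map_neg]
  neg_notMem := by
    intro x hx hx'
    refine hc.neg_notMem _ hx.2 ?_
    rw [← map_neg]
    exact hx'.2

-- Singularity upstairs a priori tests fewer sums than downstairs. The field `lift_add` closes this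
-- gap: every element of `P` that can be added to `π x` has a lift that can be added to `x`.
include hπ in
theorem singSet_eq (hc : IsConfig Φ S P) :
    singSet Φ' (Φ' ∩ π ⁻¹' S) (Φ' ∩ π ⁻¹' P) = Φ' ∩ π ⁻¹' singSet Φ S P := by
  ext x
  constructor
  · rintro ⟨⟨hx, hxS⟩, h⟩
    refine ⟨hx, ⟨hπ.map_mem x hx, fun h' => hxS ⟨hx, h'⟩⟩, fun d hd hd' => ?_⟩
    obtain ⟨y, hy, rfl, hxy⟩ := hπ.lift_add x hx d (hc.pos_closed.1 hd) hd'
    exact h y ⟨hy, hd⟩ hxy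
  · rintro ⟨hx, ⟨-, hxS⟩, h⟩
    refine ⟨⟨hx, fun h' => hxS h'.2⟩, fun d hd hd' => ?_⟩
    have := hπ.map_mem _ hd'
    rw [map_add] at this
    exact h _ hd.2 this

-- A root need not have an additive choice of a single lift, but the sum of its two chosen lifts is
-- the additive map `s`. Lifting each summand twice therefore turns equal sums into equal sums.
include hπ in
theorem exists_lift {T : Set M} (hT : T ⊆ Φ) (A : Multiset M) (hA : ∀ x ∈ A, x ∈ T) :
    ∃ A' : Multiset M', (∀ x ∈ A', x ∈ Φ' ∩ π ⁻¹' T) ∧ A'.sum = s A.sum ∧ (A ≠ 0 → A' ≠ 0) := by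
  induction A using Multiset.induction with
  | empty => exact ⟨0, by simp, by simp, fun h => absurd rfl h⟩
  | cons a A ih =>
    obtain ⟨A', h1, h2, -⟩ := ih fun x hx => hA x (by simp [hx])
    have ha := hA a (by simp)
    obtain ⟨x, hx, y, hy, hxa, hya, hxy⟩ := hπ.lift a (hT ha)
    refine ⟨x ::ₘ y ::ₘ A', ?_, ?_, fun _ => by simp⟩
    · intro z hz
      simp only [Multiset.mem_cons] at hz
      rcases hz with rfl | rfl | hz
      · exact ⟨hx, by rwa [Set.mem_preimage, hxa]⟩
      · exact ⟨hy, by rwa [Set.mem_preimage, hya]⟩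
      · exact h1 z hz
    · simp only [Multiset.sum_cons, map_add, h2, hxy, add_assoc]

include hπ hneg in
theorem exists_rel (hc : IsConfig Φ S P) {A B : Multiset M} (h : Rel Φ S P A B) :
    ∃ A' B', Rel Φ' (Φ' ∩ π ⁻¹' S) (Φ' ∩ π ⁻¹' P) A' B' := by
  obtain ⟨A', hA, hAs, -⟩ := hπ.exists_lift (fun x hx => hx.1.1) A h.sing
  obtain ⟨B', hB, hBs, hB0⟩ := hπ.exists_lift (fun x hx => hc.closed.1 hx.1) B h.nil
  refine ⟨A', B', ?_, ?_, by rw [hAs, hBs, h.sum_eq], hB0 h.ne_zero⟩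
  · rwa [hπ.singSet_eq hc]
  · rwa [nilSet_eq hneg]

-- The image of the pair has a nonzero sum although `π` has a kernel, because that sum is also a
-- nonempty sum of nilradical roots downstairs.
include hπ hneg in
theorem hasPair {p : M → M →+ ℝ} (hΦ : IsRootSet Φ p) (hc : IsConfig Φ S P)
    (h : HasPair Φ' (Φ' ∩ π ⁻¹' S) (Φ' ∩ π ⁻¹' P)) : HasPair Φ S P := by
  obtain ⟨x, hx, y, hy, h0, hm⟩ := h
  rw [hπ.singSet_eq hc] at hx hy
  rw [nilSet_eq hneg] at hm
  obtain ⟨B, hB, hBs⟩ := AddSubmonoid.exists_multiset_of_mem_closure hm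
  have hB' : ∀ z ∈ B.map π, z ∈ nilSet S := by
    intro z hz
    obtain ⟨b, hb, rfl⟩ := Multiset.mem_map.1 hz
    exact (hB b hb).2
  have e : π x + π y = (B.map π).sum := by rw [← map_multiset_sum, hBs, map_add]
  refine ⟨π x, hx.2, π y, hy.2, ?_, ?_⟩
  · rw [e]
    refine sum_nil_ne_zero hΦ hc hB' fun hB0 => h0 ?_
    rw [Multiset.map_eq_zero] at hB0
    rw [← hBs, hB0, Multiset.sum_zero]
  · rw [e]
    exact multiset_sum_mem_closure hB'

end IsFolding

/-- In a set of roots that is a folding of a subsystem of a root system of type `D`, a relation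
gives a pair. -/
theorem IsFolding.hasPair_of_rel {Φ S P : Set M} {p : M → M →+ ℝ} {W : Set M'} {c : M' → M' →+ ℝ}
    {U : AddSubgroup M'} {π : M' →+ M} {s : M →+ M'} (hW : IsSignedBasis W c)
    (hπ : IsFolding Φ (edges W ∩ U) π s) (hΦ : IsRootSet Φ p) (hc : IsConfig Φ S P)
    {A B : Multiset M} (h : Rel Φ S P A B) : HasPair Φ S P := by
  have hneg := (hW.isRootSet.inter U).neg_mem
  obtain ⟨A', B', h'⟩ := hπ.exists_rel hneg hc h
  exact hπ.hasPair hneg hΦ hc (RootCone.hasPair_of_rel hW (hπ.config hneg hc) h')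

theorem exists_card_le {N : Set M} {w : M} (hw : w ∈ AddSubmonoid.closure N) :
    ∃ B : Multiset M, (∀ x ∈ B, x ∈ N) ∧ B.sum = w ∧
      ∀ B' : Multiset M, (∀ x ∈ B', x ∈ N) → B'.sum = w → B.card ≤ B'.card := by
  classical
  have h1 : ∃ n, ∃ B : Multiset M, (∀ x ∈ B, x ∈ N) ∧ B.sum = w ∧ B.card = n := by
    obtain ⟨B, hB, hs⟩ := AddSubmonoid.exists_multiset_of_mem_closure hw
    exact ⟨_, B, hB, hs, rfl⟩
  obtain ⟨B, hB, hs, hn⟩ := Nat.find_spec h1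
  exact ⟨B, hB, hs, fun B' hB' hs' => by rw [hn]; exact Nat.find_min' h1 ⟨B', hB', hs', rfl⟩⟩

/-- A root whose pairing with all other roots is at most one. -/
def IsLongRoot (Φ : Set M) (p : M → M →+ ℝ) (x : M) : Prop := ∀ a ∈ Φ, a ≠ x → p x a ≤ 1

/-- If of two roots with a difference, but not a sum, one is always long, then a sum of two
singular roots in the cone of the nilradical is a sum of equal or strongly orthogonal roots. -/
theorem exists_orthogonal {Φ S P : Set M} {p : M → M →+ ℝ} (hΦ : IsRootSet Φ p)
    (hc : IsConfig Φ S P) (hself : ∀ x ∈ Φ, p x x = 2)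
    (hsub : ∀ x ∈ Φ, ∀ y ∈ Φ, x - y ∈ Φ → x + y ∉ Φ → x + y ≠ 0 → 1 ≤ p x y)
    (hlong : ∀ x ∈ Φ, ∀ y ∈ Φ, x - y ∈ Φ → x + y ∉ Φ → x + y ≠ 0 →
      IsLongRoot Φ p x ∨ IsLongRoot Φ p y) {a b : M} (ha : a ∈ singSet Φ S P)
    (hb : b ∈ singSet Φ S P) (hab : a + b ∈ AddSubmonoid.closure (nilSet S)) :
    ∃ B : Multiset M, (∀ x ∈ B, x ∈ nilSet S) ∧ B.sum = a + b ∧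
      ∀ x ∈ B, ∀ y ∈ B, x ≠ y → x + y ∉ Φ ∧ x + y ≠ 0 ∧ x - y ∉ Φ := by
  obtain ⟨B, hB, hs, hmin⟩ := exists_card_le hab
  have hadd := fun {x y : M} => nil_add_of_card_le hΦ hc (x := x) (y := y) hB
    (fun B' hB' h => hmin B' hB' (h.trans hs))
  have key : ∀ x ∈ B, ∀ y ∈ B, x ≠ y → x - y ∈ Φ → IsLongRoot Φ p x → False := by
    intro x hx y hy hxy hsubxy hl
    obtain ⟨h1, h2⟩ := hadd hx hy hxy
    have hΦB : ∀ z ∈ B, z ∈ Φ := fun z hz => hc.closed.1 (hB z hz).1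
    have hxy1 := hsub x (hΦB x hx) y (hΦB y hy) hsubxy h1 h2
    have hn : ∀ z ∈ B, 0 ≤ p x z := by
      intro z hz
      by_cases hzx : x = z
      · rw [← hzx]; exact (hΦ.self_pos x (hΦB x hx)).le
      · obtain ⟨h3, h4⟩ := hadd hx hz hzx
        exact hΦ.nonneg_of_add_notMem (hΦB x hx) (hΦB z hz) h3 h4
    obtain ⟨t, rfl⟩ := Multiset.exists_cons_of_mem hx
    obtain ⟨u, rfl⟩ := Multiset.exists_cons_of_mem
      ((Multiset.mem_cons.1 hy).resolve_left hxy.symm)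
    have hu : 0 ≤ p x u.sum := by
      rw [map_multiset_sum]
      apply Multiset.sum_nonneg
      intro r hr
      obtain ⟨z, hz, rfl⟩ := Multiset.mem_map.1 hr
      exact hn z (by simp [hz])
    -- Pair both expressions for the sum with the coroot of the long root `x`. The nilradical side
    -- contributes 2 from `x`, at least 1 from `y` and nothing negative; each of `a`, `b`
    -- contributes at most 1.
    have h3 := congrArg (p x) hs
    simp only [Multiset.sum_cons, map_add] at h3
    rw [hself x (hΦB x hx)] at h3
    have hx' := hB x hx
    have h4 := hl a ha.1.1 fun h => notMem_nilSet_of_mem_singSet ha (h ▸ hx')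
    have h5 := hl b hb.1.1 fun h => notMem_nilSet_of_mem_singSet hb (h ▸ hx')
    linarith
  refine ⟨B, hB, hs, fun x hx y hy hxy => ?_⟩
  obtain ⟨h1, h2⟩ := hadd hx hy hxy
  refine ⟨h1, h2, fun h3 => ?_⟩
  rcases hlong x (hc.closed.1 (hB x hx).1) y (hc.closed.1 (hB y hy).1) h3 h1 h2 with h4 | h4
  · exact key x hx y hy hxy h3 h4
  · refine key y hy x hx hxy.symm ?_ h4
    rw [← neg_sub]
    exact hΦ.neg_mem _ h3

end RootCone

/-! ### Type C: splittings and the exceptional relation. -/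

namespace RootCone

variable {M : Type*} [AddCommGroup M]

/-- The sums of two elements of `W` that are not opposite. -/
def symplecticEdges (W : Set M) : Set M := {x | ∃ v ∈ W, ∃ w ∈ W, w ≠ -v ∧ x = v + w}

namespace IsSignedBasis

variable {W : Set M} {c : M → M →+ ℝ} (hW : IsSignedBasis W c)
include hW

theorem apply_le_one {v w : M} (hv : v ∈ W) (hw : w ∈ W) : c v w ≤ 1 := by
  by_cases h : w = v
  · rw [h, hW.apply_self v hv]
  · by_contra! h'
    exact h (hW.eq_of_apply_pos hv hw (by linarith))

theorem apply_nonpos {v w : M} (hv : v ∈ W) (hw : w ∈ W) (h : w ≠ v) : c v w ≤ 0 := by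
  by_contra! h'
  exact h (hW.eq_of_apply_pos hv hw h')

theorem one_le_apply_add {a b : M} (ha : a ∈ W) (hb : b ∈ W) (h : b ≠ -a) :
    1 ≤ c a (a + b) := by
  rw [map_add, hW.apply_self a ha]
  linarith [hW.apply_nonneg ha hb h]

theorem eq_or_eq_of_add_eq {a b v w : M} (ha : a ∈ W) (hb : b ∈ W) (hv : v ∈ W) (hw : w ∈ W)
    (h : b ≠ -a) (e : a + b = v + w) : (a = v ∧ b = w) ∨ (a = w ∧ b = v) := by
  have h1 := hW.one_le_apply_add ha hb h
  rw [e] at h1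
  rcases hW.mem_of_apply_add_pos ha hv hw (by linarith) with rfl | rfl
  · exact Or.inl ⟨rfl, add_left_cancel e⟩
  · rw [add_comm v] at e
    exact Or.inr ⟨rfl, add_left_cancel e⟩

theorem ne_neg_of_mem {a b : M} (h : a + b ∈ symplecticEdges W) :
    b ≠ -a := by
  rintro rfl
  obtain ⟨v, hv, w, hw, h1, h2⟩ := h
  have := hW.one_le_apply_add hv hw h1
  rw [← h2] at this
  simp at this
  linarith

/-- Without cancellation each of the four vertices would be an end of the root `g + k`. Counting
ends, with `c g + c k` (or `c k` when `g = k`), would then give four on one side and two on the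
other. -/
theorem exists_cancel {u v y z : M} (hu : u ∈ W) (hv : v ∈ W) (hy : y ∈ W) (hz : z ∈ W)
    (huv : v ≠ -u) (hyz : z ≠ -y) (h : u + v + (y + z) ∈ symplecticEdges W) :
    y = -u ∨ y = -v ∨ z = -u ∨ z = -v := by
  by_contra! hc
  obtain ⟨hyu, hyv, hzu, hzv⟩ := hc
  obtain ⟨g, hg, k, hk, hgk, e⟩ := h
  have hsw : ∀ {a b : M}, b ≠ -a → a ≠ -b := fun h h' => h (by rw [h', neg_neg])
  have hmem : ∀ a b d f, a ∈ W → b ∈ W → d ∈ W → f ∈ W → b ≠ -a → d ≠ -a → f ≠ -a →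
      a + b + (d + f) = g + k → g = a ∨ k = a := by
    intro a b d f ha hb hd hf h1 h2 h3 e
    refine hW.mem_of_apply_add_pos ha hg hk ?_
    rw [← e]
    simp only [map_add, hW.apply_self a ha]
    linarith [hW.apply_nonneg ha hb h1, hW.apply_nonneg ha hd h2, hW.apply_nonneg ha hf h3]
  have h1 := hmem u v y z hu hv hy hz huv hyu hzu e
  have h2 := hmem v u y z hv hu hy hz (hsw huv) hyv hzv (by rw [← e]; abel)
  have h3 := hmem y z u v hy hz hu hv hyz (hsw hyu) (hsw hyv) (by rw [← e]; abel)
  have h4 := hmem z y u v hz hy hu hv (hsw hyz) (hsw hzu) (hsw hzv) (by rw [← e]; abel)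
  by_cases hgk' : k = g
  · subst hgk'
    rw [or_self] at h1 h2 h3 h4
    subst h1 h2 h3 h4
    have := congrArg (c k) e
    simp only [map_add, hW.apply_self k hk] at this
    norm_num at this
  · have hF : ∀ a, (g = a ∨ k = a) → c g a + c k a = 1 := by
      have h0 := hW.apply_of_ne g hg k hk hgk' hgk
      rintro a (rfl | rfl)
      · rw [hW.apply_self _ hg, ← hW.apply_symm hg hk, h0, add_zero]
      · rw [hW.apply_self _ hk, h0, zero_add]
    have e1 := congrArg (c g) e
    have e2 := congrArg (c k) e
    simp only [map_add] at e1 e2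
    linarith [hF u h1, hF v h2, hF y h3, hF z h4, hF g (Or.inl rfl), hF k (Or.inr rfl)]

end IsSignedBasis

/-- A symmetric closed set of roots that contains the Levi part of `S`. -/
structure IsLeviExtension (Φ S Ψ : Set M) : Prop where
  closed : IsClosedIn Φ Ψ
  neg_mem : ∀ x ∈ Ψ, -x ∈ Ψ
  levi_subset : leviSet S ⊆ Ψ

namespace IsLeviExtension

variable {Φ S P Ψ : Set M} {p : M → M →+ ℝ} (hΨ : IsLeviExtension Φ S Ψ)
include hΨ

theorem leviSet_eq : leviSet (S ∩ Ψ) = leviSet S := by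
  ext x
  refine ⟨fun h => ⟨h.1.1, h.2.1⟩, fun h => ?_⟩
  have := hΨ.levi_subset h
  exact ⟨⟨h.1, this⟩, h.2, hΨ.neg_mem _ this⟩

theorem nilSet_eq : nilSet (S ∩ Ψ) = nilSet S ∩ Ψ := by
  ext x
  exact ⟨fun h => ⟨⟨h.1.1, fun h' => h.2 ⟨h', hΨ.neg_mem _ h.1.2⟩⟩, h.1.2⟩,
    fun h => ⟨⟨h.1.1, h.2⟩, fun h' => h.1.2 h'.1⟩⟩

theorem rootSet (hΦ : IsRootSet Φ p) : IsRootSet Ψ p where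
  finite := hΦ.finite.subset hΨ.closed.1
  neg_mem := hΨ.neg_mem
  self_pos := fun x hx => hΦ.self_pos x (hΨ.closed.1 hx)
  pos_symm := fun x hx y hy => hΦ.pos_symm x (hΨ.closed.1 hx) y (hΨ.closed.1 hy)
  neg_symm := fun x hx y hy => hΦ.neg_symm x (hΨ.closed.1 hx) y (hΨ.closed.1 hy)
  add_mem := fun x hx y hy h => (hΦ.add_mem x (hΨ.closed.1 hx) y (hΨ.closed.1 hy) h).imp_left
    fun h => hΨ.closed.2 x hx y hy h

theorem config (hc : IsConfig Φ S P) : IsConfig Ψ (S ∩ Ψ) P where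
  closed := ⟨Set.inter_subset_right, fun x hx y hy h =>
    ⟨hc.closed.2 x hx.1 y hy.1 (hΨ.closed.1 h), h⟩⟩
  pos_closed := ⟨fun x hx => hΨ.levi_subset (hc.pos_subset hx), fun x hx y hy h =>
    hc.pos_closed.2 x hx y hy (hΨ.closed.1 h)⟩
  pos_subset := by rw [hΨ.leviSet_eq]; exact hc.pos_subset
  pos_or_neg := by rw [hΨ.leviSet_eq]; exact hc.pos_or_neg
  neg_notMem := hc.neg_notMem

end IsLeviExtension

section

variable {W : Set M} {c : M → M →+ ℝ} {S P : Set M} {p : M → M →+ ℝ}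

/-- The roots both or none of whose ends are in `X`. -/
def splitRoots (W X Ψ : Set M) : Set M :=
  {z ∈ Ψ | ∃ v ∈ W, ∃ w ∈ W, z = v + w ∧ (v ∈ X ↔ w ∈ X)}

/-- When two such roots add up to a root, a vertex of one cancels a vertex of the other, so the
condition on `X` is transmitted from one remaining end to the other. -/
theorem isLeviExtension_splitRoots (hW : IsSignedBasis W c) {Ψ X : Set M}
    (hΨ : IsLeviExtension (symplecticEdges W) S Ψ) (hneg : ∀ v ∈ X, -v ∈ X)
    (hX : ∀ v ∈ W, ∀ w ∈ W, v + w ∈ leviSet S → v ∈ X → w ∈ X) :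
    IsLeviExtension (symplecticEdges W) S (splitRoots W X Ψ) where
  closed := by
    refine ⟨fun x hx => hΨ.closed.1 hx.1, ?_⟩
    rintro x ⟨hx, v, hv, w, hw, rfl, h1⟩ y ⟨hy, v', hv', w', hw', rfl, h2⟩ h
    have h3 := hW.ne_neg_of_mem (hΨ.closed.1 hx)
    have h4 := hW.ne_neg_of_mem (hΨ.closed.1 hy)
    refine ⟨hΨ.closed.2 _ hx _ hy h, ?_⟩
    have hn : ∀ v, -v ∈ X ↔ v ∈ X := fun v => ⟨fun h => by simpa using hneg _ h, hneg v⟩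
    rcases hW.exists_cancel hv hw hv' hw' h3 h4 h with rfl | rfl | rfl | rfl
    · exact ⟨w, hw, w', hw', by abel, by rw [← h1, ← h2, hn]⟩
    · exact ⟨v, hv, w', hw', by abel, by rw [h1, ← h2, hn]⟩
    · exact ⟨w, hw, v', hv', by abel, by rw [← h1, h2, hn]⟩
    · exact ⟨v, hv, v', hv', by abel, by rw [h1, h2, hn]⟩
  neg_mem := by
    rintro x ⟨hx, v, hv, w, hw, rfl, h1⟩
    have hn : ∀ v, -v ∈ X ↔ v ∈ X := fun v => ⟨fun h => by simpa using hneg _ h, hneg v⟩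
    exact ⟨hΨ.neg_mem _ hx, -v, hW.neg_mem v hv, -w, hW.neg_mem w hw, by abel, by rw [hn, hn, h1]⟩
  levi_subset := by
    intro x hx
    refine ⟨hΨ.levi_subset hx, ?_⟩
    obtain ⟨v, hv, w, hw, -, rfl⟩ := hΨ.closed.1 (hΨ.levi_subset hx)
    exact ⟨v, hv, w, hw, rfl, hX v hv w hw hx, hX w hw v hv (by rwa [add_comm])⟩

/-- The vertices joined to `a` by the Levi part of `S`, up to sign. -/
def linkedTo (S : Set M) (a : M) : Set M :=
  {v | v = a ∨ v = -a ∨ v + a ∈ leviSet S ∨ v + -a ∈ leviSet S}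

theorem neg_mem_linkedTo {a v : M} (h : v ∈ linkedTo S a) : -v ∈ linkedTo S a := by
  rcases h with rfl | rfl | h | h
  · exact Or.inr (Or.inl rfl)
  · exact Or.inl (neg_neg a)
  · refine Or.inr (Or.inr (Or.inr ?_))
    rw [← neg_add]; exact mem_leviSet_neg h
  · refine Or.inr (Or.inr (Or.inl ?_))
    have := mem_leviSet_neg h
    rwa [neg_add, neg_neg] at this

/-- Roots of the Levi part do not leave a linked class, so unions of such classes may serve as `X`
in `splitRoots`. -/
theorem mem_linkedTo_of_add_mem (hW : IsSignedBasis W c)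
    (hneg : ∀ x ∈ symplecticEdges W, -x ∈ symplecticEdges W)
    (hS : IsClosedIn (symplecticEdges W) S) {a v w : M} (ha : a ∈ W) (hw : w ∈ W)
    (h : v + w ∈ leviSet S) (hv : v ∈ linkedTo S a) : w ∈ linkedTo S a := by
  have key : ∀ a ∈ W, v + a ∈ leviSet S → w = a ∨ w + -a ∈ leviSet S := by
    intro a ha h1
    by_cases hwa : w = a
    · exact Or.inl hwa
    right
    have := levi_add_mem hneg hS h (mem_leviSet_neg h1)
    rw [show v + w + -(v + a) = w + -a by abel] at this
    exact this ⟨w, hw, -a, hW.neg_mem a ha, fun h => hwa (neg_injective h).symm, rfl⟩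
  rcases hv with rfl | rfl | hv | hv
  · exact Or.inr (Or.inr (Or.inl (by rwa [add_comm])))
  · exact Or.inr (Or.inr (Or.inr (by rwa [add_comm])))
  · rcases key a ha hv with h | h
    exacts [Or.inl h, Or.inr (Or.inr (Or.inr h))]
  · rcases key (-a) (hW.neg_mem a ha) hv with h | h
    · exact Or.inr (Or.inl h)
    · rw [neg_neg] at h
      exact Or.inr (Or.inr (Or.inl h))

variable (hW : IsSignedBasis W c) (hΦ : IsRootSet (symplecticEdges W) p)
  (hc : IsConfig (symplecticEdges W) S P) {Ψ : Set M}
  (hΨ : IsLeviExtension (symplecticEdges W) S Ψ)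
include hW hΦ hc hΨ

/-- A pair of singular roots survives in the smaller root system of a splitting. -/
theorem not_of_minimal (hmin : ∀ Ψ', IsLeviExtension (symplecticEdges W) S Ψ' → Ψ' ⊆ Ψ →
      HasPair Ψ' (S ∩ Ψ') P → Ψ ⊆ Ψ') {a b d : M} (ha : a ∈ W) (hb : b ∈ W) (hd : d ∈ W)
    (had : a + d ∈ Ψ) (hda : d ∉ linkedTo S a) (hdb : d ∉ linkedTo S b)
    {x y : M} {B : Multiset M} (hx : x ∈ singSet Ψ (S ∩ Ψ) P) (hy : y ∈ singSet Ψ (S ∩ Ψ) P)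
    (hB : ∀ z ∈ B, z ∈ nilSet S) (hxy : x + y = B.sum) (hB0 : B ≠ 0)
    (hends : ∀ z, z = x ∨ z = y ∨ z ∈ B → ∃ v w, (v = a ∨ v = b) ∧ (w = a ∨ w = b) ∧ z = v + w)
    (hBΨ : ∀ z ∈ B, z ∈ Ψ) : False := by
  -- Splitting along the classes of `a` and `b` keeps the Levi part and the given pair but loses the
  -- root `a + d`, against the minimality of `Ψ`.
  let X := linkedTo S a ∪ linkedTo S b
  have hΨ' : IsLeviExtension (symplecticEdges W) S (splitRoots W X Ψ) := by
    refine isLeviExtension_splitRoots hW hΨ ?_ ?_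
    · rintro v (hv | hv)
      exacts [Or.inl (neg_mem_linkedTo hv), Or.inr (neg_mem_linkedTo hv)]
    · rintro v hv w hw h (hv' | hv')
      · exact Or.inl (mem_linkedTo_of_add_mem hW hΦ.neg_mem hc.closed ha hw h hv')
      · exact Or.inr (mem_linkedTo_of_add_mem hW hΦ.neg_mem hc.closed hb hw h hv')
  have haX : a ∈ X := Or.inl (Or.inl rfl)
  have hbX : b ∈ X := Or.inr (Or.inl rfl)
  have hmem : ∀ z ∈ Ψ, (z = x ∨ z = y ∨ z ∈ B) → z ∈ splitRoots W X Ψ := by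
    intro z hz h
    obtain ⟨v, w, hv, hw, rfl⟩ := hends z h
    refine ⟨hz, v, ?_, w, ?_, rfl, ?_⟩
    · rcases hv with rfl | rfl <;> assumption
    · rcases hw with rfl | rfl <;> assumption
    · have h1 : v ∈ X := by rcases hv with rfl | rfl <;> assumption
      have h2 : w ∈ X := by rcases hw with rfl | rfl <;> assumption
      exact ⟨fun _ => h2, fun _ => h1⟩
  have hsing : ∀ z ∈ singSet Ψ (S ∩ Ψ) P, z ∈ splitRoots W X Ψ →
      z ∈ singSet (splitRoots W X Ψ) (S ∩ splitRoots W X Ψ) P := by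
    intro z hz hz'
    exact ⟨⟨hz', fun h => hz.1.2 ⟨h.1, hz.1.1⟩⟩, fun d hd h => hz.2 d hd h.1⟩
  have hBn : ∀ z ∈ B, z ∈ nilSet (S ∩ splitRoots W X Ψ) := by
    rw [hΨ'.nilSet_eq]
    exact fun z hz => ⟨hB z hz, hmem z (hBΨ z hz) (Or.inr (Or.inr hz))⟩
  have hp : HasPair (splitRoots W X Ψ) (S ∩ splitRoots W X Ψ) P := by
    refine ⟨x, hsing x hx (hmem x hx.1.1 (Or.inl rfl)), y,
      hsing y hy (hmem y hy.1.1 (Or.inr (Or.inl rfl))), ?_, ?_⟩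
    · rw [hxy]
      exact sum_nil_ne_zero hΦ hc hB hB0
    · rw [hxy]
      exact multiset_sum_mem_closure hBn
  obtain ⟨-, v, hv, w, hw, e, hvw⟩ := hmin _ hΨ' (fun z hz => hz.1) hp had
  have hdX : d ∉ X := fun h => h.elim hda hdb
  rcases hW.eq_or_eq_of_add_eq ha hd hv hw (hW.ne_neg_of_mem (hΨ.closed.1 had)) e with
    ⟨rfl, rfl⟩ | ⟨rfl, rfl⟩
  · exact hdX (hvw.1 haX)
  · exact hdX (hvw.2 haX)

-- Unlike in type D, `b + x` is a root even for `x = b`, so `P` cannot move any end of a singular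
-- root.
omit hW hΦ in
theorem symplectic_sing_end {a b x : M} (hb : b ∈ W) (hx : x ∈ W)
    (h1 : a + b ∈ singSet Ψ (S ∩ Ψ) P) (h2 : -a + x ∈ P) : False := by
  have hk := hc.pos_subset h2
  have e : a + b + (-a + x) = b + x := by abel
  have := h1.2 _ h2
  rw [e] at this
  refine this ?_
  rw [← e]
  refine hΨ.closed.2 _ h1.1.1 _ (hΨ.levi_subset hk) ?_
  rw [e]
  refine ⟨b, hb, x, hx, ?_, rfl⟩
  rintro rfl
  refine h1.1.2 ⟨?_, h1.1.1⟩
  have := hk.2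
  rwa [show -(-a + -b) = a + b by abel] at this

/-- The relation `2q + (u + w) = (q + u) + (q + w)` involves three classes of vertices, while a pair
on only two of them survives a splitting. If `2u` is outside `S`, then `2q + 2u = 2(q + u)` is such
a pair, and likewise for `w`. Otherwise `2u` and `2w` are in the nilradical and `2(u + w) = 2u + 2w`
is one. -/
theorem symplectic_not_bad (hmin : ∀ Ψ', IsLeviExtension (symplecticEdges W) S Ψ' → Ψ' ⊆ Ψ →
      HasPair Ψ' (S ∩ Ψ') P → Ψ ⊆ Ψ') {q u w : M} (hq : q ∈ W) (hu : u ∈ W) (hw : w ∈ W)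
    (hqq : q + q ∈ singSet Ψ (S ∩ Ψ) P) (huw : u + w ∈ singSet Ψ (S ∩ Ψ) P)
    (hqu : q + u ∈ nilSet S) (hqw : q + w ∈ nilSet S) (hquΨ : q + u ∈ Ψ) (hqwΨ : q + w ∈ Ψ)
    (huq' : u ≠ q ∧ u ≠ -q) (hwq' : w ≠ q ∧ w ≠ -q) (hwu : w ≠ u ∧ w ≠ -u) : False := by
  have hneg := hΦ.neg_mem
  have hqqn : q + q ∉ nilSet S := fun h => hqq.1.2 ⟨h.1, hqq.1.1⟩
  have huwS : u + w ∉ S := fun h => huw.1.2 ⟨h, huw.1.1⟩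
  have hqqΦ := hΨ.closed.1 hqq.1.1
  have huwΦ := hΨ.closed.1 huw.1.1
  have hdbl : ∀ u ∈ W, u + u ∈ symplecticEdges W := fun u hu =>
    ⟨u, hu, u, hu, hW.ne_neg hu, rfl⟩
  have hsub : ∀ u w, u ∈ W → w ∈ W → w ≠ u → u + -w ∈ symplecticEdges W := fun u w hu hw h =>
    ⟨u, hu, -w, hW.neg_mem w hw, fun h' => h (neg_injective h'), rfl⟩
  -- If `2u` were in the Levi part, `q - u` and then `2q = (q - u) + (q + u)` would be in the
  -- nilradical.
  have hnl : ∀ u ∈ W, q + u ∈ nilSet S → u ≠ q → u + u ∉ leviSet S := by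
    intro u hu hqu huq hk
    have h1 := nil_add_mem hneg hc.closed hqu hk.2
    rw [show q + u + -(u + u) = q + -u by abel] at h1
    have h2 := nil_add_mem hneg hc.closed (h1 (hsub q u hq hu huq)) hqu.1
    rw [show q + -u + (q + u) = q + q by abel] at h2
    exact hqqn (h2 hqqΦ)
  have hdΨ : ∀ u w, u ∈ W → w ∈ W → w ≠ u → q + u ∈ Ψ → q + w ∈ Ψ → u + w ∈ Ψ → u + u ∈ Ψ := by
    intro u w hu hw hwu h1 h2 h3
    have h4 := hΨ.closed.2 _ h1 _ (hΨ.neg_mem _ h2)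
    rw [show q + u + -(q + w) = u + -w by abel] at h4
    have h5 := hΨ.closed.2 _ (h4 (hsub u w hu hw hwu)) _ h3
    rw [show u + -w + (u + w) = u + u by abel] at h5
    exact h5 (hdbl u hu)
  have hlinkq : ∀ u w, w ∈ W → u ∈ W → q + u ∈ nilSet S → q + w ∈ nilSet S → (w ≠ q ∧ w ≠ -q) →
      u + w ∈ symplecticEdges W → u + w ∉ S → w ∉ linkedTo S q := by
    rintro u w hw hu hqu hqw hwq hΦuw hS (h | h | h | h)
    · exact hwq.1 h
    · exact hwq.2 h
    · rw [add_comm] at h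
      exact notMem_leviSet_of_mem_nilSet hqw h
    · have := nil_add_mem hneg hc.closed hqu h.1
      rw [show q + u + (w + -q) = u + w by abel] at this
      exact hS (this hΦuw).1
  have hlinku : ∀ u w, u ∈ W → w ∈ W → u + w ∈ singSet Ψ (S ∩ Ψ) P → u + w ∉ S →
      (w ≠ u ∧ w ≠ -u) → w ∉ linkedTo S u := by
    rintro u w hu hw huw hS hwu (h | h | h | h)
    · exact hwu.1 h
    · exact hwu.2 h
    · rw [add_comm] at h
      exact hS h.1
    · rcases hc.pos_or_neg _ h with h | h
      · exact symplectic_sing_end hc hΨ hw hw huw (by rwa [add_comm])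
      · rw [neg_add, neg_neg] at h
        exact symplectic_sing_end hc hΨ hu hu (by rwa [add_comm]) h
  -- if twice an end of `u + w` is not in `S`
  have hcase : ∀ u w, u ∈ W → w ∈ W → u + w ∈ singSet Ψ (S ∩ Ψ) P → q + u ∈ nilSet S →
      q + w ∈ nilSet S → q + u ∈ Ψ → q + w ∈ Ψ → (u ≠ q ∧ u ≠ -q) → (w ≠ q ∧ w ≠ -q) →
      (w ≠ u ∧ w ≠ -u) → u + w ∉ S → u + w ∈ symplecticEdges W → u + u ∈ S := by
    intro u w hu hw huw hqu hqw hquΨ hqwΨ huq hwq hwu hS hΦuw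
    by_contra huS
    have hsing : u + u ∈ singSet Ψ (S ∩ Ψ) P := by
      refine ⟨⟨hdΨ u w hu hw hwu.1 hquΨ hqwΨ huw.1.1, fun h => huS h.1⟩, fun δ hδ hδ' => ?_⟩
      obtain ⟨y, hy, z, hz, hyz, rfl⟩ := hc.pos_closed.1 hδ
      have := hW.exists_cancel hu hu hy hz (hW.ne_neg hu) hyz (hΨ.closed.1 hδ')
      rcases this with rfl | rfl | rfl | rfl
      · exact symplectic_sing_end hc hΨ hw hz huw hδ
      · exact symplectic_sing_end hc hΨ hw hz huw hδ
      · exact symplectic_sing_end hc hΨ hw hy huw (by rwa [add_comm])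
      · exact symplectic_sing_end hc hΨ hw hy huw (by rwa [add_comm])
    refine not_of_minimal hW hΦ hc hΨ hmin hq hu hw hqwΨ
      (hlinkq u w hw hu hqu hqw hwq hΦuw hS) (hlinku u w hu hw huw hS hwu) hqq hsing
      (B := {q + u, q + u}) ?_ ?_ (by simp) ?_ ?_
    · intro z hz
      have : z = q + u := by simpa using hz
      rwa [this]
    · simp only [Multiset.insert_eq_cons, Multiset.sum_cons, Multiset.sum_singleton]
      abel
    · rintro z (rfl | rfl | hz)
      · exact ⟨q, q, Or.inl rfl, Or.inl rfl, rfl⟩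
      · exact ⟨u, u, Or.inr rfl, Or.inr rfl, rfl⟩
      · have : z = q + u := by simpa using hz
        exact ⟨q, u, Or.inl rfl, Or.inr rfl, this⟩
    · intro z hz
      have : z = q + u := by simpa using hz
      rwa [this]
  have hwu' : u ≠ w ∧ u ≠ -w := ⟨hwu.1.symm, fun h => hwu.2 (by rw [h, neg_neg])⟩
  have huw' : w + u ∈ singSet Ψ (S ∩ Ψ) P := by rwa [add_comm]
  have hwuS : w + u ∉ S := by rwa [add_comm]
  have hwuΦ : w + u ∈ symplecticEdges W := by rwa [add_comm]
  have hu2 := (mem_levi_or_nil (hcase u w hu hw huw hqu hqw hquΨ hqwΨ huq' hwq' hwu huwS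
    huwΦ)).resolve_left (hnl u hu hqu huq'.1)
  have hw2 := (mem_levi_or_nil (hcase w u hw hu huw' hqw hqu hqwΨ hquΨ hwq' huq' hwu' hwuS
    hwuΦ)).resolve_left (hnl w hw hqw hwq'.1)
  have hlink : ∀ u w, u ∈ W → w ∈ W → q + u ∈ nilSet S → q + w ∈ nilSet S → (u ≠ q ∧ u ≠ -q) →
      u + w ∈ symplecticEdges W → u + w ∉ S → q ∉ linkedTo S u := by
    intro u w hu hw hqu hqw huq hΦuw hS hl
    refine hlinkq w u hu hw hqw hqu huq (by rwa [add_comm]) (by rwa [add_comm]) ?_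
    rcases hl with h | h | h | h
    · exact absurd h.symm huq.1
    · exact absurd (by rw [h, neg_neg]) huq.2
    · exact Or.inr (Or.inr (Or.inl (by rwa [add_comm])))
    · refine Or.inr (Or.inr (Or.inr ?_))
      have := mem_leviSet_neg h
      rwa [neg_add_rev, neg_neg] at this
  -- The pair consists of `u + w` taken twice; the vertex `q` is linked to neither `u` nor `w`.
  refine not_of_minimal hW hΦ hc hΨ hmin hu hw hq (by rwa [add_comm])
    (hlink u w hu hw hqu hqw huq' huwΦ huwS) (hlink w u hw hu hqw hqu hwq' hwuΦ hwuS) huw huw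
    (B := {u + u, w + w}) ?_ ?_ (by simp) ?_ ?_
  · intro z hz
    have : z = u + u ∨ z = w + w := by simpa using hz
    rcases this with rfl | rfl <;> assumption
  · simp only [Multiset.insert_eq_cons, Multiset.sum_cons, Multiset.sum_singleton]
    abel
  · rintro z (rfl | rfl | hz)
    · exact ⟨u, w, Or.inl rfl, Or.inr rfl, rfl⟩
    · exact ⟨u, w, Or.inl rfl, Or.inr rfl, rfl⟩
    · have : z = u + u ∨ z = w + w := by simpa using hz
      rcases this with rfl | rfl
      · exact ⟨u, u, Or.inl rfl, Or.inl rfl, rfl⟩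
      · exact ⟨w, w, Or.inr rfl, Or.inr rfl, rfl⟩
  · intro z hz
    have : z = u + u ∨ z = w + w := by simpa using hz
    rcases this with rfl | rfl
    · exact hdΨ u w hu hw hwu.1 hquΨ hqwΨ huw.1.1
    · exact hdΨ w u hw hu hwu'.1 hqwΨ hquΨ huw'.1.1

end

end RootCone

/-! ### Type C: a smallest subsystem that carries a pair. -/

namespace RootCone

variable {M : Type*} [AddCommGroup M]

theorem exists_common_end {W : Set M} {c : M → M →+ ℝ} (hW : IsSignedBasis W c) {x y : M}
    (hx : x ∈ symplecticEdges W) (hy : y ∈ symplecticEdges W) (h : x - y ∈ symplecticEdges W) :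
    ∃ q ∈ W, ∃ u ∈ W, ∃ r ∈ W, x = q + u ∧ y = q + r := by
  obtain ⟨v, hv, w, hw, hvw, rfl⟩ := hx
  obtain ⟨v', hv', w', hw', hvw', rfl⟩ := hy
  rw [show v + w - (v' + w') = v + w + (-v' + -w') by abel] at h
  have h1 := hW.exists_cancel hv hw (hW.neg_mem _ hv') (hW.neg_mem _ hw') hvw
    (fun h => hvw' (neg_injective h)) h
  simp only [neg_inj] at h1
  rcases h1 with rfl | rfl | rfl | rfl
  · exact ⟨v', hv', w, hw, w', hw', rfl, rfl⟩
  · exact ⟨v', hv', v, hv, w', hw', add_comm _ _, rfl⟩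
  · exact ⟨w', hw', w, hw, v', hv', rfl, add_comm _ _⟩
  · exact ⟨w', hw', v, hv, v', hv', add_comm _ _, add_comm _ _⟩

/-- Two singular roots whose sum involves `q + u` and `q + r` have the form `q + q`, `u + r`. -/
theorem eq_of_apply_pos {W : Set M} {c : M → M →+ ℝ} (hW : IsSignedBasis W c) {q u r a b : M}
    (hq : q ∈ W) (hu : u ∈ W) (hr : r ∈ W) (ha : a ∈ symplecticEdges W)
    (hb : b ∈ symplecticEdges W) (huq : u ≠ q) (hrq : r ≠ -q) (hru : r ≠ u)
    (hua : a ≠ q + u ∧ a ≠ q + r) (hub : b ≠ q + u ∧ b ≠ q + r)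
    (h1 : 2 ≤ c q (a + b)) (h2 : 0 < c u (a + b)) (h3 : 0 < c r (a + b)) :
    r ≠ q ∧ ((a = q + q ∧ b = u + r) ∨ (a = u + r ∧ b = q + q)) := by
  have key : ∀ a b, a ∈ symplecticEdges W → b ∈ symplecticEdges W → (a ≠ q + u ∧ a ≠ q + r) →
      (b ≠ q + u ∧ b ≠ q + r) → 2 ≤ c q (a + b) → 0 < c u a → 0 < c r (a + b) →
      r ≠ q ∧ a = u + r ∧ b = q + q := by
    intro a b ha hb hua hub h1 h2 h3
    have : ∃ s ∈ W, a = u + s := by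
      obtain ⟨v, hv, w, hw, -, rfl⟩ := ha
      rcases hW.mem_of_apply_add_pos hu hv hw h2 with rfl | rfl
      exacts [⟨w, hw, rfl⟩, ⟨v, hv, add_comm _ _⟩]
    obtain ⟨s, hs, rfl⟩ := this
    obtain ⟨v, hv, w, hw, -, rfl⟩ := hb
    have hsq : s ≠ q := by
      rintro rfl; exact hua.1 (add_comm _ _)
    have e1 := hW.apply_nonpos hq hu huq
    have e2 := hW.apply_nonpos hq hs hsq
    have e3 := hW.apply_le_one hq hv
    have e4 := hW.apply_le_one hq hw
    simp only [map_add] at h1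
    obtain rfl : v = q := hW.eq_of_apply_pos hq hv (by linarith)
    obtain rfl : w = v := hW.eq_of_apply_pos hq hw (by linarith)
    have hrw : r ≠ w := by
      rintro rfl; exact hub.2 rfl
    refine ⟨hrw, ?_, rfl⟩
    have e5 := hW.apply_of_ne r hr w hq hrw.symm (fun h => hrq (by rw [h, neg_neg]))
    have e6 := hW.apply_nonpos hr hu (Ne.symm hru)
    simp only [map_add, e5] at h3
    rw [hW.eq_of_apply_pos hr hs (by linarith)]
  by_cases hau : 0 < c u a
  · obtain ⟨k1, k2, k3⟩ := key a b ha hb hua hub h1 hau h3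
    exact ⟨k1, Or.inr ⟨k2, k3⟩⟩
  · have hbu : 0 < c u b := by
      rw [map_add] at h2
      linarith
    obtain ⟨k1, k2, k3⟩ := key b a hb ha hub hua (by rwa [add_comm]) hbu (by rwa [add_comm])
    exact ⟨k1, Or.inl ⟨k3, k2⟩⟩

/-- In a root system of type `C`, a pair of singular roots with sum in the cone of the nilradical
gives a symmetric closed set of roots `Ψ` for which there is such a pair that normalizes the
nilradical and whose sum is a sum of equal or strongly orthogonal roots. -/
theorem exists_symplectic {W : Set M} {c : M → M →+ ℝ} {S P : Set M} {p : M → M →+ ℝ}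
    (hW : IsSignedBasis W c) (hΦ : IsRootSet (symplecticEdges W) p)
    (hc : IsConfig (symplecticEdges W) S P) (hp : HasPair (symplecticEdges W) S P) :
    ∃ Ψ, IsLeviExtension (symplecticEdges W) S Ψ ∧
      ∃ a ∈ singSet Ψ (S ∩ Ψ) P, ∃ b ∈ singSet Ψ (S ∩ Ψ) P,
        a + b ≠ 0 ∧
        (∀ z, z = a ∨ z = b → ∀ x ∈ nilSet (S ∩ Ψ),
          z + x ≠ 0 ∧ (z + x ∈ Ψ → z + x ∈ nilSet (S ∩ Ψ))) ∧
        ∃ B : Multiset M, (∀ x ∈ B, x ∈ nilSet (S ∩ Ψ)) ∧ B.sum = a + b ∧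
          ∀ x ∈ B, ∀ y ∈ B, x ≠ y → x + y ∉ Ψ ∧ x + y ≠ 0 ∧ x - y ∉ Ψ := by
  -- The full root system belongs to `F`, and a minimal member is the set of roots sought.
  let F : Set (Set M) := {Ψ | IsLeviExtension (symplecticEdges W) S Ψ ∧ HasPair Ψ (S ∩ Ψ) P}
  have hF : F.Finite := hΦ.finite.finite_subsets.subset fun Ψ hΨ => hΨ.1.closed.1
  have hne : F.Nonempty := by
    refine ⟨symplecticEdges W, ⟨⟨fun _ h => h, fun _ _ _ _ h => h⟩, hΦ.neg_mem,
      fun x hx => hc.closed.1 hx.1⟩, ?_⟩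
    rwa [Set.inter_eq_left.2 hc.closed.1]
  obtain ⟨Ψ, ⟨hΨ, hpΨ⟩, hminF⟩ := hF.exists_minimal hne
  have hmin : ∀ Ψ', IsLeviExtension (symplecticEdges W) S Ψ' → Ψ' ⊆ Ψ →
      HasPair Ψ' (S ∩ Ψ') P → Ψ ⊆ Ψ' := fun Ψ' h1 h2 h3 => hminF ⟨h1, h3⟩ h2
  have hΦΨ := hΨ.rootSet hΦ
  have hcΨ := hΨ.config hc
  obtain ⟨a, ha, b, hb, hab0, habm, hnorm⟩ := exists_normalizing_pair hΦΨ hcΨ hpΨ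
  refine ⟨Ψ, hΨ, a, ha, b, hb, hab0, hnorm, ?_⟩
  obtain ⟨B, hB, hs, hBmin⟩ := exists_card_le habm
  have hadd := fun {x y : M} => nil_add_of_card_le hΦΨ hcΨ (x := x) (y := y) hB
    (fun B' hB' h => hBmin B' hB' (h.trans hs))
  refine ⟨B, hB, hs, fun x hx y hy hxy => ?_⟩
  obtain ⟨f1, f2⟩ := hadd hx hy hxy
  refine ⟨f1, f2, fun hsub => ?_⟩
  have hBΨ : ∀ z ∈ B, z ∈ Ψ := fun z hz => (hB z hz).1.2
  have hBΦ : ∀ z ∈ B, z ∈ symplecticEdges W := fun z hz => hΨ.closed.1 (hBΨ z hz)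
  -- no vertex of an element of `B` is cancelled in `B`
  have hnn : ∀ v ∈ W, ∀ w ∈ W, v + w ∈ B → ∀ z ∈ B, 0 ≤ c v z := by
    intro v hv w hw hvw z hz
    by_contra! hneg
    have hvw' := hW.ne_neg_of_mem (hBΦ _ hvw)
    have : ∃ s ∈ W, z = -v + s := by
      obtain ⟨g, hg, k, hk, -, rfl⟩ := hBΦ z hz
      by_cases h1 : c v g < 0
      · rw [hW.eq_of_apply_neg hv hg h1]; exact ⟨k, hk, rfl⟩
      · rw [map_add] at hneg
        rw [hW.eq_of_apply_neg hv hk (by linarith), add_comm]; exact ⟨g, hg, rfl⟩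
    obtain ⟨s, hs', rfl⟩ := this
    have hne : v + w ≠ -v + s := by
      intro h
      have := hW.one_le_apply_add hv hw hvw'
      rw [h] at this
      linarith
    obtain ⟨g1, g2⟩ := hadd hvw hz hne
    have e : v + w + (-v + s) = w + s := by abel
    have hΨe := hΨ.closed.2 _ (hBΨ _ hvw) _ (hBΨ _ hz)
    rw [e] at g1 g2 hΨe
    exact g1 (hΨe ⟨w, hw, s, hs', fun h => g2 (by rw [h, add_neg_cancel]), rfl⟩)
  -- Since nothing cancels at `v`, the remaining summands contribute nonnegatively. For `x = q + u`
  -- and `y = q + r` this bounds the coordinates of `a + b` at `q`, `u` and `r` from below, which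
  -- leaves only the pair `2q`, `u + r`.
  have hle : ∀ v ∈ W, ∀ w ∈ W, v + w ∈ B → c v x + c v y ≤ c v (a + b) := by
    intro v hv w hw hvw
    have hn := hnn v hv w hw hvw
    obtain ⟨t, rfl⟩ := Multiset.exists_cons_of_mem hx
    obtain ⟨t', rfl⟩ := Multiset.exists_cons_of_mem
      ((Multiset.mem_cons.1 hy).resolve_left hxy.symm)
    have h0 : 0 ≤ c v t'.sum := by
      rw [map_multiset_sum]
      apply Multiset.sum_nonneg
      intro r hr
      obtain ⟨z, hz, rfl⟩ := Multiset.mem_map.1 hr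
      exact hn z (by simp [hz])
    rw [← hs]
    simp only [Multiset.sum_cons, map_add]
    linarith
  obtain ⟨q, hq, u, hu, r, hr, rfl, rfl⟩ :=
    exists_common_end hW (hBΦ x hx) (hBΦ y hy) (hΨ.closed.1 hsub)
  have huq := hW.ne_neg_of_mem (hBΦ _ hx)
  have hrq := hW.ne_neg_of_mem (hBΦ _ hy)
  have hur : r ≠ u := by rintro rfl; exact hxy rfl
  have haB : ∀ z ∈ B, a ≠ z := fun z hz h => notMem_nilSet_of_mem_singSet ha (h ▸ hB z hz)
  have hbB : ∀ z ∈ B, b ≠ z := fun z hz h => notMem_nilSet_of_mem_singSet hb (h ▸ hB z hz)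
  have hq2 : 2 ≤ c q (a + b) := by
    linarith [hle q hq u hu hx, hW.one_le_apply_add hq hu huq, hW.one_le_apply_add hq hr hrq]
  have hsw : ∀ {a b : M}, b ≠ -a → a ≠ -b := fun h h' => h (by rw [h', neg_neg])
  have hone : ∀ u ∈ W, q + u ∈ B → u ≠ -q → 0 < c u (q + u) := by
    intro u hu hqu h
    rw [add_comm]
    linarith [hW.one_le_apply_add hu hq (hsw h)]
  have hpos : 0 < c u (a + b) := by
    linarith [hle u hu q hq (by rwa [add_comm]), hone u hu hx huq,
      hnn u hu q hq (by rwa [add_comm]) _ hy]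
  have hpos' : 0 < c r (a + b) := by
    linarith [hle r hr q hq (by rwa [add_comm]), hone r hr hy hrq,
      hnn r hr q hq (by rwa [add_comm]) _ hx]
  have hbad : ∀ u r, u ∈ W → r ∈ W → u ≠ q → u ≠ -q → r ≠ -q → r ≠ u → q + u ∈ B → q + r ∈ B →
      0 < c u (a + b) → 0 < c r (a + b) → False := by
    intro u r hu hr huq huq' hrq hru hqu hqr h1 h2
    obtain ⟨hrq', h3⟩ := eq_of_apply_pos hW hq hu hr (hΨ.closed.1 ha.1.1) (hΨ.closed.1 hb.1.1)
      huq hrq hru ⟨haB _ hqu, haB _ hqr⟩ ⟨hbB _ hqu, hbB _ hqr⟩ hq2 h1 h2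
    have hn := fun z hz => (hΨ.nilSet_eq ▸ hB z hz : z ∈ nilSet S ∩ Ψ)
    have hfin : ∀ a b, a = q + q → b = u + r → a ∈ singSet Ψ (S ∩ Ψ) P →
        b ∈ singSet Ψ (S ∩ Ψ) P → False := by
      rintro a b rfl rfl ha hb
      exact symplectic_not_bad hW hΦ hc hΨ hmin hq hu hr ha hb (hn _ hqu).1 (hn _ hqr).1
        (hBΨ _ hqu) (hBΨ _ hqr) ⟨huq, huq'⟩ ⟨hrq', hrq⟩
        ⟨hru, hW.ne_neg_of_mem (hΨ.closed.1 hb.1.1)⟩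
    rcases h3 with ⟨e1, e2⟩ | ⟨e1, e2⟩
    · exact hfin a b e1 e2 ha hb
    · exact hfin b a e2 e1 hb ha
  -- At most one of `u`, `r` equals `q`; the roles are exchanged so that the first vertex differs
  -- from `q`.
  by_cases h : u = q
  · exact hbad r u hr hu (by rw [← h]; exact hur) hrq huq (Ne.symm hur) hy hx hpos' hpos
  · exact hbad u r hu hr h huq hrq hur hx hy hpos hpos'

end RootCone

/-! ### The roots of a Killing Lie algebra as an abstract root set. -/

namespace RootSubalgebra

open LieAlgebra LieAlgebra.IsKilling LieModule

section Roots

variable {L : Type*} [LieRing L] [LieAlgebra ℂ L] {H : LieSubalgebra ℂ L} [LieRing.IsNilpotent H]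
  {s t : LieSubalgebra ℂ L} {α : Module.Dual ℂ H}

theorem mem_roots_top : α ∈ roots H ⊤ ↔ α ≠ 0 ∧ rootSpace H α ≠ ⊥ := by
  simp [roots]

theorem mem_roots : α ∈ roots H s ↔
    α ∈ roots H ⊤ ∧ (rootSpace H α).toSubmodule ≤ s.toSubmodule := by
  simp [roots, and_assoc]

theorem roots_subset_top : roots H s ⊆ roots H ⊤ := fun _ h => (mem_roots.1 h).1

theorem roots_inf : roots H (s ⊓ t) = roots H s ∩ roots H t := by
  ext α
  simp only [Set.mem_inter_iff, mem_roots (s := s ⊓ t), mem_roots (s := s), mem_roots (s := t),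
    LieSubalgebra.inf_toSubmodule, le_inf_iff]
  tauto

theorem nilRoots_eq : nilRoots H s = RootCone.nilSet (roots H s) := by
  ext α
  simp [nilRoots, RootCone.nilSet, leviRoots]

theorem sing_eq (b : LieSubalgebra ℂ L) :
    sing H t b s =
      RootCone.singSet (roots H t) (roots H s) (roots H b ∩ RootCone.leviSet (roots H s)) := rfl

end Roots

variable {L : Type*} [LieRing L] [LieAlgebra ℂ L] [FiniteDimensional ℂ L] [IsKilling ℂ L]
  {H : LieSubalgebra ℂ L} [H.IsCartanSubalgebra] {α β : Module.Dual ℂ H}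

open Classical in
/-- Evaluation of a weight at the coroot of a root `α`, as a real number; zero if `α` is not a
root. -/
noncomputable def corootPairing (α : Module.Dual ℂ H) : Module.Dual ℂ H →+ ℝ :=
  if h : rootSpace H α ≠ ⊥ then
    { toFun := fun β => (β (coroot ⟨α, h⟩)).re
      map_zero' := by simp
      map_add' := by simp }
  else 0

/-- The root string of `β` in direction `α`; every needed fact about sums and differences of roots
is read off from its two ends. -/
theorem exists_chain (hα : α ∈ roots H ⊤) (hβ : β ∈ roots H ⊤) :
    ∃ p q : ℕ, corootPairing α β = p - q ∧
      ∀ n : ℤ, rootSpace H (n • α + β : Module.Dual ℂ H) ≠ ⊥ ↔ n ≤ q ∧ -n ≤ p := by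
  rw [mem_roots_top] at hα hβ
  let a : Weight ℂ H L := ⟨α, hα.2⟩
  let b : Weight ℂ H L := ⟨β, hβ.2⟩
  have ha : a.IsNonZero := fun h => hα.1 (DFunLike.coe_injective h)
  refine ⟨chainBotCoeff a b, chainTopCoeff a b, ?_, fun n => ?_⟩
  · rw [corootPairing, dif_pos hα.2]
    change ((b : H → ℂ) (coroot a)).re = _
    rw [apply_coroot_eq_cast a b]
    simp
  · rw [← rootSpace_zsmul_add_ne_bot_iff a b ha n]
    rfl

theorem corootPairing_self (hα : α ∈ roots H ⊤) : corootPairing α α = 2 := by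
  rw [mem_roots_top] at hα
  rw [corootPairing, dif_pos hα.2]
  let a : Weight ℂ H L := ⟨α, hα.2⟩
  have ha : a.IsNonZero := fun h => hα.1 (DFunLike.coe_injective h)
  change ((a : H → ℂ) (coroot a)).re = _
  rw [root_apply_coroot ha]
  rfl

theorem exists_root (hα : α ∈ roots H ⊤) :
    ∃ i : H.root, (rootSystem H).root i = α := by
  rw [mem_roots_top] at hα
  let a : Weight ℂ H L := ⟨α, hα.2⟩
  have ha : a.IsNonZero := fun h => hα.1 (DFunLike.coe_injective h)
  exact ⟨⟨a, by simpa using ha⟩, rfl⟩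

theorem corootPairing_root (i j : H.root) :
    corootPairing ((rootSystem H).root i) ((rootSystem H).root j) =
      (rootSystem H).pairingIn ℤ j i := by
  have h : rootSpace H ((rootSystem H).root i) ≠ ⊥ := i.1.2
  rw [corootPairing, dif_pos h]
  have := (rootSystem H).algebraMap_pairingIn ℤ j i
  rw [rootSystem_pairing_apply] at this
  change (j.1 (coroot i.1)).re = _
  rw [← this]
  simp

theorem neg_mem_roots (hα : α ∈ roots H ⊤) : -α ∈ roots H ⊤ := by
  rw [mem_roots_top] at hα ⊢
  let a : Weight ℂ H L := ⟨α, hα.2⟩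
  have h := (-a).genWeightSpace_ne_bot
  rw [Weight.coe_neg] at h
  exact ⟨by simpa using hα.1, h⟩

theorem finite_roots : (roots H ⊤).Finite := by
  refine (Set.finite_range ((rootSystem H).root)).subset fun α hα => ?_
  obtain ⟨i, rfl⟩ := exists_root hα
  exact ⟨i, rfl⟩

theorem add_mem_roots (hα : α ∈ roots H ⊤) (hβ : β ∈ roots H ⊤) (h : corootPairing α β < 0) :
    α + β ∈ roots H ⊤ ∨ α + β = 0 := by
  obtain ⟨p, q, h1, h2⟩ := exists_chain hα hβ
  have : (1 : ℤ) ≤ q := by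
    have : (p : ℝ) < q := by linarith
    have : p < q := by exact_mod_cast this
    omega
  have h3 := (h2 1).2 ⟨this, by omega⟩
  rw [one_smul] at h3
  by_cases h0 : α + β = 0
  · exact .inr h0
  · exact .inl (mem_roots_top.2 ⟨h0, h3⟩)

theorem isRootSet_roots : RootCone.IsRootSet (roots H ⊤) corootPairing where
  finite := finite_roots
  neg_mem _ := neg_mem_roots
  self_pos x hx := by
    rw [corootPairing_self hx]
    norm_num
  pos_symm x hx y hy h := by
    obtain ⟨i, rfl⟩ := exists_root hx
    obtain ⟨j, rfl⟩ := exists_root hy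
    rw [corootPairing_root] at h ⊢
    rw [Int.cast_pos] at h ⊢
    exact ((rootSystem H).zero_lt_pairingIn_iff' ℤ).1 h
  neg_symm x hx y hy h := by
    obtain ⟨i, rfl⟩ := exists_root hx
    obtain ⟨j, rfl⟩ := exists_root hy
    rw [corootPairing_root] at h ⊢
    rw [Int.cast_lt_zero] at h ⊢
    exact ((rootSystem H).pairingIn_lt_zero_iff ℤ).1 h
  add_mem x hx y hy h := add_mem_roots hx hy h

theorem one_le_corootPairing (hα : α ∈ roots H ⊤) (hβ : β ∈ roots H ⊤) (h1 : α - β ∈ roots H ⊤)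
    (h2 : α + β ∉ roots H ⊤) (h3 : α + β ≠ 0) : 1 ≤ corootPairing α β := by
  obtain ⟨p, q, h4, h5⟩ := exists_chain hα hβ
  have h6 := (h5 (-1)).1 (by
    have := (mem_roots_top.1 (neg_mem_roots h1)).2
    rwa [neg_sub, sub_eq_neg_add, ← neg_one_zsmul] at this)
  have h7 : ¬ (1 : ℤ) ≤ q := fun h => h2 (mem_roots_top.2 ⟨h3, by
    have := (h5 1).2 ⟨h, by omega⟩
    rwa [one_smul] at this⟩)
  have h8 : (1 : ℤ) ≤ p - q := by omega
  rw [h4]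
  exact_mod_cast h8

/-- A pairing above 1 makes the string reach at least two steps down. This allows long roots to be
recognized without computing coroots. -/
theorem sub_two_smul_mem_roots (hα : α ∈ roots H ⊤) (hβ : β ∈ roots H ⊤)
    (h : 1 < corootPairing α β) : β - 2 • α ∈ roots H ⊤ := by
  obtain ⟨p, q, h1, h2⟩ := exists_chain hα hβ
  have h3 : (2 : ℤ) ≤ p := by
    rw [h1] at h
    have : (q : ℝ) + 1 < p := by linarith
    have : q + 1 < p := by exact_mod_cast this
    omega
  have h4 := (h2 (-2)).2 ⟨by omega, by omega⟩
  refine mem_roots_top.2 ⟨fun h0 => ?_, ?_⟩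
  · rw [sub_eq_zero] at h0
    rw [mem_roots_top] at hα hβ
    apply hβ.2
    have ha : (⟨α, hα.2⟩ : Weight ℂ H L).IsNonZero := fun h => hα.1 (DFunLike.coe_injective h)
    have := rootSpace_two_smul _ ha
    rw [h0]
    exact this
  · convert! h4 using 2
    ext
    simp
    ring

end RootSubalgebra

/-! ### Sums of root spaces and the closed set of roots of a subalgebra. -/

namespace RootSubalgebra

open LieAlgebra LieAlgebra.IsKilling LieModule

variable {L : Type*} [LieRing L] [LieAlgebra ℂ L] [FiniteDimensional ℂ L] [IsKilling ℂ L]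
  {H : LieSubalgebra ℂ L} [H.IsCartanSubalgebra] {α β : Module.Dual ℂ H}
  {s : LieSubalgebra ℂ L}

theorem rootSpace_le_of_mem (hα : α ∈ roots H ⊤) {x : L} (hx : x ∈ rootSpace H α) (h0 : x ≠ 0)
    {p : Submodule ℂ L} (hp : x ∈ p) : (rootSpace H α).toSubmodule ≤ p := by
  rw [mem_roots_top] at hα
  let a : Weight ℂ H L := ⟨α, hα.2⟩
  have ha : a.IsNonZero := fun h => hα.1 (DFunLike.coe_injective h)
  have hx' : x ∈ rootSpace H a := hx
  intro y hy
  have hy' : y ∈ rootSpace H a := hy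
  obtain ⟨c, rfl⟩ : ∃ c : ℂ, c • x = y := by
    simpa using (finrank_eq_one_iff_of_nonzero' ⟨x, hx'⟩ (by simpa using h0)).1
      (finrank_rootSpace_eq_one a ha) ⟨y, hy'⟩
  exact p.smul_mem c hp

/-- The bracket of the two root spaces is nonzero by the representation theory of the `sl₂` attached
to `α`. This gives closedness of the roots of any subalgebra, because root spaces are
one-dimensional. -/
theorem exists_lie_ne_zero (hα : α ∈ roots H ⊤) (hβ : β ∈ roots H ⊤) (hab : α + β ∈ roots H ⊤) :
    ∃ x ∈ rootSpace H α, ∃ y ∈ rootSpace H β, ⁅x, y⁆ ≠ 0 := by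
  rw [mem_roots_top] at hα hβ hab
  let a : Weight ℂ H L := ⟨α, hα.2⟩
  let b : Weight ℂ H L := ⟨β, hβ.2⟩
  have ha : a.IsNonZero := fun h => hα.1 (DFunLike.coe_injective h)
  obtain ⟨h, e, f, isSl2, he, hf⟩ := exists_isSl2Triple_of_weight_isNonZero ha
  obtain rfl := isSl2.h_eq_coroot ha he hf
  obtain ⟨v, hv, hv0⟩ := (chainTop a b).exists_ne_zero
  have prim : isSl2.HasPrimitiveVectorWith v (chainLength a b : ℂ) :=
    have := lie_mem_genWeightSpace_of_mem_genWeightSpace he hv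
    ⟨hv0, (chainLength_smul _ _ hv).symm, by rwa [genWeightSpace_add_chainTop _ _ ha] at this⟩
  have hq : (1 : ℤ) ≤ chainTopCoeff a b :=
    ((rootSpace_zsmul_add_ne_bot_iff a b ha 1).1 (by rw [one_smul]; exact hab.2)).1
  obtain ⟨q, hq⟩ : ∃ q, chainTopCoeff a b = q + 1 := ⟨chainTopCoeff a b - 1, by omega⟩
  have hlen := chainTopCoeff_le_chainLength a b
  -- The vector `v` tops the string, `q + 1` steps above `β`. Raising `f ^ (q + 1) v` gives `f ^ q
  -- v` times `(q + 1)(N - q)` with `N` the string length, and `q < N`.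
  refine ⟨e, he, (toEnd ℂ L L f ^ (q + 1)) v, ?_, ?_⟩
  · have := toEnd_pow_apply_mem hf hv (q + 1)
    rw [coe_chainTop', hq, smul_neg, neg_add_cancel_left] at this
    exact this
  · rw [prim.lie_e_pow_succ_toEnd_f]
    refine smul_ne_zero (mul_ne_zero (by exact_mod_cast q.succ_ne_zero) ?_)
      (prim.pow_toEnd_f_ne_zero_of_eq_nat rfl (by omega))
    rw [sub_ne_zero]
    norm_cast
    omega

theorem isClosedIn_roots : RootCone.IsClosedIn (roots H ⊤) (roots H s) := by
  refine ⟨roots_subset_top, fun α hα β hβ hab => mem_roots.2 ⟨hab, ?_⟩⟩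
  obtain ⟨x, hx, y, hy, h⟩ := exists_lie_ne_zero (roots_subset_top hα) (roots_subset_top hβ) hab
  exact rootSpace_le_of_mem hab (lie_mem_genWeightSpace_of_mem_genWeightSpace hx hy) h
    (s.lie_mem (hα.2.2 hx) (hβ.2.2 hy))

variable (H) in
/-- The sum of the root spaces of the elements of `T`. -/
noncomputable def weightSum (T : Set (Module.Dual ℂ H)) : Submodule ℂ L :=
  ⨆ α ∈ T, (rootSpace H α).toSubmodule

variable {T T₁ T₂ T₃ : Set (Module.Dual ℂ H)}

omit [FiniteDimensional ℂ L] [IsKilling ℂ L] in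
theorem rootSpace_le_weightSum (hα : α ∈ T) : (rootSpace H α).toSubmodule ≤ weightSum H T :=
  le_iSup₂_of_le α hα le_rfl

omit [FiniteDimensional ℂ L] [IsKilling ℂ L] in
theorem weightSum_mono (h : T₁ ⊆ T₂) : weightSum H T₁ ≤ weightSum H T₂ :=
  iSup₂_le fun _ hα => rootSpace_le_weightSum (h hα)

omit [FiniteDimensional ℂ L] [IsKilling ℂ L] in
theorem weightSum_le {p : Submodule ℂ L} :
    weightSum H T ≤ p ↔ ∀ α ∈ T, (rootSpace H α).toSubmodule ≤ p := iSup₂_le_iff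

omit [FiniteDimensional ℂ L] [IsKilling ℂ L] in
theorem lie_mem_weightSum_of_forall (h : ∀ α ∈ T₁, ∀ β ∈ T₂, ∀ x ∈ rootSpace H α,
      ∀ y ∈ rootSpace H β, ⁅x, y⁆ ∈ weightSum H T₃)
    {x y : L} (hx : x ∈ weightSum H T₁) (hy : y ∈ weightSum H T₂) : ⁅x, y⁆ ∈ weightSum H T₃ := by
  have h1 : weightSum H T₁ ≤
      (Submodule.compatibleMaps (weightSum H T₂) (weightSum H T₃)).comap
        (toEnd ℂ L L : L →ₗ[ℂ] Module.End ℂ L) := by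
    refine weightSum_le.2 fun α hα x hx => ?_
    change weightSum H T₂ ≤ (weightSum H T₃).comap (toEnd ℂ L L x)
    exact weightSum_le.2 fun β hβ y hy => h α hα β hβ x hx y hy
  exact h1 hx hy

omit [FiniteDimensional ℂ L] [IsKilling ℂ L] in
theorem lie_mem_weightSum
    (h : ∀ α ∈ T₁, ∀ β ∈ T₂, rootSpace H (α + β : Module.Dual ℂ H) ≠ ⊥ → α + β ∈ T₃)
    {x y : L} (hx : x ∈ weightSum H T₁) (hy : y ∈ weightSum H T₂) : ⁅x, y⁆ ∈ weightSum H T₃ := by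
  refine lie_mem_weightSum_of_forall (fun α hα β hβ x hx y hy => ?_) hx hy
  have hxy : ⁅x, y⁆ ∈ rootSpace H (α + β : Module.Dual ℂ H) :=
    lie_mem_genWeightSpace_of_mem_genWeightSpace hx hy
  by_cases h0 : rootSpace H (α + β : Module.Dual ℂ H) = ⊥
  · rw [h0, LieSubmodule.mem_bot] at hxy
    rw [hxy]
    exact zero_mem _
  · exact rootSpace_le_weightSum (h α hα β hβ h0) hxy

omit [FiniteDimensional ℂ L] [IsKilling ℂ L] in
theorem mem_of_rootSpace_le_weightSum (h0 : rootSpace H α ≠ ⊥)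
    (h : (rootSpace H α).toSubmodule ≤ weightSum H T) : α ∈ T := by
  by_contra hα
  have h1 := (iSupIndep_genWeightSpace ℂ H L).comp
    (f := fun α : Module.Dual ℂ H => (α : H → ℂ)) DFunLike.coe_injective
  have h2 : Disjoint (rootSpace H α) (⨆ β ∈ T, rootSpace H β) :=
    h1.disjoint_biSup (y := T) hα
  apply h0
  rw [← disjoint_self]
  refine h2.mono_right ?_
  rw [← LieSubmodule.toSubmodule_le_toSubmodule]
  refine h.trans (weightSum_le.2 fun β hβ => ?_)
  rw [LieSubmodule.toSubmodule_le_toSubmodule]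
  exact le_iSup₂_of_le β hβ le_rfl

omit [FiniteDimensional ℂ L] [IsKilling ℂ L] in
theorem nil_eq (l : LieSubalgebra ℂ L) : nil H l = weightSum H (RootCone.nilSet (roots H l)) := by
  rw [← nilRoots_eq]
  rfl

omit [IsKilling ℂ L] in
theorem rootSpace_zero_toSubmodule :
    (rootSpace H ((0 : Module.Dual ℂ H) : H → ℂ)).toSubmodule = H.toSubmodule := by
  have := LieAlgebra.rootSpace_zero_eq ℂ L H
  have h0 : ((0 : Module.Dual ℂ H) : H → ℂ) = 0 := rfl
  rw [h0, this]
  rfl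

omit [IsKilling ℂ L] in
theorem levi_eq (l : LieSubalgebra ℂ L) :
    levi H l = weightSum H (insert 0 (RootCone.leviSet (roots H l))) := by
  rw [weightSum, iSup_insert, rootSpace_zero_toSubmodule]
  rfl

variable (H) in
/-- The subalgebra that is the sum of the root spaces of the elements of a closed set `T`. -/
noncomputable def weightSubalgebra (T : Set (Module.Dual ℂ H))
    (hT : ∀ α ∈ T, ∀ β ∈ T, rootSpace H (α + β : Module.Dual ℂ H) ≠ ⊥ → α + β ∈ T) :
    LieSubalgebra ℂ L :=
  { weightSum H T with lie_mem' := fun hx hy => lie_mem_weightSum hT hx hy }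

end RootSubalgebra

/-! ### Solvable subalgebras and the positive system of a Borel subalgebra. -/

namespace RootSubalgebra

open LieAlgebra LieAlgebra.IsKilling LieModule

variable {L : Type*} [LieRing L] [LieAlgebra ℂ L]

/-- Both `e` and `f` are recovered from brackets of `e`, `f` and `h = ⁅e, f⁆`, so they stay in every
term of the derived series. -/
theorem not_isSolvable_of_isSl2Triple {s : LieSubalgebra ℂ L} [IsSolvable s] {h e f : L}
    (t : IsSl2Triple h e f) (he : e ∈ s) (hf : f ∈ s) : False := by
  have hh : h ∈ s := t.lie_e_f ▸ s.lie_mem he hf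
  have key : ∀ k, (⟨e, he⟩ : s) ∈ derivedSeries ℂ s k ∧ (⟨f, hf⟩ : s) ∈ derivedSeries ℂ s k := by
    intro k
    induction k with
    | zero => simp
    | succ k ih =>
      have h1 : (⟨h, hh⟩ : s) ∈ derivedSeries ℂ s k := by
        have := lie_mem_left ℂ s (derivedSeries ℂ s k) _ ⟨f, hf⟩ ih.1
        convert! this using 1
        exact Subtype.ext t.lie_e_f.symm
      rw [derivedSeries_def, derivedSeriesOfIdeal_succ, ← derivedSeries_def]
      have h2 := LieSubmodule.lie_mem_lie h1 ih.1
      have h3 := LieSubmodule.lie_mem_lie h1 ih.2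
      rw [show ⁅(⟨h, hh⟩ : s), (⟨e, he⟩ : s)⁆ = (2 : ℂ) • ⟨e, he⟩ from
        Subtype.ext (t.lie_h_e_smul ℂ)] at h2
      rw [show ⁅(⟨h, hh⟩ : s), (⟨f, hf⟩ : s)⁆ = (-2 : ℂ) • ⟨f, hf⟩ from
        Subtype.ext (by
          have := t.lie_lie_smul_f ℂ
          rw [← neg_smul] at this
          exact this)] at h3
      have h4 := SMulMemClass.smul_mem (2⁻¹ : ℂ) h2
      have h5 := SMulMemClass.smul_mem (-2⁻¹ : ℂ) h3
      rw [smul_smul] at h4 h5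
      norm_num at h4 h5
      exact ⟨h4, h5⟩
  obtain ⟨k, hk⟩ := IsSolvable.solvable ℂ s
  have := (key k).1
  rw [hk, LieSubmodule.mem_bot] at this
  exact t.e_ne_zero (congrArg Subtype.val this)

variable [FiniteDimensional ℂ L] [IsKilling ℂ L]
  {H : LieSubalgebra ℂ L} [H.IsCartanSubalgebra] {α β : Module.Dual ℂ H}
  {b s : LieSubalgebra ℂ L} {Q T : Set (Module.Dual ℂ H)}

theorem neg_notMem_roots [IsSolvable s] (hα : α ∈ roots H s) : -α ∉ roots H s := by
  intro h
  have h' := mem_roots_top.1 (roots_subset_top hα)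
  let a : Weight ℂ H L := ⟨α, h'.2⟩
  have ha : a.IsNonZero := fun h => h'.1 (DFunLike.coe_injective h)
  obtain ⟨_, e, f, isSl2, he, hf⟩ := exists_isSl2Triple_of_weight_isNonZero ha
  exact not_isSolvable_of_isSl2Triple (s := s) isSl2 (hα.2.2 he) (h.2.2 hf)

theorem eq_of_rootSpace_zero_lie {x y : L} (hx : x ∈ weightSum H {0}) (hy : y ∈ weightSum H {0}) :
    ⁅x, y⁆ = 0 := by
  have h : weightSum H {0} = H.toSubmodule := by
    rw [weightSum, iSup_singleton, rootSpace_zero_toSubmodule]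
  rw [h] at hx hy
  have := trivial_lie_zero H H ⟨x, hx⟩ ⟨y, hy⟩
  exact congrArg Subtype.val this

omit [FiniteDimensional ℂ L] [IsKilling ℂ L] in
theorem derivedSeries_succ_le (T T' : Set (Module.Dual ℂ H)) (k : ℕ)
    (hT : ∀ x ∈ weightSum H T, ∀ y ∈ weightSum H T, ⁅x, y⁆ ∈ weightSum H T')
    (hk : ∀ x ∈ derivedSeries ℂ s k, (x : L) ∈ weightSum H T) :
    ∀ x ∈ derivedSeries ℂ s (k + 1), (x : L) ∈ weightSum H T' := by
  rw [derivedSeries_def, derivedSeriesOfIdeal_succ, ← derivedSeries_def]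
  have : (⁅derivedSeries ℂ s k, derivedSeries ℂ s k⁆ : LieIdeal ℂ s).toSubmodule ≤
      (weightSum H T').comap s.subtype := by
    rw [LieSubmodule.lieIdeal_oper_eq_linear_span', Submodule.span_le]
    rintro _ ⟨x, hx, y, hy, rfl⟩
    exact hT _ (hk x hx) _ (hk y hy)
  exact fun x hx => this hx

/-- One more derivation replaces `T` by the roots that are sums of two elements of `T`, a strictly
smaller closed set; induction on the size of `T`. -/
theorem isSolvable_of_derivedSeries_le (hT : RootCone.IsClosedIn (roots H ⊤) T)
    (hneg : ∀ x ∈ T, -x ∉ T) (k : ℕ)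
    (hk : ∀ x ∈ derivedSeries ℂ s k, (x : L) ∈ weightSum H T) : IsSolvable s := by
  have hfin : T.Finite := finite_roots.subset hT.1
  induction hn : T.ncard using Nat.strong_induction_on generalizing T k with
  | _ n ih =>
  rcases T.eq_empty_or_nonempty with rfl | hne
  · refine IsSolvable.mk (R := ℂ) (k := k) ((LieSubmodule.eq_bot_iff _).2 fun x hx => ?_)
    have := hk x hx
    rw [weightSum, iSup_emptyset, Submodule.mem_bot] at this
    exact Subtype.ext this
  let T' : Set (Module.Dual ℂ H) := {z ∈ roots H ⊤ | ∃ x ∈ T, ∃ y ∈ T, z = x + y}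
  have hsub : T' ⊆ T := by
    rintro _ ⟨hz, x, hx, y, hy, rfl⟩
    exact hT.2 x hx y hy hz
  -- An element `t` of `T` that is minimal for the order of `T`, obtained as maximal for `-T`, is
  -- not a sum `x + y`, since `t - y = x` would be lower.
  have hlt : T'.ncard < T.ncard := by
    refine Set.ncard_lt_ncard ⟨hsub, fun hle => ?_⟩ hfin
    have hneg' : ∀ x ∈ Neg.neg '' T, -x ∉ Neg.neg '' T := by
      rintro _ ⟨x, hx, rfl⟩ ⟨y, hy, h⟩
      rw [neg_neg, neg_eq_iff_eq_neg] at h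
      exact hneg x hx (h ▸ hy)
    have hcl : RootCone.IsClosedIn (roots H ⊤) (Neg.neg '' T) := by
      refine ⟨?_, ?_⟩
      · rintro _ ⟨x, hx, rfl⟩
        exact neg_mem_roots (hT.1 hx)
      · rintro _ ⟨x, hx, rfl⟩ _ ⟨y, hy, rfl⟩ h
        refine ⟨x + y, hT.2 x hx y hy ?_, by abel⟩
        have := neg_mem_roots h
        rwa [← neg_add, neg_neg] at this
    obtain ⟨t, ht, hmax⟩ := isRootSet_roots.exists_maximal hcl hneg' hfin hne
    obtain ⟨-, x, hx, y, hy, rfl⟩ := hle ht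
    refine hmax (-y) (AddSubmonoid.subset_closure ⟨y, hy, rfl⟩)
      (neg_ne_zero.2 (isRootSet_roots.ne_zero (hT.1 hy))) ?_
    rwa [add_neg_cancel_right]
  have hcl' : RootCone.IsClosedIn (roots H ⊤) T' :=
    ⟨fun z hz => hz.1, fun x hx y hy h => ⟨h, x, hsub hx, y, hsub hy, rfl⟩⟩
  have hadd : ∀ α ∈ T, ∀ β ∈ T, rootSpace H (α + β : Module.Dual ℂ H) ≠ ⊥ → α + β ∈ T' := by
    refine fun α hα β hβ h => ⟨mem_roots_top.2 ⟨fun h0 => ?_, h⟩, α, hα, β, hβ, rfl⟩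
    exact hneg α hα (by rwa [← eq_neg_of_add_eq_zero_right h0])
  exact ih T'.ncard (hn ▸ hlt) hcl' (fun x hx h => hneg x (hsub hx) (hsub h)) (k + 1)
    (derivedSeries_succ_le T T' k (fun x hx y hy => lie_mem_weightSum hadd hx hy) hk)
    (hfin.subset hsub) rfl

omit [FiniteDimensional ℂ L] [IsKilling ℂ L] in
theorem add_mem_insert_zero (hQ : RootCone.IsClosedIn (roots H ⊤) Q) :
    ∀ α ∈ insert 0 Q, ∀ β ∈ insert 0 Q, rootSpace H (α + β : Module.Dual ℂ H) ≠ ⊥ →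
      α + β ∈ insert 0 Q := by
  rintro α hα β hβ h
  by_cases h0 : α + β = 0
  · exact .inl h0
  rcases hα with rfl | hα
  · rwa [zero_add]
  rcases hβ with rfl | hβ
  · rw [add_zero]
    exact .inr hα
  exact .inr (hQ.2 α hα β hβ (mem_roots_top.2 ⟨h0, h⟩))

/-- The Cartan subalgebra is abelian and `Q` contains no opposite roots, so one derivation already
removes the zero weight space. -/
theorem isSolvable_weightSubalgebra (hQ : RootCone.IsClosedIn (roots H ⊤) Q)
    (hneg : ∀ x ∈ Q, -x ∉ Q) :
    IsSolvable (weightSubalgebra H (insert 0 Q) (add_mem_insert_zero hQ)) := by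
  refine isSolvable_of_derivedSeries_le (H := H) hQ hneg 1
    (derivedSeries_succ_le (insert 0 Q) Q 0 ?_ fun x _ => x.2)
  intro x hx y hy
  refine lie_mem_weightSum_of_forall (fun α hα β hβ x hx y hy => ?_) hx hy
  by_cases h0 : α = 0 ∧ β = 0
  · obtain ⟨rfl, rfl⟩ := h0
    have hx' : x ∈ weightSum H {0} := rootSpace_le_weightSum (Set.mem_singleton _) hx
    have hy' : y ∈ weightSum H {0} := rootSpace_le_weightSum (Set.mem_singleton _) hy
    rw [eq_of_rootSpace_zero_lie hx' hy']
    exact zero_mem _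
  · have hx' : x ∈ weightSum H {α} := rootSpace_le_weightSum (Set.mem_singleton _) hx
    have hy' : y ∈ weightSum H {β} := rootSpace_le_weightSum (Set.mem_singleton _) hy
    refine lie_mem_weightSum (fun α' hα' β' hβ' h => ?_) hx' hy'
    rw [Set.mem_singleton_iff] at hα' hβ'
    subst hα' hβ'
    refine (add_mem_insert_zero hQ _ hα _ hβ h).resolve_left fun h1 => ?_
    rcases hα with rfl | hα
    · exact h0 ⟨rfl, by simpa using h1⟩
    rcases hβ with rfl | hβ
    · exact h0 ⟨by simpa using h1, rfl⟩
    exact hneg _ hα (by rwa [← eq_neg_of_add_eq_zero_right h1])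

/-- A subalgebra containing `H` is stable under `H`, hence the sum of its intersections with the
weight spaces; a nonzero intersection with a one-dimensional root space is all of it. -/
theorem le_weightSum_roots (hs : H ≤ s) : s.toSubmodule ≤ weightSum H (insert 0 (roots H s)) := by
  let N : LieSubmodule ℂ H L :=
    { s.toSubmodule with lie_mem := fun {x m} hm => s.lie_mem (hs x.2) hm }
  have h := eq_iSup_inf_genWeightSpace (K := ℂ) (N := N)
  have h1 : s.toSubmodule = N.toSubmodule := rfl
  rw [h1, h, LieSubmodule.iSup_toSubmodule, iSup_le_iff]
  rintro χ x ⟨hx1, hx2⟩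
  change x ∈ rootSpace H χ.toLinear at hx2
  by_cases h0 : x = 0
  · rw [h0]
    exact zero_mem _
  refine rootSpace_le_weightSum ?_ hx2
  by_cases hχ : χ.toLinear = 0
  · exact .inl hχ
  · have h2 : χ.toLinear ∈ roots H ⊤ := mem_roots_top.2 ⟨hχ, χ.2⟩
    exact .inr (mem_roots.2 ⟨h2, rootSpace_le_of_mem h2 hx2 h0 hx1⟩)

omit [FiniteDimensional ℂ L] [IsKilling ℂ L] in
theorem isClosedIn_closure (Q : Set (Module.Dual ℂ H)) :
    RootCone.IsClosedIn (roots H ⊤)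
      {x ∈ roots H ⊤ | x ∈ AddSubmonoid.closure Q} :=
  ⟨fun _ h => h.1, fun _ hx _ hy h => ⟨h, add_mem hx.2 hy.2⟩⟩

/-- Adding the expressions of `α` and `-α` isolates a multiple of `-β`. The multiple is nonzero
because the cone of `roots H s` contains no opposite nonzero elements. -/
theorem exists_nsmul_mem_closure (h : ∀ x ∈ roots H s, -x ∉ roots H s)
    (hα : α ∈ roots H ⊤) (hα' : α ∈ AddSubmonoid.closure (insert β (roots H s)))
    (hn : -α ∈ AddSubmonoid.closure (insert β (roots H s))) :
    ∃ n : ℕ, n ≠ 0 ∧ -(n • β) ∈ AddSubmonoid.closure (roots H s) := by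
  have h0 := isRootSet_roots.ne_zero hα
  rw [Set.insert_eq, AddSubmonoid.closure_union, AddSubmonoid.mem_sup] at hα' hn
  obtain ⟨u, hu, v, hv, huv⟩ := hα'
  obtain ⟨w, hw, z, hz, hwz⟩ := hn
  obtain ⟨m, rfl⟩ := AddSubmonoid.mem_closure_singleton.1 hu
  obtain ⟨k, rfl⟩ := AddSubmonoid.mem_closure_singleton.1 hw
  have h1 : v + z = -((m + k) • β) := by
    rw [eq_neg_iff_add_eq_zero, add_smul]
    rw [← huv] at hwz
    have := congrArg (m • β + v + ·) hwz
    simp only [add_neg_cancel] at this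
    rw [← this]
    abel
  refine ⟨m + k, fun hmk => ?_, h1 ▸ add_mem hv hz⟩
  rw [hmk, zero_smul, neg_zero] at h1
  obtain ⟨rfl, rfl⟩ : m = 0 ∧ k = 0 := by omega
  simp only [zero_smul, zero_add] at huv hwz
  exact isRootSet_roots.ne_zero_of_mem_closure_add isClosedIn_roots h hv hz (huv ▸ h0) h1

/-- The set `Q` gives a solvable subalgebra containing `b`, so maximality of `b` applies. -/
theorem mem_roots_of_isBorel (hb : IsBorel b) (hHb : H ≤ b) {Q : Set (Module.Dual ℂ H)}
    (hQ : RootCone.IsClosedIn (roots H ⊤) Q) (hneg : ∀ x ∈ Q, -x ∉ Q) (hbQ : roots H b ⊆ Q) :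
    Q ⊆ roots H b := by
  have h1 := isSolvable_weightSubalgebra hQ hneg
  have h2 : b ≤ weightSubalgebra H (insert 0 Q) (add_mem_insert_zero hQ) :=
    (le_weightSum_roots hHb).trans (weightSum_mono (Set.insert_subset_insert hbQ))
  have h3 := hb.2 h1 h2
  exact fun α hα => mem_roots.2 ⟨hQ.1 hα, (rootSpace_le_weightSum (.inr hα)).trans h3⟩

/-- If a root could not be added to `b`, a positive multiple of its negative lies in the cone of the
roots of `b`. Were this so for both `α` and `-α`, that cone would contain two opposite nonzero
elements. -/
theorem mem_or_neg_mem_of_isBorel (hb : IsBorel b) (hHb : H ≤ b) (hα : α ∈ roots H ⊤) :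
    α ∈ roots H b ∨ -α ∈ roots H b := by
  have := hb.1
  have hneg : ∀ x ∈ roots H b, -x ∉ roots H b := fun _ h => neg_notMem_roots h
  have key : ∀ β ∈ roots H ⊤, β ∉ roots H b →
      ∃ n : ℕ, n ≠ 0 ∧ -(n • β) ∈ AddSubmonoid.closure (roots H b) := by
    intro β hβ hβb
    by_contra hc
    refine hβb (mem_roots_of_isBorel hb hHb (isClosedIn_closure (insert β (roots H b)))
      (fun x hx hx' => hc (exists_nsmul_mem_closure hneg hx.1 hx.2 hx'.2)) ?_ ?_)
    · exact fun x hx => ⟨roots_subset_top hx, AddSubmonoid.subset_closure (.inr hx)⟩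
    · exact ⟨hβ, AddSubmonoid.subset_closure (.inl rfl)⟩
  by_contra! hc
  obtain ⟨m, hm, h1⟩ := key α hα hc.1
  obtain ⟨n, hn, h2⟩ := key (-α) (neg_mem_roots hα) hc.2
  refine isRootSet_roots.ne_zero_of_mem_closure_add isClosedIn_roots hneg
    (nsmul_mem h1 n) (nsmul_mem h2 m) ?_ ?_
  · have h0 := isRootSet_roots.ne_zero hα
    have : IsAddTorsionFree (Module.Dual ℂ H) := .of_isTorsionFree ℂ _
    simp [hn, hm, h0]
  · simp only [smul_neg, neg_neg, smul_smul, mul_comm n m]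
    exact neg_add_cancel _

theorem isConfig (hb : IsBorel b) (hHb : H ≤ b) (l : LieSubalgebra ℂ L) :
    RootCone.IsConfig (roots H ⊤) (roots H l) (roots H b ∩ RootCone.leviSet (roots H l)) where
  closed := isClosedIn_roots
  pos_closed := by
    refine ⟨fun x hx => roots_subset_top hx.1, fun x hx y hy h =>
      ⟨isClosedIn_roots.2 x hx.1 y hy.1 h, isClosedIn_roots.2 x hx.2.1 y hy.2.1 h, ?_⟩⟩
    rw [neg_add]
    refine isClosedIn_roots.2 _ hx.2.2 _ hy.2.2 ?_
    rw [← neg_add]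
    exact neg_mem_roots h
  pos_subset := fun _ h => h.2
  pos_or_neg x hx := (mem_or_neg_mem_of_isBorel hb hHb (roots_subset_top hx.1)).imp
    (fun h => ⟨h, hx⟩) fun h => ⟨h, RootCone.mem_leviSet_neg hx⟩
  neg_notMem x hx h := by
    have := hb.1
    exact neg_notMem_roots hx.1 h.1

end RootSubalgebra

/-! ### From pairs of singular roots to infinite weights. -/

namespace RootSubalgebra

open LieAlgebra LieAlgebra.IsKilling LieModule RootCone

variable {L : Type*} [LieRing L] [LieAlgebra ℂ L] [FiniteDimensional ℂ L] [IsKilling ℂ L]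
  {H : LieSubalgebra ℂ L} [H.IsCartanSubalgebra] {α β : Module.Dual ℂ H}
  {t b l : LieSubalgebra ℂ L}

omit [FiniteDimensional ℂ L] [IsKilling ℂ L] in
theorem hasStronglyOrthogonalDecomposition_of_multiset (I : Set (Module.Dual ℂ H))
    (B : Multiset (Module.Dual ℂ H)) (hB : ∀ x ∈ B, x ∈ I)
    (h : ∀ x ∈ B, ∀ y ∈ B, x ≠ y → x + y ∉ roots H t ∧ x + y ≠ 0 ∧ x - y ∉ roots H t) :
    HasStronglyOrthogonalDecomposition H t I B.sum := by
  classical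
  refine ⟨B.toFinset, fun x => B.count x, ?_, ?_, ?_, ?_⟩
  · exact fun x hx => hB x (by simpa using hx)
  · exact fun x hx => Multiset.count_pos.2 (by simpa using hx)
  · intro x hx y hy hxy
    obtain ⟨h1, h2, h3⟩ := h x (by simpa using hx) y (by simpa using hy) hxy
    exact ⟨h1, h2, h3, sub_ne_zero.2 hxy⟩
  · exact Finset.sum_multiset_count B

omit [FiniteDimensional ℂ L] [IsKilling ℂ L] in
theorem isStrictlyInfinite_add (ht : IsClosedIn (roots H ⊤) (roots H t))
    (hα : α ∈ sing H t b l) (hβ : β ∈ sing H t b l) (h0 : α + β ≠ 0)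
    (hn : ∀ z, z = α ∨ z = β → ∀ x ∈ nilSet (roots H l),
      z + x ≠ 0 ∧ (z + x ∈ roots H t → z + x ∈ nilSet (roots H l)))
    (hlt : roots H l ⊆ roots H t) (B : Multiset (Module.Dual ℂ H))
    (hB : ∀ x ∈ B, x ∈ nilSet (roots H l)) (hs : B.sum = α + β)
    (h : ∀ x ∈ B, ∀ y ∈ B, x ≠ y → x + y ∉ roots H t ∧ x + y ≠ 0 ∧ x - y ∉ roots H t) :
    IsStrictlyInfinite H t b l (α + β) := by
  have hmem : ∀ z, z = α ∨ z = β → z ∈ {α ∈ sing H t b l | ∀ x ∈ rootSpace H α,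
      ∀ y ∈ nil H l, ⁅x, y⁆ ∈ nil H l} := by
    intro z hz
    have hzs : z ∈ sing H t b l := by rcases hz with rfl | rfl <;> assumption
    refine ⟨hzs, fun x hx y hy => ?_⟩
    rw [nil_eq] at hy ⊢
    have hadd : ∀ a ∈ ({z} : Set (Module.Dual ℂ H)), ∀ b ∈ nilSet (roots H l),
        rootSpace H (a + b : Module.Dual ℂ H) ≠ ⊥ → a + b ∈ nilSet (roots H l) := by
      rintro a rfl b hb h1
      obtain ⟨h2, h3⟩ := hn a hz b hb
      exact h3 (ht.2 a hzs.1.1 b (hlt hb.1) (mem_roots_top.2 ⟨h2, h1⟩))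
    exact lie_mem_weightSum hadd (rootSpace_le_weightSum (Set.mem_singleton z) hx) hy
  refine ⟨⟨h0, ?_, ?_, ?_⟩, ?_⟩
  · exact add_mem (AddSubmonoid.subset_closure hα) (AddSubmonoid.subset_closure hβ)
  · rw [← hs, nilRoots_eq]
    exact multiset_sum_mem_closure hB
  · exact add_mem (AddSubmonoid.subset_closure (hmem α (.inl rfl)))
      (AddSubmonoid.subset_closure (hmem β (.inr rfl)))
  · rw [← hs, nilRoots_eq]
    exact hasStronglyOrthogonalDecomposition_of_multiset _ B hB h

omit [FiniteDimensional ℂ L] [IsKilling ℂ L] in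
theorem exists_rel_of_not_coneCondition (h : ¬ ConeCondition H b l) :
    ∃ A B, Rel (roots H ⊤) (roots H l) (roots H b ∩ leviSet (roots H l)) A B := by
  by_contra hc
  refine h (Set.eq_singleton_iff_unique_mem.2 ⟨⟨zero_mem _, zero_mem _⟩, fun w hw => ?_⟩)
  by_contra h0
  rw [nilRoots_eq, sing_eq] at hw
  exact hc (exists_rel hw.1 hw.2 h0)

/-- The hypothesis `hlong` expresses length through root strings: `α` is long if `γ - 2α` is a root
only for `γ = α`. By `sub_two_smul_mem_roots` this bounds its pairings with the other roots by 1. -/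
theorem exists_isStrictlyInfinite (hb : IsBorel b) (hHb : H ≤ b)
    (hpair : ∀ S P A B, IsConfig (roots H ⊤) S P → Rel (roots H ⊤) S P A B →
      HasPair (roots H ⊤) S P)
    (hlong : ∀ α ∈ roots H ⊤, ∀ β ∈ roots H ⊤, α ≠ β → α + β ∉ roots H ⊤ → α + β ≠ 0 →
      (∀ γ ∈ roots H ⊤, γ - 2 • α ∈ roots H ⊤ → γ = α) ∨
        ∀ γ ∈ roots H ⊤, γ - 2 • β ∈ roots H ⊤ → γ = β)
    (hcone : ¬ ConeCondition H b l) : ∃ ω, IsStrictlyInfinite H ⊤ b l ω := by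
  have hc := isConfig hb hHb l
  have hΦ := isRootSet_roots (H := H)
  obtain ⟨A, B, hrel⟩ := exists_rel_of_not_coneCondition hcone
  obtain ⟨x, hx, y, hy, h0, hcl, hn⟩ :=
    exists_normalizing_pair hΦ hc (hpair _ _ A B hc hrel)
  have hl : ∀ α, α ∈ roots H ⊤ → (∀ γ ∈ roots H ⊤, γ - 2 • α ∈ roots H ⊤ → γ = α) →
      IsLongRoot (roots H ⊤) corootPairing α := by
    intro α hα h γ hγ hne
    by_contra! hlt
    exact hne (h γ hγ (sub_two_smul_mem_roots hα hγ hlt))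
  obtain ⟨B, hB, hs, h⟩ := exists_orthogonal hΦ hc (fun x hx => corootPairing_self hx)
    (fun x hx y hy => one_le_corootPairing hx hy)
    (fun x hx y hy h1 h2 h3 => (hlong x hx y hy
      (fun h => hΦ.ne_zero h1 (sub_eq_zero.2 h)) h2 h3).imp (hl x hx) (hl y hy)) hx hy hcl
  exact ⟨x + y, isStrictlyInfinite_add isClosedIn_roots hx hy h0 hn roots_subset_top B hB hs h⟩

omit [FiniteDimensional ℂ L] [IsKilling ℂ L] in
theorem roots_weightSubalgebra {T : Set (Module.Dual ℂ H)} (hT : IsClosedIn (roots H ⊤) T) :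
    roots H (weightSubalgebra H (insert 0 T) (add_mem_insert_zero hT)) = T := by
  ext α
  rw [mem_roots]
  constructor
  · rintro ⟨h1, h2⟩
    exact (mem_of_rootSpace_le_weightSum (mem_roots_top.1 h1).2 h2).resolve_left
      (mem_roots_top.1 h1).1
  · exact fun h => ⟨hT.1 h, rootSpace_le_weightSum (.inr h)⟩

theorem exists_isInfinite {W : Set (Module.Dual ℂ H)}
    {c : Module.Dual ℂ H → Module.Dual ℂ H →+ ℝ} (hW : IsSignedBasis W c)
    (hHW : roots H ⊤ = symplecticEdges W) (hb : IsBorel b) (hHb : H ≤ b)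
    (hpair : ∀ S P A B, IsConfig (roots H ⊤) S P → Rel (roots H ⊤) S P A B →
      HasPair (roots H ⊤) S P)
    (hcone : ¬ ConeCondition H b l) : ∃ ω, IsInfinite H b l ω := by
  have hc := isConfig hb hHb l
  have hΦ := isRootSet_roots (H := H)
  obtain ⟨A, B, hrel⟩ := exists_rel_of_not_coneCondition hcone
  have hp := hpair _ _ A B hc hrel
  rw [hHW] at hc hp hΦ
  obtain ⟨Ψ, hΨ, x, hx, y, hy, h0, hn, B, hB, hs, h⟩ := exists_symplectic hW hΦ hc hp
  rw [← hHW] at hΨ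
  -- Since `Ψ` contains the Levi roots, intersecting with `t` changes neither the Levi part nor its
  -- positive system, so the singular roots of `l ⊓ t` in `t` are those found for `Ψ`.
  let t := weightSubalgebra H (insert 0 Ψ) (add_mem_insert_zero hΨ.closed)
  have ht : roots H t = Ψ := roots_weightSubalgebra hΨ.closed
  have hlt : roots H (l ⊓ t) = roots H l ∩ Ψ := by rw [roots_inf, ht]
  have hP : roots H (b ⊓ t) ∩ leviSet (roots H (l ⊓ t)) =
      roots H b ∩ leviSet (roots H l) := by
    rw [roots_inf, ht, hlt, hΨ.leviSet_eq, Set.inter_assoc,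
      Set.inter_eq_right.2 hΨ.levi_subset]
  have hsing : sing H t (b ⊓ t) (l ⊓ t) =
      singSet Ψ (roots H l ∩ Ψ) (roots H b ∩ leviSet (roots H l)) := by
    rw [sing_eq, hP, ht, hlt]
  refine ⟨x + y, t, ⟨?_, ?_⟩, ?_, ?_⟩
  · change H.toSubmodule ≤ weightSum H (insert 0 Ψ)
    rw [← rootSpace_zero_toSubmodule]
    exact rootSpace_le_weightSum (.inl rfl)
  · rw [ht]
    exact hΨ.neg_mem
  · rw [levi_eq]
    exact weightSum_mono (Set.insert_subset_insert hΨ.levi_subset)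
  · refine isStrictlyInfinite_add ?_ ?_ ?_ h0 ?_ ?_ B ?_ hs ?_
    · rw [ht]
      exact hΨ.closed
    · rwa [hsing]
    · rwa [hsing]
    · rwa [hlt, ht]
    · rw [hlt, ht]
      exact Set.inter_subset_right
    · rwa [hlt]
    · rwa [ht]

end RootSubalgebra

/-! ### Diagonalizing a Cartan subalgebra in a faithful representation. -/

namespace RootSubalgebra

open LieAlgebra LieAlgebra.IsKilling LieModule

/-- A faithful representation of a Lie algebra, as a linear map to endomorphisms. -/
structure IsFaithfulRep {L V : Type*} [LieRing L] [LieAlgebra ℂ L] [AddCommGroup V] [Module ℂ V]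
    (ψ : L →ₗ[ℂ] Module.End ℂ V) : Prop where
  injective : Function.Injective ψ
  map_lie : ∀ x y, ψ ⁅x, y⁆ = ψ x * ψ y - ψ y * ψ x

/-- A basis of simultaneous eigenvectors for a subalgebra `H`. -/
def IsWeightBasis {L V ι : Type*} [LieRing L] [LieAlgebra ℂ L] [AddCommGroup V] [Module ℂ V]
    {H : LieSubalgebra ℂ L} (ψ : L →ₗ[ℂ] Module.End ℂ V) (v : Module.Basis ι ℂ V)
    (wt : ι → Module.Dual ℂ H) : Prop :=
  ∀ (h : H) i, ψ h (v i) = wt i h • v i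

variable {L : Type*} [LieRing L] [LieAlgebra ℂ L] [FiniteDimensional ℂ L] [IsKilling ℂ L]
  {H : LieSubalgebra ℂ L} [H.IsCartanSubalgebra]
  {V : Type*} [AddCommGroup V] [Module ℂ V]
  {ψ : L →ₗ[ℂ] Module.End ℂ V}

omit [FiniteDimensional ℂ L] [IsKilling ℂ L] in
theorem rootSpace_ne_bot_iff {α : Module.Dual ℂ H} :
    rootSpace H α ≠ ⊥ ↔ ∃ x ∈ rootSpace H α, x ≠ 0 := by
  rw [Ne, LieSubmodule.eq_bot_iff]
  push Not
  rfl

namespace IsFaithfulRep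

variable (hψ : IsFaithfulRep ψ)
include hψ

-- A Cartan subalgebra is self-normalizing, and by faithfulness an element commuting with it in the
-- representation centralizes it.
omit [FiniteDimensional ℂ L] [IsKilling ℂ L] in
theorem mem_of_commute {x : L} (hx : ∀ h ∈ H, Commute (ψ h) (ψ x)) : x ∈ H := by
  rw [← LieSubalgebra.IsCartanSubalgebra.self_normalizing (H := H),
    LieSubalgebra.mem_normalizer_iff]
  intro y hy
  have : ⁅x, y⁆ = 0 := hψ.injective (by rw [hψ.map_lie, (hx y hy).eq, sub_self, map_zero])
  rw [this]
  exact zero_mem _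

omit [FiniteDimensional ℂ L] [IsKilling ℂ L] in
theorem isNilpotent_ad {x : L} (hx : IsNilpotent (ψ x)) : IsNilpotent (ad ℂ L x) := by
  have h : IsNilpotent (LinearMap.mulLeft ℂ (ψ x) - LinearMap.mulRight ℂ (ψ x)) :=
    (LinearMap.commute_mulLeft_right _ _).isNilpotent_sub
      (by rwa [LinearMap.isNilpotent_mulLeft_iff]) (by rwa [LinearMap.isNilpotent_mulRight_iff])
  obtain ⟨k, hk⟩ := h
  refine ⟨k, LinearMap.ext fun y => hψ.injective ?_⟩
  have key : ∀ (m : ℕ) (y : L), ψ ((ad ℂ L x ^ m) y) =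
      ((LinearMap.mulLeft ℂ (ψ x) - LinearMap.mulRight ℂ (ψ x)) ^ m) (ψ y) := by
    intro m
    induction m with
    | zero => intro y; simp
    | succ m ih =>
      intro y
      rw [pow_succ, pow_succ, Module.End.mul_apply, Module.End.mul_apply, ih, ad_apply,
        hψ.map_lie]
      rfl
  rw [key, hk]
  simp

theorem commute {x y : L} (hx : x ∈ H) (hy : y ∈ H) : Commute (ψ x) (ψ y) := by
  have h := trivial_lie_zero H H ⟨x, hx⟩ ⟨y, hy⟩
  have h' : ⁅x, y⁆ = 0 := congrArg Subtype.val h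
  have := hψ.map_lie x y
  rw [h', map_zero] at this
  exact (sub_eq_zero.1 this.symm)

/-- By `hJ` the nilpotent Jordan part of `ψ h` is some `ψ y`. It commutes with `ψ H`, so `y ∈ H`;
being ad-nilpotent in a Cartan subalgebra of a Killing algebra, `y` vanishes. -/
theorem isSemisimple [FiniteDimensional ℂ V]
    (hJ : ∀ x : L, ∀ n ∈ Algebra.adjoin ℂ {ψ x}, ∀ s ∈ Algebra.adjoin ℂ {ψ x}, IsNilpotent n →
      s.IsSemisimple → ψ x = n + s → n ∈ Set.range ψ) {h : L} (hh : h ∈ H) :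
    (ψ h).IsSemisimple := by
  obtain ⟨n, hn, s, hs, hnil, hss, heq⟩ := (ψ h).exists_isNilpotent_isSemisimple
  obtain ⟨y, rfl⟩ := hJ h n hn s hs hnil hss heq
  have hy : y ∈ H := hψ.mem_of_commute fun x hx =>
    Algebra.commute_of_mem_adjoin_singleton_of_commute hn (hψ.commute hx hh)
  rw [eq_zero_of_isNilpotent_ad_of_mem_isCartanSubalgebra ℂ L H hy (hψ.isNilpotent_ad hnil),
    map_zero, zero_add] at heq
  rwa [heq]

theorem exists_isWeightBasis [FiniteDimensional ℂ V] (hss : ∀ h ∈ H, (ψ h).IsSemisimple) :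
    ∃ (v : Module.Basis (Fin (Module.finrank ℂ V)) ℂ V)
      (wt : Fin (Module.finrank ℂ V) → Module.Dual ℂ H), IsWeightBasis ψ v wt := by
  have h1 := Module.End.iSup_iInf_maxGenEigenspace_eq_top_of_iSup_maxGenEigenspace_eq_top_of_commute
    (fun h : H => ψ h) (fun h h' _ => hψ.commute h.2 h'.2)
    (fun h => Module.End.iSup_maxGenEigenspace_eq_top _)
  let S : Set V := {x | ∃ χ : H → ℂ, ∀ h : H, ψ h x = χ h • x}
  have hS : ⊤ ≤ Submodule.span ℂ S := by
    rw [← h1, iSup_le_iff]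
    intro χ x hx
    refine Submodule.subset_span ⟨χ, fun h => ?_⟩
    have := (Submodule.mem_iInf _).1 hx h
    rw [(hss h h.2).isFinitelySemisimple.maxGenEigenspace_eq_eigenspace,
      Module.End.mem_eigenspace_iff] at this
    exact this
  let b := Module.Basis.ofSpan hS
  let v := b.reindex (b.indexEquiv (Module.finBasis ℂ V))
  have hv : ∀ i, v i ∈ S := fun i => Module.Basis.ofSpan_subset hS (by
    rw [Module.Basis.reindex_apply]
    exact ⟨_, rfl⟩)
  refine ⟨v, fun i => (v.coord i) ∘ₗ (LinearMap.applyₗ (v i)) ∘ₗ ψ ∘ₗ H.toSubmodule.subtype,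
    fun h i => ?_⟩
  obtain ⟨χ, hχ⟩ := hv i
  change ψ h (v i) = v.coord i (ψ h (v i)) • v i
  rw [hχ h]
  simp

variable {ι : Type*} {v : Module.Basis ι ℂ V} {wt : ι → Module.Dual ℂ H}
  (hv : IsWeightBasis ψ v wt)

omit [FiniteDimensional ℂ L] [IsKilling ℂ L] in
include hv in
theorem mem_of_diagonal {x : L} {c : ι → ℂ} (hx : ∀ i, ψ x (v i) = c i • v i) : x ∈ H := by
  refine hψ.mem_of_commute fun h hh => v.ext fun i => ?_
  have := hv ⟨h, hh⟩ i
  simp only at this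
  simp only [Module.End.mul_apply, hx, this, map_smul, smul_smul, mul_comm]

omit [FiniteDimensional ℂ L] [IsKilling ℂ L] in
theorem mem_rootSpace {α : Module.Dual ℂ H} {x : L}
    (hx : ∀ h : H, ψ h * ψ x - ψ x * ψ h = α h • ψ x) : x ∈ rootSpace H α := by
  refine weightSpace_le_genWeightSpace L _ ((mem_weightSpace _ _).2 fun h => ?_)
  refine hψ.injective ?_
  rw [map_smul, ← hx h]
  exact hψ.map_lie h x

include hv in
theorem exists_coord_ne_zero {α : Module.Dual ℂ H} {x : L} (hx : x ∈ rootSpace H α)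
    (h0 : x ≠ 0) : ∃ i j, α = wt i - wt j ∧ v.repr (ψ x (v j)) i ≠ 0 := by
  have h1 : ψ x ≠ 0 := fun h => h0 (hψ.injective (by rw [h, map_zero]))
  obtain ⟨j, hj⟩ : ∃ j, ψ x (v j) ≠ 0 := by
    by_contra! h
    exact h1 (v.ext fun j => by rw [h j, LinearMap.zero_apply])
  obtain ⟨i, hi⟩ : ∃ i, v.repr (ψ x (v j)) i ≠ 0 := by
    by_contra! h
    exact hj (v.repr.injective (by ext i; simp [h i]))
  refine ⟨i, j, LinearMap.ext fun h => ?_, hi⟩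
  have h2 : ψ h (ψ x (v j)) = (α h + wt j h) • ψ x (v j) := by
    have h3 : ⁅h, x⁆ = α h • x := lie_eq_smul_of_mem_rootSpace hx h
    have h4 := hψ.map_lie h x
    rw [show ⁅(h : L), x⁆ = α h • x from h3, map_smul] at h4
    have h5 := congrArg (fun f => f (v j)) h4
    simp only [LinearMap.smul_apply, LinearMap.sub_apply, Module.End.mul_apply, hv h j,
      map_smul] at h5
    rw [add_smul, h5, sub_add_cancel]
  have h6 : ∀ y : V, v.repr (ψ h y) i = wt i h * v.repr y i := by
    intro y
    have : v.coord i ∘ₗ ψ h = wt i h • v.coord i := by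
      refine v.ext fun k => ?_
      simp only [LinearMap.comp_apply, hv h k, map_smul, LinearMap.smul_apply,
        Module.Basis.coord_apply, Module.Basis.repr_self, smul_eq_mul]
      by_cases hk : k = i
      · rw [hk]
      · rw [Finsupp.single_eq_of_ne (Ne.symm hk)]
        simp
    exact congrArg (fun f => f y) this
  have h7 := h6 (ψ x (v j))
  rw [h2, map_smul, Finsupp.smul_apply, smul_eq_mul] at h7
  have h8 := mul_right_cancel₀ hi h7
  rw [LinearMap.sub_apply, ← h8, add_sub_cancel_right]

end IsFaithfulRep

end RootSubalgebra

/-! ### Weights and roots of special linear algebras. -/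

namespace RootSubalgebra

open LieAlgebra LieAlgebra.IsKilling LieModule

variable {L : Type*} [LieRing L] [LieAlgebra ℂ L] [FiniteDimensional ℂ L] [IsKilling ℂ L]
  {H : LieSubalgebra ℂ L} [H.IsCartanSubalgebra]
  {V : Type*} [AddCommGroup V] [Module ℂ V] [FiniteDimensional ℂ V]
  {ψ : L →ₗ[ℂ] Module.End ℂ V}

variable (H) in
/-- The weights `wt i` are those of the natural representation of a special linear algebra. -/
structure IsLinearWeights {ι : Type*} [DecidableEq ι] (wt : ι → Module.Dual ℂ H) : Prop where
  injective : Function.Injective wt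
  mem_roots_iff : ∀ α, α ∈ roots H ⊤ ↔ ∃ i j, i ≠ j ∧ α = wt i - wt j
  exists_apply : ∀ i j, ∃ h : H, ∀ k, wt k h = (if k = i then 1 else 0) - if k = j then 1 else 0

theorem IsFaithfulRep.exists_isLinearWeights (hψ : IsFaithfulRep ψ)
    (hr : ∀ f, f ∈ Set.range ψ ↔ LinearMap.trace ℂ V f = 0) :
    ∃ wt : Fin (Module.finrank ℂ V) → Module.Dual ℂ H, IsLinearWeights H wt := by
  obtain ⟨v, wt, hv⟩ := hψ.exists_isWeightBasis (H := H) fun h hh => hψ.isSemisimple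
    (fun x n _ s _ hn _ _ =>
      (hr n).2 (LinearMap.isNilpotent_trace_of_isNilpotent hn).eq_zero) hh
  let E : Fin (Module.finrank ℂ V) → Fin (Module.finrank ℂ V) → Module.End ℂ V :=
    fun i j => (v.coord j).smulRight (v i)
  have hE : ∀ i j k, E i j (v k) = (if k = j then 1 else 0 : ℂ) • v i := by
    intro i j k
    simp [E, Finsupp.single_apply]
  have htr : ∀ i j, LinearMap.trace ℂ V (E i j) = if i = j then 1 else 0 := by
    intro i j
    simp [E, Finsupp.single_apply]
  have hE0 : ∀ i j, E i j ≠ 0 := by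
    intro i j h
    have := hE i j j
    rw [h] at this
    simp only [LinearMap.zero_apply, if_true, one_smul] at this
    exact v.ne_zero i this.symm
  have hbr : ∀ i j (h : H), ψ h * E i j - E i j * ψ h = (wt i - wt j) h • E i j := by
    intro i j h
    refine v.ext fun k => ?_
    simp only [LinearMap.sub_apply, Module.End.mul_apply, hE, hv h k, hv h i, map_smul,
      LinearMap.smul_apply]
    by_cases hk : k = j
    · subst hk
      simp [sub_smul]
    · simp [hk]
  -- If two weights agreed, the matrix unit `E i j` would commute with the Cartan subalgebra, hence
  -- belong to it, but it is not diagonal.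
  have hinj : Function.Injective wt := by
    intro i j hij
    by_contra hne
    obtain ⟨x, hx⟩ := (hr (E i j)).2 (by rw [htr, if_neg hne])
    have hxH : x ∈ H := hψ.mem_of_commute fun h hh => by
      rw [hx]
      have := hbr i j ⟨h, hh⟩
      rw [hij, sub_self, LinearMap.zero_apply, zero_smul] at this
      exact sub_eq_zero.1 this
    have h1 := hv ⟨x, hxH⟩ j
    simp only at h1
    rw [hx, hE, if_pos rfl, one_smul] at h1
    have := congrArg (fun y => v.repr y i) h1
    simp [Ne.symm hne] at this
  refine ⟨wt, hinj, fun α => ⟨fun hα => ?_, ?_⟩, fun i j => ?_⟩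
  · obtain ⟨x, hx, h0⟩ := rootSpace_ne_bot_iff.1 hα.2.1
    obtain ⟨i, j, rfl, -⟩ := hψ.exists_coord_ne_zero hv hx h0
    refine ⟨i, j, ?_, rfl⟩
    rintro rfl
    exact hα.1 (sub_self _)
  · rintro ⟨i, j, hij, rfl⟩
    obtain ⟨x, hx⟩ := (hr (E i j)).2 (by rw [htr, if_neg hij])
    refine mem_roots_top.2 ⟨fun h => hij (hinj (sub_eq_zero.1 h)), ?_⟩
    rw [rootSpace_ne_bot_iff]
    refine ⟨x, hψ.mem_rootSpace fun h => ?_, fun h0 => hE0 i j ?_⟩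
    · rw [hx, hbr]
    · rw [← hx, h0, map_zero]
  · obtain ⟨x, hx⟩ := (hr (E i i - E j j)).2 (by rw [map_sub, htr, htr]; simp)
    have hd : ∀ k, ψ x (v k) =
        ((if k = i then 1 else 0 : ℂ) - (if k = j then 1 else 0 : ℂ)) • v k := by
      intro k
      rw [hx, LinearMap.sub_apply, hE, hE, sub_smul]
      congr 1
      · by_cases hk : k = i
        · rw [hk]
        · simp [hk]
      · by_cases hk : k = j
        · rw [hk]
        · simp [hk]
    refine ⟨⟨x, hψ.mem_of_diagonal hv hd⟩, fun k => ?_⟩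
    have := hv ⟨x, hψ.mem_of_diagonal hv hd⟩ k
    simp only at this
    rw [hd] at this
    exact (smul_left_injective ℂ (v.ne_zero k) this).symm

end RootSubalgebra

/-! ### Endomorphisms that are skew for a bilinear form. -/

namespace RootSubalgebra

open LieAlgebra LieAlgebra.IsKilling LieModule

section Form

variable {V : Type*} [AddCommGroup V] [Module ℂ V]

/-- A nondegenerate bilinear form that is symmetric (`ε = 1`) or skew-symmetric (`ε = -1`). -/
structure IsSignedForm (B : V →ₗ[ℂ] V →ₗ[ℂ] ℂ) (ε : ℂ) : Prop where
  sq : ε * ε = 1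
  symm : ∀ u w, B u w = ε * B w u
  nondegenerate : ∀ u, (∀ w, B u w = 0) → u = 0

/-- Invariance of a bilinear form under an endomorphism, in the infinitesimal sense. -/
def IsSkew (B : V →ₗ[ℂ] V →ₗ[ℂ] ℂ) (f : Module.End ℂ V) : Prop :=
  ∀ u w, B (f u) w + B u (f w) = 0

variable {B : V →ₗ[ℂ] V →ₗ[ℂ] ℂ} {ε : ℂ}

theorem apply_aeval_eq {f g : Module.End ℂ V} (h : ∀ u w, B (f u) w = B u (g w))
    (p : Polynomial ℂ) (u w : V) :
    B (Polynomial.aeval f p u) w = B u (Polynomial.aeval g p w) := by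
  induction p using Polynomial.induction_on' generalizing u w with
  | add p q hp hq => simp [hp, hq]
  | monomial n a =>
    have : ∀ (n : ℕ) u w, B ((f ^ n) u) w = B u ((g ^ n) w) := by
      intro n
      induction n with
      | zero => simp
      | succ n ih =>
        intro u w
        rw [pow_succ, pow_succ', Module.End.mul_apply, Module.End.mul_apply, ih, h]
    simp [Polynomial.aeval_monomial, this]

variable (hB : IsSignedForm B ε)
include hB

theorem IsSignedForm.eq_of_forall {f g : Module.End ℂ V} (h : ∀ u w, B u (f w) = B u (g w)) :
    f = g := by
  refine LinearMap.ext fun w => sub_eq_zero.1 (hB.nondegenerate _ fun u => ?_)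
  rw [hB.symm, map_sub, h, sub_self, mul_zero]

variable [FiniteDimensional ℂ V]

/-- With `n` and `s` polynomials in `f`, their adjoints `n'` and `s'` are the same polynomials in
`-f`. So `-n'` and `-s'` form another Jordan decomposition of `f`, and uniqueness gives `n' = -n`.
-/
theorem IsSignedForm.isSkew_of_mem_adjoin {f n s : Module.End ℂ V} (hf : IsSkew B f)
    (hn : n ∈ Algebra.adjoin ℂ {f}) (hs : s ∈ Algebra.adjoin ℂ {f}) (hnil : IsNilpotent n)
    (hss : s.IsSemisimple) (hfns : f = n + s) : IsSkew B n := by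
  rw [Algebra.adjoin_singleton_eq_range_aeval] at hn hs
  obtain ⟨p, rfl⟩ := hn
  obtain ⟨q, rfl⟩ := hs
  simp only [AlgHom.toRingHom_eq_coe, RingHom.coe_coe] at hnil hss hfns ⊢
  have hf' : ∀ u w, B (f u) w = B u ((-f) w) := by
    intro u w
    rw [eq_comm, LinearMap.neg_apply, map_neg, neg_eq_iff_add_eq_zero, add_comm]
    exact hf u w
  have hp := apply_aeval_eq hf' p
  have hq := apply_aeval_eq hf' q
  set n := Polynomial.aeval f p
  set s := Polynomial.aeval f q
  set n' := Polynomial.aeval (-f) p with hn'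
  set s' := Polynomial.aeval (-f) q with hs'
  have hsum : n' + s' = -f := hB.eq_of_forall fun u w => by
    rw [LinearMap.add_apply, map_add, ← hp, ← hq, ← hf', ← LinearMap.add_apply, ← map_add,
      ← LinearMap.add_apply, ← hfns]
  have hnil' : IsNilpotent n' := by
    obtain ⟨k, hk⟩ := hnil
    refine ⟨k, hB.eq_of_forall fun u w => ?_⟩
    have := apply_aeval_eq hp (Polynomial.X ^ k) u w
    simp only [map_pow, Polynomial.aeval_X, hk] at this
    rw [← this]
    simp
  have hss' : s'.IsSemisimple := by
    refine Module.End.isSemisimple_of_squarefree_aeval_eq_zero hss.minpoly_squarefree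
      (hB.eq_of_forall fun u w => ?_)
    rw [← apply_aeval_eq hq, minpoly.aeval]
    simp
  have hc : Commute n s := by
    rw [commute_iff_eq, ← map_mul, ← map_mul, mul_comm]
  have hc' : Commute (-n') (-s') := by
    rw [commute_iff_eq, neg_mul_neg, neg_mul_neg, hn', hs', ← map_mul, ← map_mul, mul_comm]
  have huniq := Module.End.isNilpotent_isSemisimple_unique hnil hss hnil'.neg
    (Module.End.isSemisimple_neg.2 hss') hc hc' (by rw [← hfns, ← neg_add, hsum, neg_neg])
  intro u w
  rw [hp, ← map_add, huniq.1, LinearMap.neg_apply, add_neg_cancel, map_zero]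

omit hB [FiniteDimensional ℂ V] in
variable (B ε) in
/-- The endomorphism `x ↦ B w x • u - ε * B u x • w`, which is skew for `B`. -/
noncomputable def skewEnd (u w : V) : Module.End ℂ V :=
  (B w).smulRight u - ε • (B u).smulRight w

omit hB [FiniteDimensional ℂ V] in
theorem skewEnd_apply (u w x : V) : skewEnd B ε u w x = B w x • u - (ε * B u x) • w := by
  simp [skewEnd, smul_smul]

omit [FiniteDimensional ℂ V] in
theorem IsSignedForm.isSkew_skewEnd (u w : V) : IsSkew B (skewEnd B ε u w) := by
  intro x y
  simp only [skewEnd_apply, map_sub, map_smul, LinearMap.sub_apply, LinearMap.smul_apply,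
    smul_eq_mul]
  rw [hB.symm x u, hB.symm x w]
  linear_combination (-B u y * B w x) * hB.sq

omit hB [FiniteDimensional ℂ V] in
theorem skewEnd_commutator {f : Module.End ℂ V} (hf : IsSkew B f) {u w : V} {a b : ℂ}
    (hu : f u = a • u) (hw : f w = b • w) :
    f * skewEnd B ε u w - skewEnd B ε u w * f = (a + b) • skewEnd B ε u w := by
  refine LinearMap.ext fun x => ?_
  have h1 : B u (f x) = -(a * B u x) := by
    have := hf u x
    rw [hu, map_smul, LinearMap.smul_apply, smul_eq_mul] at this
    linear_combination this
  have h2 : B w (f x) = -(b * B w x) := by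
    have := hf w x
    rw [hw, map_smul, LinearMap.smul_apply, smul_eq_mul] at this
    linear_combination this
  simp only [LinearMap.sub_apply, Module.End.mul_apply, skewEnd_apply, map_sub, map_smul, hu, hw,
    h1, h2, LinearMap.smul_apply, smul_sub, smul_smul]
  module

end Form

end RootSubalgebra

/-! ### Weights and roots of orthogonal and symplectic algebras. -/

namespace RootSubalgebra

open LieAlgebra LieAlgebra.IsKilling LieModule

variable {L : Type*} [LieRing L] [LieAlgebra ℂ L] [FiniteDimensional ℂ L] [IsKilling ℂ L]
  {H : LieSubalgebra ℂ L} [H.IsCartanSubalgebra]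
  {V : Type*} [AddCommGroup V] [Module ℂ V] [FiniteDimensional ℂ V]
  {ψ : L →ₗ[ℂ] Module.End ℂ V} {B : V →ₗ[ℂ] V →ₗ[ℂ] ℂ} {ε : ℂ}

open Classical in
variable (H) in
/-- The set of weights `Λ` is stable under negation, and the weights up to sign are linearly
independent. -/
structure IsSkewWeights (Λ : Set (Module.Dual ℂ H)) : Prop where
  finite : Λ.Finite
  neg_mem : ∀ x ∈ Λ, -x ∈ Λ
  exists_apply : ∀ x ∈ Λ, x ≠ 0 →
    ∃ h : H, ∀ y ∈ Λ, y h = (if y = x then 1 else 0) - if y = -x then 1 else 0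

theorem IsFaithfulRep.exists_isSkewWeights (hψ : IsFaithfulRep ψ) (hB : IsSignedForm B ε)
    (hr : ∀ f, f ∈ Set.range ψ ↔ IsSkew B f) :
    ∃ Λ : Set (Module.Dual ℂ H), IsSkewWeights H Λ ∧
      (ε = 1 → ∀ α, α ∈ roots H ⊤ ↔ ∃ x ∈ Λ, ∃ y ∈ Λ, y ≠ x ∧ y ≠ -x ∧ α = x + y) ∧
      (ε = -1 → 0 ∉ Λ ∧ ∀ α, α ∈ roots H ⊤ ↔ ∃ x ∈ Λ, ∃ y ∈ Λ, y ≠ -x ∧ α = x + y) := by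
  obtain ⟨v, wt, hv⟩ := hψ.exists_isWeightBasis (H := H) fun h hh => hψ.isSemisimple
    (fun x n hn s hs hnil hss h =>
      (hr n).2 (hB.isSkew_of_mem_adjoin ((hr _).1 ⟨x, rfl⟩) hn hs hnil hss h)) hh
  have : IsAddTorsionFree (Module.Dual ℂ H) := .of_isTorsionFree ℂ _
  have hsymm0 : ∀ i j, B (v i) (v j) ≠ 0 → B (v j) (v i) ≠ 0 := by
    intro i j h
    rw [hB.symm] at h
    exact right_ne_zero_of_mul h
  have hinv : ∀ i j, B (v i) (v j) ≠ 0 → wt j = -wt i := by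
    intro i j hij
    refine LinearMap.ext fun h => ?_
    have := (hr _).1 ⟨(h : L), rfl⟩ (v i) (v j)
    rw [hv h i, hv h j, map_smul, map_smul, LinearMap.smul_apply, ← add_smul, smul_eq_mul,
      mul_eq_zero] at this
    have := this.resolve_right hij
    rw [LinearMap.neg_apply]
    linear_combination this
  have hpart : ∀ i, ∃ j, B (v i) (v j) ≠ 0 := by
    intro i
    by_contra! h
    refine v.ne_zero i (hB.nondegenerate _ fun w => ?_)
    have : B (v i) = 0 := v.ext fun j => by rw [h j, LinearMap.zero_apply]
    rw [this, LinearMap.zero_apply]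
  have hbr : ∀ i j (h : H), ψ h * skewEnd B ε (v i) (v j) - skewEnd B ε (v i) (v j) * ψ h =
      (wt i + wt j) h • skewEnd B ε (v i) (v j) := fun i j h =>
    skewEnd_commutator ((hr _).1 ⟨(h : L), rfl⟩) (hv h i) (hv h j)
  have hmem : ∀ i j, skewEnd B ε (v i) (v j) ∈ Set.range ψ := fun i j =>
    (hr _).2 (hB.isSkew_skewEnd _ _)
  have hcoef : ∀ i j k m, v.repr (skewEnd B ε (v i) (v j) (v k)) m =
      B (v j) (v k) * (if m = i then 1 else 0) -
        ε * B (v i) (v k) * (if m = j then 1 else 0) := by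
    intro i j k m
    rw [skewEnd_apply]
    simp only [map_sub, map_smul, Module.Basis.repr_self, Finsupp.sub_apply, Finsupp.smul_apply,
      Finsupp.single_apply, smul_eq_mul, eq_comm (a := m)]
  -- For opposite weights `skewEnd` has weight zero, so it comes from the Cartan subalgebra and acts
  -- diagonally. Comparing matrix entries gives explicit values of all weights.
  have hdiag : ∀ i j, wt i + wt j = 0 → ∃ h : H, ∀ k m,
      B (v j) (v k) * (if m = i then 1 else 0) - ε * B (v i) (v k) * (if m = j then 1 else 0) =
        wt k h * if m = k then 1 else 0 := by
    intro i j hij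
    obtain ⟨x, hx⟩ := hmem i j
    have hxH : x ∈ H := hψ.mem_of_commute fun h hh => by
      rw [hx]
      have := hbr i j ⟨h, hh⟩
      rw [hij, LinearMap.zero_apply, zero_smul] at this
      exact sub_eq_zero.1 this
    refine ⟨⟨x, hxH⟩, fun k m => ?_⟩
    rw [← hcoef, ← hx]
    have := hv ⟨x, hxH⟩ k
    simp only at this
    rw [this]
    simp [Finsupp.single_apply, eq_comm]
  -- Let `v j` be a partner of `v k` under the form. If `j ≠ i`, the diagonal operator of `v i` and
  -- `v j` would send `v k` to a vector with a `v i` component. If `j = i`, the common weight is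
  -- zero, but the operator of `v j` and `v k` has a nonzero eigenvalue on `v j`.
  have hinj : Function.Injective wt := by
    intro i k hik
    by_contra hne
    obtain ⟨j, hj⟩ := hpart k
    have hj' := hinv k j hj
    by_cases hji : j = i
    · subst hji
      have h0 : wt j + wt k = 0 := by rw [hj', neg_add_cancel]
      have h1 : wt j = 0 := by
        rw [← hik] at h0
        exact self_eq_neg.1 (eq_neg_of_add_eq_zero_left h0)
      obtain ⟨h, hh⟩ := hdiag j k h0
      have := hh j j
      simp [h1, hne] at this
      exact hj this
    · obtain ⟨h, hh⟩ := hdiag i j (by rw [hj', hik, add_neg_cancel])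
      have := hh k i
      simp [hne, Ne.symm hji] at this
      exact hsymm0 _ _ hj this
  have hpart' : ∀ i, ∃ j, B (v i) (v j) ≠ 0 ∧ wt j = -wt i := fun i =>
    (hpart i).imp fun j hj => ⟨hj, hinv i j hj⟩
  have hroot : ∀ α ∈ roots H ⊤, ∃ i j j', α = wt i + wt j' ∧ wt j' ≠ -wt i ∧ wt j' = -wt j ∧
      B (v j) (v j') ≠ 0 ∧ ∃ f, IsSkew B f ∧ v.repr (f (v j)) i ≠ 0 := by
    intro α hα
    obtain ⟨x, hx, h0⟩ := rootSpace_ne_bot_iff.1 hα.2.1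
    obtain ⟨i, j, rfl, hij⟩ := hψ.exists_coord_ne_zero hv hx h0
    obtain ⟨j', hj', hwt⟩ := hpart' j
    refine ⟨i, j, j', by rw [hwt, sub_eq_add_neg], fun h => hα.1 ?_, hwt, hj',
      ψ x, (hr _).1 ⟨x, rfl⟩, hij⟩
    rw [sub_eq_add_neg, ← hwt, h, add_neg_cancel]
  have hroot' : ∀ i j, wt j ≠ -wt i → (i ≠ j ∨ ε = -1) → wt i + wt j ∈ roots H ⊤ := by
    intro i j hij hε'
    refine mem_roots_top.2 ⟨fun h => hij (eq_neg_of_add_eq_zero_right h), ?_⟩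
    obtain ⟨x, hx⟩ := hmem i j
    refine rootSpace_ne_bot_iff.2 ⟨x, hψ.mem_rootSpace fun h => by rw [hx, hbr], fun h0 => ?_⟩
    obtain ⟨k, hk⟩ := hpart j
    have h1 := hcoef i j k i
    rw [← hx, h0, map_zero] at h1
    by_cases h2 : i = j
    · subst h2
      rw [hε'.resolve_left (fun h => h rfl)] at h1
      simp only [LinearMap.zero_apply, map_zero, Finsupp.coe_zero, Pi.zero_apply, if_true] at h1
      exact hk (by linear_combination (-1 / 2) * h1)
    · simp [h2] at h1
      exact hk h1.symm
  refine ⟨Set.range wt, ⟨Set.finite_range wt, ?_, ?_⟩, ?_, ?_⟩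
  · rintro _ ⟨i, rfl⟩
    obtain ⟨j, -, hj⟩ := hpart' i
    exact ⟨j, hj⟩
  · rintro _ ⟨i, rfl⟩ h0
    obtain ⟨j, hj, hwt⟩ := hpart' i
    have hij : i ≠ j := by
      rintro rfl
      exact h0 (self_eq_neg.1 hwt)
    obtain ⟨h, hh⟩ := hdiag i j (by rw [hwt, add_neg_cancel])
    have hb := hsymm0 _ _ hj
    -- The element `h` has eigenvalues `±B (v j) (v i)` on `v i` and `v j`, and zero on all other
    -- basis vectors.
    refine ⟨(B (v j) (v i))⁻¹ • h, ?_⟩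
    rintro _ ⟨k, rfl⟩
    rw [map_smul, smul_eq_mul, ← hwt]
    simp only [hinj.eq_iff]
    by_cases hki : k = i
    · subst hki
      have := hh k k
      simp only [if_true, if_neg hij] at this ⊢
      rw [mul_zero, sub_zero, mul_one, mul_one] at this
      rw [← this, inv_mul_cancel₀ hb, sub_zero]
    by_cases hkj : k = j
    · subst hkj
      have := hh i i
      simp only [if_true, if_neg hij, if_neg hki] at this ⊢
      rw [mul_zero, sub_zero, mul_one, mul_one] at this
      rw [hwt, LinearMap.neg_apply, ← this, mul_neg, inv_mul_cancel₀ hb, zero_sub]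
    · have := hh k k
      simp only [if_true, if_neg hki, if_neg hkj] at this ⊢
      rw [mul_zero, mul_zero, sub_zero, mul_one] at this
      rw [← this, mul_zero, sub_zero]
  · rintro rfl α
    constructor
    · intro hα
      obtain ⟨i, j, j', rfl, h1, h2, h3, f, hf, h4⟩ := hroot α hα
      refine ⟨_, ⟨i, rfl⟩, _, ⟨j', rfl⟩, fun h => ?_, h1, rfl⟩
      obtain rfl := hinj h
      -- As weights are distinct, `v j` pairs only with `v j'`. Thus a nonzero `v j'` component of
      -- `f (v j)` would make `B (v j) (f (v j))` nonzero, impossible for `f` skew and `B`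
      -- symmetric.
      have h5 : B (v j) = B (v j) (v j') • v.coord j' := by
        refine v.ext fun k => ?_
        rw [LinearMap.smul_apply, Module.Basis.coord_apply, Module.Basis.repr_self, smul_eq_mul]
        by_cases hk : k = j'
        · simp [hk]
        · rw [Finsupp.single_eq_of_ne (Ne.symm hk), mul_zero]
          by_contra hne
          exact hk (hinj ((hinv _ _ hne).trans h2.symm))
      have h6 := hf (v j) (v j)
      rw [hB.symm (f (v j)), one_mul, ← two_mul, h5] at h6
      simp [h3, h4] at h6
    · rintro ⟨_, ⟨i, rfl⟩, _, ⟨j, rfl⟩, h1, h2, rfl⟩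
      exact hroot' i j h2 (.inl fun h => h1 (by rw [h]))
  · rintro rfl
    refine ⟨?_, fun α => ⟨fun hα => ?_, ?_⟩⟩
    · rintro ⟨i, hi⟩
      obtain ⟨j, hj, hwt⟩ := hpart' i
      have : j = i := hinj (by rw [hwt, hi, neg_zero])
      subst this
      have := hB.symm (v j) (v j)
      exact hj (by linear_combination (1 / 2) * this)
    · obtain ⟨i, j, j', rfl, h1, -⟩ := hroot α hα
      exact ⟨_, ⟨i, rfl⟩, _, ⟨j', rfl⟩, h1, rfl⟩
    · rintro ⟨_, ⟨i, rfl⟩, _, ⟨j, rfl⟩, h1, rfl⟩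
      exact hroot' i j h1 (.inr rfl)

end RootSubalgebra

/-! ### The natural representations of the classical matrix algebras. -/

namespace RootSubalgebra

open LieAlgebra LieAlgebra.IsKilling LieModule

attribute [local instance] LieRing.ofAssociativeRing

section

variable {L : Type*} [LieRing L] [LieAlgebra ℂ L] {ι : Type*} [Fintype ι] [DecidableEq ι]
  {S : LieSubalgebra ℂ (Matrix ι ι ℂ)}

/-- The representation on `ι → ℂ` of a Lie algebra that is isomorphic to a Lie algebra of
matrices. -/
noncomputable def matrixRep (e : L ≃ₗ⁅ℂ⁆ S) : L →ₗ[ℂ] Module.End ℂ (ι → ℂ) :=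
  (Matrix.toLin' : Matrix ι ι ℂ ≃ₗ[ℂ] _).toLinearMap ∘ₗ S.toSubmodule.subtype ∘ₗ
    (e : L →ₗ[ℂ] S)

theorem matrixRep_apply (e : L ≃ₗ⁅ℂ⁆ S) (x : L) :
    matrixRep e x = Matrix.toLin' (e x : Matrix ι ι ℂ) := rfl

theorem isFaithfulRep_matrixRep (e : L ≃ₗ⁅ℂ⁆ S) : IsFaithfulRep (matrixRep e) where
  injective x y h := by
    rw [matrixRep_apply, matrixRep_apply] at h
    exact e.injective (Subtype.ext (Matrix.toLin'.injective h))
  map_lie x y := by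
    rw [matrixRep_apply, e.map_lie, LieSubalgebra.coe_bracket, Ring.lie_def, map_sub,
      Matrix.toLin'_mul, Matrix.toLin'_mul]
    rfl

theorem toLin'_mem_range_matrixRep (e : L ≃ₗ⁅ℂ⁆ S) (A : Matrix ι ι ℂ) :
    Matrix.toLin' A ∈ Set.range (matrixRep e) ↔ A ∈ S := by
  constructor
  · rintro ⟨x, hx⟩
    rw [← Matrix.toLin'.injective hx]
    exact (e x).2
  · intro h
    refine ⟨e.symm ⟨A, h⟩, ?_⟩
    rw [matrixRep_apply, e.apply_symm_apply]

theorem isSignedForm_toLinearMap₂' {G G' : Matrix ι ι ℂ} {ε : ℂ} (hε : ε * ε = 1)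
    (hG : G.transpose = ε • G) (hG' : G * G' = 1) :
    IsSignedForm (Matrix.toLinearMap₂' ℂ G) ε where
  sq := hε
  symm u w := by
    rw [Matrix.toLinearMap₂'_apply', Matrix.toLinearMap₂'_apply', Matrix.dotProduct_mulVec,
      ← Matrix.mulVec_transpose, hG, Matrix.smul_mulVec, smul_dotProduct, smul_eq_mul,
      dotProduct_comm]
  nondegenerate u h := by
    refine dotProduct_eq_zero _ fun w => ?_
    have := h (G'.mulVec w)
    rwa [Matrix.toLinearMap₂'_apply', Matrix.mulVec_mulVec, hG', Matrix.one_mulVec] at this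

theorem mem_range_matrixRep_iff_isSkew (G : Matrix ι ι ℂ)
    (e : L ≃ₗ⁅ℂ⁆ skewAdjointMatricesLieSubalgebra G) (f : Module.End ℂ (ι → ℂ)) :
    f ∈ Set.range (matrixRep e) ↔ IsSkew (Matrix.toLinearMap₂' ℂ G) f := by
  obtain ⟨A, rfl⟩ := Matrix.toLin'.surjective f
  rw [toLin'_mem_range_matrixRep, mem_skewAdjointMatricesLieSubalgebra,
    mem_skewAdjointMatricesSubmodule, Matrix.IsSkewAdjoint, ← isAdjointPair_toLinearMap₂']
  refine forall₂_congr fun u w => ?_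
  rw [map_neg, LinearMap.neg_apply, map_neg, eq_neg_iff_add_eq_zero]

end

variable {L : Type*} [LieRing L] [LieAlgebra ℂ L] [FiniteDimensional ℂ L] [IsKilling ℂ L]
  (H : LieSubalgebra ℂ L) [H.IsCartanSubalgebra] {ι : Type*} [Fintype ι] [DecidableEq ι]

theorem exists_isLinearWeights_of_sl (e : L ≃ₗ⁅ℂ⁆ SpecialLinear.sl ι ℂ) :
    ∃ (n : ℕ) (wt : Fin n → Module.Dual ℂ H), IsLinearWeights H wt := by
  refine ⟨_, (isFaithfulRep_matrixRep e).exists_isLinearWeights fun f => ?_⟩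
  obtain ⟨A, rfl⟩ := Matrix.toLin'.surjective f
  rw [toLin'_mem_range_matrixRep, Matrix.trace_toLin'_eq]
  exact LinearMap.mem_ker

theorem exists_isSkewWeights_of_so (e : L ≃ₗ⁅ℂ⁆ Orthogonal.so ι ℂ) :
    ∃ Λ : Set (Module.Dual ℂ H), IsSkewWeights H Λ ∧
      ∀ α, α ∈ roots H ⊤ ↔ ∃ x ∈ Λ, ∃ y ∈ Λ, y ≠ x ∧ y ≠ -x ∧ α = x + y := by
  obtain ⟨Λ, h1, h2, -⟩ := (isFaithfulRep_matrixRep e).exists_isSkewWeights (H := H)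
    (isSignedForm_toLinearMap₂' (G := 1) (G' := 1) (ε := 1) (by simp) (by simp) (by simp))
    (mem_range_matrixRep_iff_isSkew 1 e)
  exact ⟨Λ, h1, h2 rfl⟩

theorem exists_isSkewWeights_of_sp (e : L ≃ₗ⁅ℂ⁆ Symplectic.sp ι ℂ) :
    ∃ Λ : Set (Module.Dual ℂ H), IsSkewWeights H Λ ∧ 0 ∉ Λ ∧
      ∀ α, α ∈ roots H ⊤ ↔ ∃ x ∈ Λ, ∃ y ∈ Λ, y ≠ -x ∧ α = x + y := by
  obtain ⟨Λ, h1, -, h2⟩ := (isFaithfulRep_matrixRep e).exists_isSkewWeights (H := H)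
    (isSignedForm_toLinearMap₂' (G := Matrix.J ι ℂ) (G' := -Matrix.J ι ℂ) (ε := -1) (by simp)
      (by simp [Matrix.J_transpose]) (by simp [Matrix.J_squared]))
    (mem_range_matrixRep_iff_isSkew _ e)
  exact ⟨Λ, h1, h2 rfl⟩

end RootSubalgebra

/-! ### Type A inside type D. -/

namespace RootSubalgebra

open LieAlgebra LieAlgebra.IsKilling LieModule RootCone

variable {L : Type*} [LieRing L] [LieAlgebra ℂ L] [FiniteDimensional ℂ L] [IsKilling ℂ L]
  {H : LieSubalgebra ℂ L} [H.IsCartanSubalgebra]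

/-- Evaluation of a weight at an element of the Cartan subalgebra, as a real number. -/
noncomputable def evalRe (h : H) : Module.Dual ℂ H →+ ℝ where
  toFun x := (x h).re
  map_zero' := by simp
  map_add' := by simp

theorem isFolding_of_section {M M' : Type*} [AddCommGroup M] [AddCommGroup M'] {Φ : Set M}
    {Φ' : Set M'} (π : M' →+ M) (j : M →+ M') (hj : ∀ x, π (j x) = x) (hΦ' : Φ' = j '' Φ) :
    IsFolding Φ Φ' π (j + j) := by
  subst hΦ'
  refine ⟨?_, fun a ha => ⟨j a, ⟨a, ha, rfl⟩, j a, ⟨a, ha, rfl⟩, hj a, hj a, rfl⟩, ?_⟩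
  · rintro _ ⟨a, ha, rfl⟩
    rwa [hj]
  · rintro _ ⟨a, ha, rfl⟩ d hd had
    rw [hj] at had
    exact ⟨j d, ⟨d, hd, rfl⟩, hj d, a + d, had, map_add j a d⟩

namespace IsLinearWeights

variable {n : ℕ} {wt : Fin n → Module.Dual ℂ H} (hwt : IsLinearWeights H wt)
include hwt

theorem hasPair_of_rel {S P : Set (Module.Dual ℂ H)} {A B : Multiset (Module.Dual ℂ H)}
    (hc : IsConfig (roots H ⊤) S P) (h : Rel (roots H ⊤) S P A B) : HasPair (roots H ⊤) S P := by
  classical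
  choose g hg using hwt.exists_apply
  -- Functionals dual to the `wt i` need not exist on the space of weights. The extra coordinate 1
  -- makes such functionals available, and the roots become the edges on which it vanishes.
  let W : Set (Module.Dual ℂ H × ℝ) := {x | ∃ i, x = (wt i, 1) ∨ x = -(wt i, 1)}
  -- On `(wt k, 1)` the value is `(1 + ∑ j, (δ_ki - δ_kj)) / n = δ_ki`.
  let f : Fin n → Module.Dual ℂ H × ℝ →+ ℝ := fun i =>
    (AddMonoidHom.mulLeft (n : ℝ)⁻¹).comp
      (AddMonoidHom.snd _ _ + (∑ j, evalRe (g i j)).comp (AddMonoidHom.fst _ _))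
  have hf : ∀ i k, f i (wt k, 1) = if k = i then 1 else 0 := by
    intro i k
    have hn : (n : ℝ) ≠ 0 := by
      have := i.pos
      positivity
    have h1 : ∀ j, evalRe (g i j) (wt k) =
        (if k = i then 1 else 0) - if k = j then 1 else 0 := by
      intro j
      simp only [evalRe, AddMonoidHom.coe_mk, ZeroHom.coe_mk, hg]
      split_ifs <;> simp
    simp only [f, AddMonoidHom.comp_apply, AddMonoidHom.add_apply, AddMonoidHom.coe_snd,
      AddMonoidHom.coe_fst, AddMonoidHom.finsetSum_apply, h1, Finset.sum_sub_distrib,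
      AddMonoidHom.coe_mulLeft]
    by_cases hk : k = i <;> simp [hk, hn]
  let c : Module.Dual ℂ H × ℝ → Module.Dual ℂ H × ℝ →+ ℝ := fun v =>
    if h : ∃ i, v.1 = v.2 • wt i then v.2 • f h.choose else 0
  have hne : ∀ i j, (wt i, (1 : ℝ)) ≠ -(wt j, 1) := by
    intro i j h
    have := congrArg Prod.snd h
    norm_num at this
  have hcf : ∀ (e : ℝ) i, e ≠ 0 → c (e • wt i, e) = e • f i := by
    intro e i he
    have h : ∃ k, (e • wt i, e).1 = (e • wt i, e).2 • wt k := ⟨i, rfl⟩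
    have h1 := hwt.injective (smul_right_injective _ he h.choose_spec)
    simp only [c]
    rw [dif_pos h, ← h1]
  have hc1 : ∀ i, c (wt i, 1) = f i := fun i => by
    simpa using hcf 1 i one_ne_zero
  have hc2 : ∀ i, c (-(wt i, 1)) = -f i := fun i => by
    have := hcf (-1) i (by norm_num)
    simpa using this
  have hW : IsSignedBasis W c := by
    refine ⟨?_, ?_, ?_, ?_⟩
    · have : W = Set.range (fun i => (wt i, (1 : ℝ))) ∪ Set.range fun i => -(wt i, (1 : ℝ)) := by
        ext x
        simp only [W, Set.mem_ofPred_eq, Set.mem_union, Set.mem_range, exists_or, eq_comm]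
      rw [this]
      exact (Set.finite_range _).union (Set.finite_range _)
    · rintro _ ⟨i, rfl | rfl⟩
      · exact ⟨i, .inr rfl⟩
      · exact ⟨i, .inl (neg_neg _)⟩
    · rintro _ ⟨i, rfl | rfl⟩
      · rw [hc1, hf, if_pos rfl]
      · rw [hc2, AddMonoidHom.neg_apply, map_neg, hf, if_pos rfl, neg_neg]
    · rintro _ ⟨i, rfl | rfl⟩ _ ⟨k, rfl | rfl⟩ h1 h2
      · rw [hc1, hf, if_neg (by rintro rfl; exact h1 rfl)]
      · rw [hc1, map_neg, hf, if_neg (by rintro rfl; exact h2 rfl), neg_zero]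
      · rw [hc2, AddMonoidHom.neg_apply, hf,
          if_neg (by rintro rfl; exact h2 (neg_neg _).symm), neg_zero]
      · rw [hc2, AddMonoidHom.neg_apply, map_neg, hf, if_neg (by rintro rfl; exact h1 rfl),
          neg_zero, neg_zero]
  let U : AddSubgroup (Module.Dual ℂ H × ℝ) := (AddMonoidHom.snd _ _).ker
  have hΦ' : edges W ∩ U = AddMonoidHom.inl (Module.Dual ℂ H) ℝ '' roots H ⊤ := by
    have hroot : ∀ i j, i ≠ j → wt i - wt j ∈ roots H ⊤ := fun i j hij =>
      (hwt.mem_roots_iff _).2 ⟨i, j, hij, rfl⟩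
    ext x
    constructor
    · rintro ⟨⟨_, ⟨i, rfl | rfl⟩, _, ⟨k, rfl | rfl⟩, h1, h2, rfl⟩, hU⟩
      · have : (1 : ℝ) + 1 = 0 := hU
        norm_num at this
      · refine ⟨_, hroot i k (by rintro rfl; exact h2 rfl), ?_⟩
        simp [sub_eq_add_neg]
      · refine ⟨_, hroot k i (by rintro rfl; exact h2 (neg_neg _).symm), ?_⟩
        simp [sub_eq_neg_add]
      · have : -(1 : ℝ) + -1 = 0 := hU
        norm_num at this
    · rintro ⟨a, ha, rfl⟩
      obtain ⟨i, k, hik, rfl⟩ := (hwt.mem_roots_iff a).1 ha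
      refine ⟨⟨(wt i, 1), ⟨i, .inl rfl⟩, -(wt k, 1), ⟨k, .inr rfl⟩, fun h => hne i k h.symm,
        fun h => hik (hwt.injective (congrArg Prod.fst (neg_injective h)).symm), ?_⟩, rfl⟩
      simp [sub_eq_add_neg]
  exact (isFolding_of_section (AddMonoidHom.fst _ _) (AddMonoidHom.inl _ _) (fun _ => rfl)
    hΦ').hasPair_of_rel hW isRootSet_roots hc h

-- On the element `g` attached to `i` and `j`, the root `α` takes the value 2 and every root takes
-- values between -2 and 2. So `γ` must also take the value 2, which only `α` does.
omit [FiniteDimensional ℂ L] [IsKilling ℂ L] in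
theorem eq_of_sub_mem {α γ : Module.Dual ℂ H} (hα : α ∈ roots H ⊤) (hγ : γ ∈ roots H ⊤)
    (h : γ - 2 • α ∈ roots H ⊤) : γ = α := by
  obtain ⟨i, j, hij, rfl⟩ := (hwt.mem_roots_iff α).1 hα
  obtain ⟨k, l, hkl, rfl⟩ := (hwt.mem_roots_iff γ).1 hγ
  obtain ⟨m, o, hmo, h⟩ := (hwt.mem_roots_iff _).1 h
  obtain ⟨g, hg⟩ := hwt.exists_apply i j
  have h1 := congrArg (evalRe g) h
  have h2 : ∀ k, evalRe g (wt k) = (if k = i then 1 else 0) - if k = j then 1 else 0 := by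
    intro k
    simp only [evalRe, AddMonoidHom.coe_mk, ZeroHom.coe_mk, hg]
    split_ifs <;> simp
  simp only [map_sub, map_nsmul, h2, if_true, if_neg hij, if_neg hij.symm] at h1
  have h3 : k = i ∧ l = j := by
    by_contra hc
    rw [not_and_or] at hc
    split_ifs at h1 <;> first | omega | (norm_num at h1)
  rw [h3.1, h3.2]

end IsLinearWeights

end RootSubalgebra

/-! ### Skew weights: coordinates, parity, and long roots. -/

namespace RootSubalgebra

open LieAlgebra LieAlgebra.IsKilling LieModule RootCone

variable {L : Type*} [LieRing L] [LieAlgebra ℂ L]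
  {H : LieSubalgebra ℂ L}

theorem exists_half {M : Type*} [AddCommGroup M] :
    ∃ T : Set M, (∀ x, x ∈ T ∨ -x ∈ T) ∧ ∀ x, x ∈ T → -x ∈ T → x = -x := by
  classical
  have hne : ∀ x : M, ({x, -x} : Set M).Nonempty := fun x => ⟨x, .inl rfl⟩
  have hp : ∀ x : M, ({-x, - -x} : Set M) = {x, -x} := fun x => by
    rw [neg_neg, Set.pair_comm]
  let r : M → M := fun x => Classical.epsilon fun y => y ∈ ({x, -x} : Set M)
  have hr : ∀ x, r x ∈ ({x, -x} : Set M) := fun x => Classical.epsilon_spec (hne x)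
  have hr' : ∀ x, r (-x) = r x := fun x => by
    simp only [r, hp]
  refine ⟨{x | r x = x}, fun x => ?_, fun x h1 h2 => ?_⟩
  · rcases hr x with h | h
    · exact .inl h
    · refine .inr ?_
      change r (-x) = -x
      rw [hr', h]
  · change r (-x) = -x at h2
    rw [hr'] at h2
    exact (Eq.symm h1).trans h2

namespace IsSkewWeights

variable {Λ : Set (Module.Dual ℂ H)} (hΛ : IsSkewWeights H Λ)
include hΛ

open Classical in
theorem exists_evalRe : ∃ g : Module.Dual ℂ H → H, ∀ x ∈ Λ, x ≠ 0 → ∀ y ∈ Λ,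
    evalRe (g x) y = (if y = x then 1 else 0) - if y = -x then 1 else 0 := by
  have := hΛ.exists_apply
  choose! g hg using this
  refine ⟨g, fun x hx hx0 y hy => ?_⟩
  simp only [evalRe, AddMonoidHom.coe_mk, ZeroHom.coe_mk, hg x hx hx0 y hy]
  split_ifs <;> simp

/-- A functional that is odd on nonzero weights. -/
theorem exists_parity : ∃ f : Module.Dual ℂ H →+ ℝ, ∀ x ∈ Λ, x ≠ 0 → f x = 1 ∨ f x = -1 := by
  classical
  obtain ⟨g, hg⟩ := hΛ.exists_evalRe
  obtain ⟨T, hT1, hT2⟩ := exists_half (M := Module.Dual ℂ H)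
  have htf : IsAddTorsionFree (Module.Dual ℂ H) := .of_isTorsionFree ℂ _
  have hfin : {x ∈ Λ | x ∈ T ∧ x ≠ 0}.Finite := hΛ.finite.subset fun x h => h.1
  -- One nonzero weight from each pair of opposites; the sum of their coordinate functionals is `±1`
  -- on nonzero weights.
  let F := hfin.toFinset
  have hF : ∀ x, x ∈ F ↔ x ∈ Λ ∧ x ∈ T ∧ x ≠ 0 := fun x => hfin.mem_toFinset
  have key : ∀ x ∈ F, (∑ y ∈ F, evalRe (g y)) x = 1 := by
    intro x hx
    have hx' := (hF x).1 hx
    rw [AddMonoidHom.finsetSum_apply, Finset.sum_eq_single_of_mem x hx]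
    · rw [hg x hx'.1 hx'.2.2 x hx'.1, if_pos rfl, if_neg (fun h => hx'.2.2 (self_eq_neg.1 h)),
        sub_zero]
    · intro y hy hyx
      have hy' := (hF y).1 hy
      rw [hg y hy'.1 hy'.2.2 x hx'.1, if_neg hyx.symm, if_neg, sub_zero]
      rintro rfl
      exact hyx (hT2 y hy'.2.1 hx'.2.1)
  refine ⟨∑ y ∈ F, evalRe (g y), fun x hx hx0 => ?_⟩
  rcases hT1 x with h | h
  · exact .inl (key x ((hF x).2 ⟨hx, h, hx0⟩))
  · refine .inr ?_
    have := key (-x) ((hF _).2 ⟨hΛ.neg_mem x hx, h, neg_ne_zero.2 hx0⟩)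
    rw [map_neg] at this
    linarith

theorem isSignedBasis (h0 : 0 ∉ Λ) : ∃ c : Module.Dual ℂ H → Module.Dual ℂ H →+ ℝ,
    IsSignedBasis Λ c := by
  classical
  obtain ⟨g, hg⟩ := hΛ.exists_evalRe
  have htf : IsAddTorsionFree (Module.Dual ℂ H) := .of_isTorsionFree ℂ _
  have hne : ∀ x ∈ Λ, x ≠ 0 := fun x hx h => h0 (h ▸ hx)
  refine ⟨fun x => evalRe (g x), hΛ.finite, hΛ.neg_mem, fun x hx => ?_, fun x hx y hy h1 h2 => ?_⟩
  · rw [hg x hx (hne x hx) x hx, if_pos rfl, if_neg (fun h => hne x hx (self_eq_neg.1 h)),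
      sub_zero]
  · rw [hg x hx (hne x hx) y hy, if_neg h1, if_neg h2, sub_zero]

/-- No root has a coordinate below -1. Hence `γ` has coordinate at least 1 at both `x` and `y`, and
these are its ends. -/
theorem eq_of_sub_mem {Φ : Set (Module.Dual ℂ H)}
    (hΦ : ∀ α, α ∈ Φ ↔ ∃ x ∈ Λ, ∃ y ∈ Λ, y ≠ x ∧ y ≠ -x ∧ α = x + y)
    {x y γ : Module.Dual ℂ H} (hx : x ∈ Λ) (hy : y ∈ Λ) (hx0 : x ≠ 0) (hy0 : y ≠ 0) (hyx : y ≠ x)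
    (hyx' : y ≠ -x) (hγ : γ ∈ Φ) (h : γ - 2 • (x + y) ∈ Φ) : γ = x + y := by
  classical
  obtain ⟨g, hg⟩ := hΛ.exists_evalRe
  have htf : IsAddTorsionFree (Module.Dual ℂ H) := .of_isTorsionFree ℂ _
  have hle : ∀ z ∈ Λ, z ≠ 0 → ∀ u ∈ Λ, ∀ w ∈ Λ, w ≠ u → w ≠ -u →
      -1 ≤ evalRe (g z) (u + w) ∧ (1 ≤ evalRe (g z) (u + w) → u = z ∨ w = z) := by
    intro z hz hz0 u hu w hw h1 h2
    rw [map_add, hg z hz hz0 u hu, hg z hz hz0 w hw]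
    have hzz : z ≠ -z := fun h => hz0 (self_eq_neg.1 h)
    constructor
    · by_cases h3 : u = -z
      · subst h3
        rw [if_neg (fun h => hzz h.symm), if_pos rfl, if_neg (fun h => h1 h : ¬ w = -z)]
        split_ifs <;> norm_num
      · rw [if_neg h3]
        split_ifs <;> norm_num
    · intro h3
      by_contra! hc
      rw [if_neg hc.1, if_neg hc.2] at h3
      split_ifs at h3 <;> norm_num at h3
  obtain ⟨u, hu, w, hw, h1, h2, rfl⟩ := (hΦ γ).1 hγ
  obtain ⟨u', hu', w', hw', h3, h4, h5⟩ := (hΦ _).1 h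
  have hself : ∀ z ∈ Λ, z ≠ 0 → evalRe (g z) z = 1 := fun z hz hz0 => by
    rw [hg z hz hz0 z hz, if_pos rfl, if_neg (fun h => hz0 (self_eq_neg.1 h)), sub_zero]
  have hX : 1 ≤ evalRe (g x) (u + w) := by
    have h6 := (hle x hx hx0 u' hu' w' hw' h3 h4).1
    rw [← h5, map_sub, map_nsmul, map_add (evalRe (g x)) x y, hself x hx hx0,
      hg x hx hx0 y hy, if_neg hyx, if_neg hyx'] at h6
    norm_num at h6
    rw [map_add]
    linarith
  have hY : 1 ≤ evalRe (g y) (u + w) := by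
    have h6 := (hle y hy hy0 u' hu' w' hw' h3 h4).1
    rw [← h5, map_sub, map_nsmul, map_add (evalRe (g y)) x y, hself y hy hy0,
      hg y hy hy0 x hx, if_neg hyx.symm, if_neg (fun h => hyx' (by rw [h, neg_neg]))] at h6
    norm_num at h6
    rw [map_add]
    linarith
  rcases (hle x hx hx0 u hu w hw h1 h2).2 hX with rfl | rfl <;>
  rcases (hle y hy hy0 u hu w hw h1 h2).2 hY with h7 | h7
  · exact absurd h7.symm hyx
  · rw [h7]
  · rw [h7, add_comm]
  · exact absurd h7.symm hyx

/-- A root that fails the criterion is short, that is, a weight itself. Two short roots that are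
neither equal nor opposite have a root as their sum. -/
theorem forall_eq_or_forall_eq {Φ : Set (Module.Dual ℂ H)}
    (hΦ : ∀ α, α ∈ Φ ↔ ∃ x ∈ Λ, ∃ y ∈ Λ, y ≠ x ∧ y ≠ -x ∧ α = x + y) {α β : Module.Dual ℂ H}
    (hα : α ∈ Φ) (hβ : β ∈ Φ) (hne : α ≠ β) (hadd : α + β ∉ Φ) (hadd0 : α + β ≠ 0) :
    (∀ γ ∈ Φ, γ - 2 • α ∈ Φ → γ = α) ∨ ∀ γ ∈ Φ, γ - 2 • β ∈ Φ → γ = β := by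
  have key : ∀ α ∈ Φ, (∀ γ ∈ Φ, γ - 2 • α ∈ Φ → γ = α) ∨ α ∈ Λ := by
    intro α hα
    obtain ⟨x, hx, y, hy, h1, h2, rfl⟩ := (hΦ α).1 hα
    by_cases hx0 : x = 0
    · rw [hx0, zero_add]
      exact .inr hy
    by_cases hy0 : y = 0
    · rw [hy0, add_zero]
      exact .inr hx
    exact .inl fun γ hγ h => hΛ.eq_of_sub_mem hΦ hx hy hx0 hy0 h1 h2 hγ h
  rcases key α hα with h | h1
  · exact .inl h
  rcases key β hβ with h | h2
  · exact .inr h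
  exact absurd ((hΦ _).2 ⟨α, h1, β, h2, hne.symm,
    fun h => hadd0 (by rw [h, add_neg_cancel]), rfl⟩) hadd

end IsSkewWeights

end RootSubalgebra

/-! ### Types B and D as foldings of type D. -/

namespace RootSubalgebra

open LieAlgebra LieAlgebra.IsKilling LieModule RootCone

namespace IsSkewWeights

section

variable {L : Type*} [LieRing L] [LieAlgebra ℂ L] {H : LieSubalgebra ℂ L}
  {Λ : Set (Module.Dual ℂ H)}

/-- The nonzero weights, together with an additional pair of opposite vectors if zero is a
weight. -/
def extendedWeights (Λ : Set (Module.Dual ℂ H)) : Set (Module.Dual ℂ H × ℝ) :=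
  {v | (v.2 = 0 ∧ v.1 ∈ Λ ∧ v.1 ≠ 0) ∨ (v.1 = 0 ∧ 0 ∈ Λ ∧ (v.2 = 1 ∨ v.2 = -1))}

variable (hΛ : IsSkewWeights H Λ)
include hΛ

theorem isSignedBasis_extendedWeights :
    ∃ c : Module.Dual ℂ H × ℝ → Module.Dual ℂ H × ℝ →+ ℝ,
      IsSignedBasis (extendedWeights Λ) c := by
  classical
  obtain ⟨g, hg⟩ := hΛ.exists_evalRe
  have htf : IsAddTorsionFree (Module.Dual ℂ H) := .of_isTorsionFree ℂ _
  refine ⟨fun v => if v.1 = 0 then v.2 • AddMonoidHom.snd _ _ else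
    (evalRe (g v.1)).comp (AddMonoidHom.fst _ _), ?_, ?_, ?_, ?_⟩
  · refine (hΛ.finite.prod (Set.toFinite ({0, 1, -1} : Set ℝ))).subset ?_
    rintro ⟨x, t⟩ (⟨h1, h2, -⟩ | ⟨h1, h2, h3⟩)
    · exact ⟨h2, .inl h1⟩
    · exact ⟨by simp only at h1; rwa [h1], by simpa using Or.inr h3⟩
  · rintro ⟨x, t⟩ (⟨h1, h2, h3⟩ | ⟨h1, h2, h3⟩)
    · exact .inl ⟨by simpa using h1, hΛ.neg_mem x h2, by simpa using h3⟩
    · refine .inr ⟨by simpa using h1, h2, ?_⟩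
      rcases h3 with h3 | h3 <;> simp only at h3 <;> simp [h3]
  · rintro ⟨x, t⟩ (⟨h1, h2, h3⟩ | ⟨h1, h2, h3⟩)
    · simp only at h1 h2 h3
      simp only [if_neg h3, AddMonoidHom.comp_apply, AddMonoidHom.coe_fst]
      rw [hg x h2 h3 x h2, if_pos rfl, if_neg (fun h => h3 (self_eq_neg.1 h)), sub_zero]
    · simp only at h1 h3
      simp only [if_pos h1]
      rcases h3 with rfl | rfl <;> simp
  · rintro ⟨x, t⟩ (⟨h1, h2, h3⟩ | ⟨h1, h2, h3⟩) ⟨y, u⟩ (⟨h4, h5, h6⟩ | ⟨h4, h5, h6⟩) h7 h8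
    · simp only at h1 h2 h3 h4 h5 h6
      subst h1 h4
      simp only [if_neg h3, AddMonoidHom.comp_apply, AddMonoidHom.coe_fst]
      rw [hg x h2 h3 y h5, if_neg (fun h => h7 (by rw [h])),
        if_neg (fun h => h8 (by rw [h]; simp)), sub_zero]
    · simp only at h1 h2 h3 h4 h6
      subst h4
      simp [if_neg h3]
    · simp only at h1 h4
      subst h1 h4
      simp
    · simp only at h1 h3 h4 h6
      subst h1 h4
      rcases h3 with rfl | rfl <;> rcases h6 with rfl | rfl <;> simp at h7 h8

variable {Φ : Set (Module.Dual ℂ H)}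
  (hΦ : ∀ α, α ∈ Φ ↔ ∃ x ∈ Λ, ∃ y ∈ Λ, y ≠ x ∧ y ≠ -x ∧ α = x + y)

omit hΛ in
theorem mem_edges_extendedWeights (a : Module.Dual ℂ H) (t : ℝ) :
    (a, t) ∈ edges (extendedWeights Λ) ↔
      (t = 0 ∧ ∃ x ∈ Λ, ∃ y ∈ Λ, x ≠ 0 ∧ y ≠ 0 ∧ y ≠ x ∧ y ≠ -x ∧ a = x + y) ∨
      ((t = 1 ∨ t = -1) ∧ 0 ∈ Λ ∧ a ∈ Λ ∧ a ≠ 0) := by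
  constructor
  · rintro ⟨⟨x, t⟩, hx, ⟨y, u⟩, hy, h1, h2, h⟩
    rw [Prod.mk_add_mk, Prod.mk.injEq] at h
    obtain ⟨rfl, rfl⟩ := h
    rcases hx with ⟨h3, h4, h5⟩ | ⟨h3, h4, h5⟩ <;> rcases hy with ⟨h6, h7, h8⟩ | ⟨h6, h7, h8⟩ <;>
      simp only at h3 h4 h5 h6 h7 h8 <;> subst h3 h6
    · exact .inl ⟨add_zero _, x, h4, y, h7, h5, h8, fun h => h1 (by rw [h]),
        fun h => h2 (by rw [h]; simp), rfl⟩
    · rw [zero_add, add_zero]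
      exact .inr ⟨h8, h7, h4, h5⟩
    · rw [zero_add, add_zero]
      exact .inr ⟨h5, h4, h7, h8⟩
    · rcases h5 with rfl | rfl <;> rcases h8 with rfl | rfl <;> simp at h1 h2
  · rintro (⟨rfl, x, hx, y, hy, hx0, hy0, h1, h2, rfl⟩ | ⟨ht, h0, ha, ha0⟩)
    · refine ⟨(x, 0), .inl ⟨rfl, hx, hx0⟩, (y, 0), .inl ⟨rfl, hy, hy0⟩, fun h => h1 ?_,
        fun h => h2 ?_, by simp⟩
      · exact congrArg Prod.fst h
      · exact congrArg Prod.fst h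
    · refine ⟨(a, 0), .inl ⟨rfl, ha, ha0⟩, (0, t), .inr ⟨rfl, h0, ht⟩, fun h => ha0 ?_,
        fun h => ha0 ?_, by simp⟩
      · exact (congrArg Prod.fst h).symm
      · have := congrArg Prod.fst h
        simpa using this.symm

include hΦ

omit hΛ in
theorem mem_iff_long_or_short (a : Module.Dual ℂ H) : a ∈ Φ ↔
    (∃ x ∈ Λ, ∃ y ∈ Λ, x ≠ 0 ∧ y ≠ 0 ∧ y ≠ x ∧ y ≠ -x ∧ a = x + y) ∨
      (0 ∈ Λ ∧ a ∈ Λ ∧ a ≠ 0) := by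
  rw [hΦ]
  constructor
  · rintro ⟨x, hx, y, hy, h1, h2, rfl⟩
    by_cases hx0 : x = 0
    · subst hx0
      rw [zero_add]
      exact .inr ⟨hx, hy, h1⟩
    by_cases hy0 : y = 0
    · subst hy0
      rw [add_zero]
      exact .inr ⟨hy, hx, hx0⟩
    exact .inl ⟨x, hx, y, hy, hx0, hy0, h1, h2, rfl⟩
  · rintro (⟨x, hx, y, hy, hx0, hy0, h1, h2, rfl⟩ | ⟨h0, ha, ha0⟩)
    · exact ⟨x, hx, y, hy, h1, h2, rfl⟩
    · exact ⟨0, h0, a, ha, ha0, by rwa [neg_zero], by rw [zero_add]⟩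

/-- A long root lifts to itself and a short root `a` to `(a, 1)` and `(a, -1)`. The parity
functional is even on long roots and odd on short ones, so a root that is a sum of two short roots
is long, and opposite signs of the extra coordinate lift it. -/
theorem isFolding_edges : IsFolding Φ (edges (extendedWeights Λ) ∩ ((⊤ : AddSubgroup (Module.Dual ℂ H × ℝ)) : Set _))
    (AddMonoidHom.fst (Module.Dual ℂ H) ℝ)
    (AddMonoidHom.inl _ _ + AddMonoidHom.inl _ _) := by
  rw [AddSubgroup.coe_top, Set.inter_univ]
  obtain ⟨f, hf⟩ := hΛ.exists_parity
  have hlong : ∀ a, (∃ x ∈ Λ, ∃ y ∈ Λ, x ≠ 0 ∧ y ≠ 0 ∧ y ≠ x ∧ y ≠ -x ∧ a = x + y) →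
      f a = 2 ∨ f a = 0 ∨ f a = -2 := by
    rintro _ ⟨x, hx, y, hy, hx0, hy0, -, -, rfl⟩
    rw [map_add]
    rcases hf x hx hx0 with h | h <;> rcases hf y hy hy0 with h' | h' <;> rw [h, h'] <;> norm_num
  have hodd : ∀ a ∈ Λ, a ≠ 0 → ∀ n : ℤ, f a ≠ 2 * n := by
    intro a ha ha0 n h
    have : (1 : ℤ) = 2 * n ∨ (-1 : ℤ) = 2 * n := by
      rcases hf a ha ha0 with h' | h' <;> rw [h'] at h
      · exact .inl (by exact_mod_cast h)
      · exact .inr (by exact_mod_cast h)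
    omega
  have heven : ∀ a, (∃ x ∈ Λ, ∃ y ∈ Λ, x ≠ 0 ∧ y ≠ 0 ∧ y ≠ x ∧ y ≠ -x ∧ a = x + y) →
      ∃ n : ℤ, f a = 2 * n := by
    intro a ha
    rcases hlong a ha with h | h | h
    · exact ⟨1, by rw [h]; norm_num⟩
    · exact ⟨0, by rw [h]; norm_num⟩
    · exact ⟨-1, by rw [h]; norm_num⟩
  refine ⟨?_, ?_, ?_⟩
  · rintro ⟨a, t⟩ h
    rw [mem_edges_extendedWeights] at h
    exact (mem_iff_long_or_short hΦ a).2 (h.imp And.right And.right)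
  · intro a ha
    rcases (mem_iff_long_or_short hΦ a).1 ha with h | h
    · have := (mem_edges_extendedWeights a 0).2 (.inl ⟨rfl, h⟩)
      exact ⟨_, this, _, this, rfl, rfl, rfl⟩
    · exact ⟨_, (mem_edges_extendedWeights a 1).2 (.inr ⟨.inl rfl, h⟩), _,
        (mem_edges_extendedWeights a (-1)).2 (.inr ⟨.inr rfl, h⟩), rfl, rfl, by simp⟩
  · rintro ⟨a, t⟩ hat d hd had
    change a + d ∈ Φ at had
    rw [mem_edges_extendedWeights] at hat
    rw [mem_iff_long_or_short hΦ] at hd had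
    rcases hat with ⟨rfl, ha⟩ | ⟨ht, ha⟩ <;> rcases hd with hd | hd <;> rcases had with had | had
    · exact ⟨(d, 0), (mem_edges_extendedWeights d 0).2 (.inl ⟨rfl, hd⟩), rfl,
        (mem_edges_extendedWeights _ _).2 (.inl ⟨add_zero _, had⟩)⟩
    · obtain ⟨m, hm⟩ := heven a ha
      obtain ⟨n, hn⟩ := heven d hd
      refine absurd ?_ (hodd _ had.2.1 had.2.2 (m + n))
      rw [map_add, hm, hn]
      push_cast
      ring
    · obtain ⟨m, hm⟩ := heven a ha
      obtain ⟨n, hn⟩ := heven _ had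
      refine absurd ?_ (hodd _ hd.2.1 hd.2.2 (n - m))
      rw [map_add, hm] at hn
      push_cast
      linarith
    · exact ⟨(d, 1), (mem_edges_extendedWeights d 1).2 (.inr ⟨.inl rfl, hd⟩), rfl,
        (mem_edges_extendedWeights _ _).2 (.inr ⟨.inl (zero_add _), had⟩)⟩
    · obtain ⟨m, hm⟩ := heven d hd
      obtain ⟨n, hn⟩ := heven _ had
      refine absurd ?_ (hodd _ ha.2.1 ha.2.2 (n - m))
      rw [map_add, hm] at hn
      push_cast
      linarith
    · exact ⟨(d, 0), (mem_edges_extendedWeights d 0).2 (.inl ⟨rfl, hd⟩), rfl,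
        (mem_edges_extendedWeights _ _).2 (.inr ⟨by rwa [add_zero], had⟩)⟩
    · refine ⟨(d, -t), (mem_edges_extendedWeights d (-t)).2 (.inr ⟨?_, hd⟩), rfl,
        (mem_edges_extendedWeights _ _).2 (.inl ⟨add_neg_cancel _, had⟩)⟩
      rcases ht with rfl | rfl <;> simp
    · exfalso
      have h1 := hf a ha.2.1 ha.2.2
      have h2 := hf d hd.2.1 hd.2.2
      refine hodd _ had.2.1 had.2.2 (if f a = f d then (if f a = 1 then 1 else -1) else 0) ?_
      rw [map_add]
      rcases h1 with h1 | h1 <;> rcases h2 with h2 | h2 <;> rw [h1, h2] <;> norm_num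

end

end IsSkewWeights

end RootSubalgebra

/-! ### Type C as a folding of type A. -/

namespace RootSubalgebra

open LieAlgebra LieAlgebra.IsKilling LieModule RootCone

/-- The standard basis vectors and their negatives. -/
def signedStdBasis (ι : Type*) [DecidableEq ι] : Set (ι → ℝ) :=
  {x | ∃ i, x = Pi.single i 1 ∨ x = -Pi.single i 1}

/-- The dot product, as an additive map in its second argument. -/
noncomputable def dotHom {ι : Type*} [Fintype ι] (v : ι → ℝ) : (ι → ℝ) →+ ℝ where
  toFun w := v ⬝ᵥ w
  map_zero' := dotProduct_zero v
  map_add' := dotProduct_add v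

theorem isSignedBasis_signedStdBasis (ι : Type*) [Fintype ι] [DecidableEq ι] :
    IsSignedBasis (signedStdBasis ι) dotHom := by
  refine ⟨?_, ?_, ?_, ?_⟩
  · have : signedStdBasis ι = Set.range (fun i => Pi.single i (1 : ℝ)) ∪
        Set.range fun i => -Pi.single i (1 : ℝ) := by
      ext x
      simp only [signedStdBasis, Set.mem_ofPred_eq, Set.mem_union, Set.mem_range, exists_or,
        eq_comm]
    rw [this]
    exact (Set.finite_range _).union (Set.finite_range _)
  · rintro _ ⟨i, rfl | rfl⟩
    · exact ⟨i, .inr rfl⟩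
    · exact ⟨i, .inl (neg_neg _)⟩
  · rintro _ ⟨i, rfl | rfl⟩ <;> simp [dotHom]
  · rintro _ ⟨i, rfl | rfl⟩ _ ⟨k, rfl | rfl⟩ h1 h2 <;>
    · have : i ≠ k := by
        rintro rfl
        simp at h1 h2
      simp [dotHom, this]

/-- The vectors whose coordinates add up to zero. -/
def sumZero (ι : Type*) [Fintype ι] : AddSubgroup (ι → ℝ) :=
  (∑ i, Pi.evalAddMonoidHom (fun _ : ι => ℝ) i).ker

theorem mem_edges_inter_sumZero {ι : Type*} [Fintype ι] [DecidableEq ι] (x : ι → ℝ) :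
    x ∈ edges (signedStdBasis ι) ∩ sumZero ι ↔
      ∃ i j, i ≠ j ∧ x = Pi.single i 1 - Pi.single j 1 := by
  have hsum : ∀ i, (∑ i, Pi.evalAddMonoidHom (fun _ : ι => ℝ) i) (Pi.single i 1) = 1 := by
    intro i
    simp [AddMonoidHom.finsetSum_apply]
  constructor
  · rintro ⟨⟨_, ⟨i, rfl | rfl⟩, _, ⟨k, rfl | rfl⟩, h1, h2, rfl⟩, hU⟩ <;>
      rw [SetLike.mem_coe, sumZero, AddMonoidHom.mem_ker] at hU
    · rw [map_add, hsum, hsum] at hU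
      norm_num at hU
    · exact ⟨i, k, by rintro rfl; exact h2 rfl, by rw [sub_eq_add_neg]⟩
    · exact ⟨k, i, by rintro rfl; exact h2 (neg_neg _).symm, by rw [sub_eq_neg_add]⟩
    · rw [map_add, map_neg, map_neg, hsum, hsum] at hU
      norm_num at hU
  · rintro ⟨i, j, hij, rfl⟩
    refine ⟨⟨_, ⟨i, .inl rfl⟩, _, ⟨j, .inr rfl⟩, fun h => ?_, fun h => ?_, by rw [sub_eq_add_neg]⟩,
      ?_⟩
    · have := congrFun h i
      simp [hij] at this
    · have := congrFun h i
      simp [hij] at this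
    · rw [SetLike.mem_coe, sumZero, AddMonoidHom.mem_ker, map_sub, hsum, hsum, sub_self]

namespace IsSkewWeights

variable {L : Type*} [LieRing L] [LieAlgebra ℂ L] {H : LieSubalgebra ℂ L}
  {Λ : Set (Module.Dual ℂ H)} (hΛ : IsSkewWeights H Λ)

section

variable [Fintype Λ]

/-- The linear combination of the weights with the given coefficients. -/
noncomputable def combination (Λ : Set (Module.Dual ℂ H)) [Fintype Λ] :
    (Λ → ℝ) →+ Module.Dual ℂ H where
  toFun z := ∑ i, (z i : ℂ) • (i : Module.Dual ℂ H)
  map_zero' := by simp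
  map_add' := by simp [add_smul, Finset.sum_add_distrib]

theorem combination_single [DecidableEq Λ] (i : Λ) :
    combination Λ (Pi.single i 1) = (i : Module.Dual ℂ H) := by
  rw [combination, AddMonoidHom.coe_mk, ZeroHom.coe_mk, Finset.sum_eq_single i]
  · simp
  · intro j _ hj
    simp [hj]
  · simp

theorem combination_sub [DecidableEq Λ] (i j : Λ) :
    combination Λ (Pi.single i 1 - Pi.single j 1) = (i : Module.Dual ℂ H) + -j := by
  rw [map_sub, combination_single, combination_single, sub_eq_add_neg]

-- Coordinates are indexed by the weights, including both signs, and `e_x - e_{-y}` lies over `x +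
-- y`. The second lift is `e_y - e_{-x}`, which coincides with the first for a long root; the two
-- add up to `s (x + y)` for `s x = e_x - e_{-x}`.
include hΛ in
theorem exists_isFolding_symplecticEdges [DecidableEq Λ] (h0 : 0 ∉ Λ) :
    ∃ s, IsFolding (symplecticEdges Λ) (edges (signedStdBasis Λ) ∩ sumZero Λ)
      (combination Λ) s := by
  classical
  obtain ⟨g, hg⟩ := hΛ.exists_evalRe
  obtain ⟨c, hW⟩ := hΛ.isSignedBasis h0
  have hne : ∀ x ∈ Λ, x ≠ 0 := fun x hx h => h0 (h ▸ hx)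
  let s : Module.Dual ℂ H →+ (Λ → ℝ) := AddMonoidHom.pi fun i => evalRe (g i)
  have hs : ∀ x (hx : x ∈ Λ),
      s x = Pi.single ⟨x, hx⟩ 1 - Pi.single ⟨-x, hΛ.neg_mem x hx⟩ 1 := by
    intro x hx
    funext i
    have h1 : x = i ↔ i = ⟨x, hx⟩ := by rw [eq_comm, Subtype.ext_iff]
    have h2 : x = -i ↔ i = ⟨-x, hΛ.neg_mem x hx⟩ := by
      rw [Subtype.ext_iff, eq_comm, neg_eq_iff_eq_neg]
    change evalRe (g i) x = _
    rw [hg i i.2 (hne i i.2) x hx]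
    simp only [Pi.sub_apply, Pi.single_apply, h1, h2]
  have hmem : ∀ x (hx : x ∈ Λ) y (hy : y ∈ Λ), y ≠ -x →
      Pi.single (⟨x, hx⟩ : Λ) (1 : ℝ) - Pi.single ⟨-y, hΛ.neg_mem y hy⟩ 1 ∈
        edges (signedStdBasis Λ) ∩ sumZero Λ := by
    intro x hx y hy h
    refine (mem_edges_inter_sumZero _).2 ⟨_, _, fun h' => h ?_, rfl⟩
    rw [show x = -y from congrArg Subtype.val h', neg_neg]
  refine ⟨s, ?_, ?_, ?_⟩
  · intro x hx
    obtain ⟨i, j, hij, rfl⟩ := (mem_edges_inter_sumZero x).1 hx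
    rw [combination_sub]
    exact ⟨i, i.2, -j, hΛ.neg_mem j j.2, fun h => hij (Subtype.ext (neg_injective h).symm), rfl⟩
  · rintro _ ⟨x, hx, y, hy, h, rfl⟩
    refine ⟨_, hmem x hx y hy h, _, hmem y hy x hx fun h' => h (by rw [h', neg_neg]), ?_, ?_, ?_⟩
    · rw [combination_sub, neg_neg]
    · rw [combination_sub, neg_neg, add_comm]
    · rw [map_add, hs x hx, hs y hy]
      abel
  · intro v hv d hd hvd
    obtain ⟨i, j, hij, rfl⟩ := (mem_edges_inter_sumZero v).1 hv
    rw [combination_sub] at hvd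
    have hij' : (i : Module.Dual ℂ H) ≠ j := fun h => hij (Subtype.ext h)
    -- The end of `d` that is cancelled decides which of its two lifts can be added to `e_i - e_j`.
    have key : ∀ y ∈ Λ, ∀ z ∈ Λ, z ≠ -y → y = -(i : Module.Dual ℂ H) ∨ y = j →
        (i : Module.Dual ℂ H) + -j + (y + z) ∈ symplecticEdges Λ →
        ∃ w ∈ edges (signedStdBasis Λ) ∩ sumZero Λ, combination Λ w = y + z ∧
          Pi.single i 1 - Pi.single j 1 + w ∈ edges (signedStdBasis Λ) ∩ sumZero Λ := by
      intro y hy z hz hyz h hsum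
      have hsum0 : (i : Module.Dual ℂ H) + -j + (y + z) ≠ 0 := by
        obtain ⟨p, hp, q, hq, hpq, e⟩ := hsum
        rw [e]
        exact fun h => hpq (eq_neg_of_add_eq_zero_right h)
      have hzy : y ≠ -z := fun h => hyz (by rw [h, neg_neg])
      rcases h with rfl | rfl
      · refine ⟨_, hmem z hz _ hy hzy, by rw [combination_sub, neg_neg, add_comm],
          (mem_edges_inter_sumZero _).2 ⟨⟨z, hz⟩, j, ?_, ?_⟩⟩
        · rintro rfl
          apply hsum0
          abel
        · simp only [neg_neg]
          abel
      · refine ⟨_, hmem _ hy z hz hyz, by rw [combination_sub, neg_neg],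
          (mem_edges_inter_sumZero _).2 ⟨i, ⟨-z, hΛ.neg_mem z hz⟩, ?_, ?_⟩⟩
        · rintro rfl
          apply hsum0
          simp
        · simp
    obtain ⟨y, hy, z, hz, hyz, rfl⟩ := hd
    rcases hW.exists_cancel i.2 (hΛ.neg_mem j j.2) hy hz (fun h => hij' (neg_injective h).symm) hyz
      hvd with h | h | h | h
    · exact key y hy z hz hyz (.inl h) hvd
    · exact key y hy z hz hyz (.inr (by rw [h, neg_neg])) hvd
    · rw [add_comm y z] at hvd ⊢
      exact key z hz y hy (fun h' => hyz (by rw [h', neg_neg])) (.inl h) hvd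
    · rw [add_comm y z] at hvd ⊢
      exact key z hz y hy (fun h' => hyz (by rw [h', neg_neg])) (.inr (by rw [h, neg_neg])) hvd

end

variable [FiniteDimensional ℂ L] [IsKilling ℂ L] [H.IsCartanSubalgebra]
include hΛ

theorem hasPair_of_rel_orthogonal
    (hΦ : ∀ α, α ∈ roots H ⊤ ↔ ∃ x ∈ Λ, ∃ y ∈ Λ, y ≠ x ∧ y ≠ -x ∧ α = x + y)
    {S P : Set (Module.Dual ℂ H)} {A B : Multiset (Module.Dual ℂ H)}
    (hc : IsConfig (roots H ⊤) S P) (h : Rel (roots H ⊤) S P A B) :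
    HasPair (roots H ⊤) S P := by
  obtain ⟨c, hW⟩ := hΛ.isSignedBasis_extendedWeights
  exact (hΛ.isFolding_edges hΦ).hasPair_of_rel hW isRootSet_roots hc h

theorem hasPair_of_rel_symplectic (h0 : 0 ∉ Λ) (hΦ : roots H ⊤ = symplecticEdges Λ)
    {S P : Set (Module.Dual ℂ H)} {A B : Multiset (Module.Dual ℂ H)}
    (hc : IsConfig (roots H ⊤) S P) (h : Rel (roots H ⊤) S P A B) :
    HasPair (roots H ⊤) S P := by
  classical
  have := hΛ.finite.fintype
  obtain ⟨s, hs⟩ := hΛ.exists_isFolding_symplecticEdges h0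
  rw [← hΦ] at hs
  exact hs.hasPair_of_rel (isSignedBasis_signedStdBasis Λ) isRootSet_roots hc h

end IsSkewWeights

end RootSubalgebra

/-! ### The theorem for each classical type. -/

theorem mainTheorem3 {𝔤 : Type*} [LieRing 𝔤] [LieAlgebra ℂ 𝔤] [FiniteDimensional ℂ 𝔤]
    [LieAlgebra.IsSimple ℂ 𝔤] (𝔥 : LieSubalgebra ℂ 𝔤) [𝔥.IsCartanSubalgebra]
    (𝔟 : LieSubalgebra ℂ 𝔤) (h𝔟 : RootSubalgebra.IsBorel 𝔟) (h𝔥𝔟 : 𝔥 ≤ 𝔟)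
    (𝔩 : LieSubalgebra ℂ 𝔤) (h𝔥𝔩 : 𝔥 ≤ 𝔩)
    (hcone : ¬ RootSubalgebra.ConeCondition 𝔥 𝔟 𝔩) :
    ((∃ n : ℕ, Nonempty (𝔤 ≃ₗ⁅ℂ⁆ LieAlgebra.SpecialLinear.sl (Fin n) ℂ) ∨
          Nonempty (𝔤 ≃ₗ⁅ℂ⁆ LieAlgebra.Orthogonal.so (Fin (2 * n + 1)) ℂ) ∨
          Nonempty (𝔤 ≃ₗ⁅ℂ⁆ LieAlgebra.Orthogonal.so (Fin (2 * n)) ℂ)) →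
        ∃ ω : Module.Dual ℂ 𝔥, RootSubalgebra.IsStrictlyInfinite 𝔥 ⊤ 𝔟 𝔩 ω) ∧
      ((∃ n : ℕ, Nonempty (𝔤 ≃ₗ⁅ℂ⁆ LieAlgebra.Symplectic.sp (Fin n) ℂ)) →
        ∃ ω : Module.Dual ℂ 𝔥, RootSubalgebra.IsInfinite 𝔥 𝔟 𝔩 ω) := by
  have hso : ∀ n : ℕ, (𝔤 ≃ₗ⁅ℂ⁆ LieAlgebra.Orthogonal.so (Fin n) ℂ) →
      ∃ ω : Module.Dual ℂ 𝔥, RootSubalgebra.IsStrictlyInfinite 𝔥 ⊤ 𝔟 𝔩 ω := by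
    intro n e
    obtain ⟨Λ, hΛ, hΦ⟩ := RootSubalgebra.exists_isSkewWeights_of_so 𝔥 e
    exact RootSubalgebra.exists_isStrictlyInfinite h𝔟 h𝔥𝔟
      (fun S P A B hc h => hΛ.hasPair_of_rel_orthogonal hΦ hc h)
      (fun α hα β hβ hne hadd hadd0 => hΛ.forall_eq_or_forall_eq hΦ hα hβ hne hadd hadd0) hcone
  refine ⟨?_, ?_⟩
  · rintro ⟨n, h | h | h⟩
    · obtain ⟨e⟩ := h
      obtain ⟨m, wt, hwt⟩ := RootSubalgebra.exists_isLinearWeights_of_sl 𝔥 e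
      exact RootSubalgebra.exists_isStrictlyInfinite h𝔟 h𝔥𝔟 (fun S P A B hc h => hwt.hasPair_of_rel hc h)
        (fun α hα β hβ _ _ _ => .inl fun γ hγ h => hwt.eq_of_sub_mem hα hγ h) hcone
    · exact hso _ h.some
    · exact hso _ h.some
  · rintro ⟨n, ⟨e⟩⟩
    obtain ⟨Λ, hΛ, h0, hΦ⟩ := RootSubalgebra.exists_isSkewWeights_of_sp 𝔥 e
    obtain ⟨c, hW⟩ := hΛ.isSignedBasis h0
    have hΦ' : RootSubalgebra.roots 𝔥 ⊤ = RootCone.symplecticEdges Λ := Set.ext hΦ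
    exact RootSubalgebra.exists_isInfinite hW hΦ' h𝔟 h𝔥𝔟
      (fun S P A B hc h => hΛ.hasPair_of_rel_symplectic h0 hΦ' hc h) hcone
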